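/- Let $P_s^c, P_w^c, P_r^c, P_s, P_w, P_r$ be arbitrary sets satisfying the following conditions. (i) Each of the six sets is of the form $\{\infty\}$, $[p_0,\infty]$ or $(p_0,\infty]$ for some $p_0\in[1,\infty)$. (ii) $P_s\subset P_s^c$, $P_w\subset P_w^c$, $P_r\subset P_r^c$, $P_s^c\subset P_w^c\subset P_r^c\subset\overline{P_s^c}$ and $P_s\subset P_w\subset P_r\subset\overline{P_s}$, where $\overline E$ denotes the closure of $E$ in the usual topology of $\mathbb R\cup\{\infty\}$. (iii) $P_r^c=[1,\infty]$ implies $P_w^c=[1,\infty]$, and $P_r=[1,\infty]$ implies $P_w=[1,\infty]$. Then there is a metric measure space $Z$, that is, a nonempty metric space $(Z,\rho)$ with a nonnegative Borel measure $\mu$ for which every open ball has finite and strictly positive measure, such that $\mu$ is nondoubling (there is no $C<\infty$ with $\mu(B(x,2s))\le C\,\mu(B(x,s))$ for all $x\in Z$, $s>0$), and such that for the centered and noncentered Hardy--Littlewood maximal operators $$\mathcal M^c f(x)=\sup_{s>0}\frac1{\mu(B(x,s))}\int_{B(x,s)}|f|\,d\mu,\qquad \mathcal M f(x)=\sup_{B\ni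 x}\frac1{\mu(B)}\int_{B}|f|\,d\mu$$ (the second supremum is over all open balls $B$ containing $x$) the following holds for every $p\in[1,\infty]$: - $\mathcal M^c$ is of strong type $(p,p)$ if and only if $p\in P_s^c$; - $\mathcal M^c$ is of weak type $(p,p)$ if and only if $p\in P_w^c$; - $\mathcal M^c$ is of restricted weak type $(p,p)$ if and only if $p\in P_r^c$; - $\mathcal M$ is of strong type $(p,p)$ if and only if $p\in P_s$; - $\mathcal M$ is of weak type $(p,p)$ if and only if $p\in P_w$; - $\mathcal M$ is of restricted weak type $(p,p)$ if and only if $p\in P_r$. Here an operator is of strong type $(p,p)$ if it is bounded on $L^p(\mu)$; of weak type $(p,p)$ if it is bounded from $L^p(\mu)$ to $L^{p,\infty}(\mu)$; and of restricted weak type $(p,p)$ if it is bounded from $L^{p,1}(\mu)$ to $L^{p,\infty}(\mu)$, where for $p\in[1,\infty)$ $$\|f\|_{p,\infty}=\sup_{t>0}t\,\mu(\{|f|>t\})^{1/p},\qquad \|f\|_{p,1}=p\int_0^\infty\mu(\{|f|>t\})^{1/p}\,dt.$$ For $p=\infty$ weak type and restricted weak type both mean boundedness on $L^\infty(\mu)$.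 -/

import Mathlib

open MeasureTheory Set
open scoped ENNReal NNReal

noncomputable section

namespace MaximalTypes

/-- A set of exponents of the form `{∞}`, `[p₀, ∞]` or `(p₀, ∞]` with `p₀ ∈ [1, ∞)`. -/
def IsExponentRange (P : Set ℝ≥0∞) : Prop :=
  P = {∞} ∨ ∃ p₀ : ℝ≥0∞, 1 ≤ p₀ ∧ p₀ < ∞ ∧ (P = Icc p₀ ∞ ∨ P = Ioc p₀ ∞)

section Operators

variable {X : Type*} [MetricSpace X] [MeasurableSpace X]

/-- Every open ball has finite and strictly positive measure. -/
def BallsFinitePos (μ : Measure X) : Prop :=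
  ∀ (x : X) (s : ℝ), 0 < s → 0 < μ (Metric.ball x s) ∧ μ (Metric.ball x s) < ∞

/-- The doubling condition `|B(x, 2s)| ≤ C |B(x, s)|` with one finite constant for all balls. -/
def IsDoubling (μ : Measure X) : Prop :=
  ∃ C : ℝ≥0, ∀ (x : X) (s : ℝ), 0 < s →
    μ (Metric.ball x (2 * s)) ≤ C * μ (Metric.ball x s)

/-- The average of `|f|` over the ball `B(y, s)`. In `ℝ≥0∞` the value is `0` if the ball has
measure `0` or `∞`, so that such balls do not contribute to the suprema below. -/
def ballAverage (μ : Measure X) (f : X → ℂ) (y : X) (s : ℝ) : ℝ≥0∞ :=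
  (∫⁻ z in Metric.ball y s, ‖f z‖ₑ ∂μ) / μ (Metric.ball y s)

/-- The centered Hardy--Littlewood maximal operator. -/
def centeredMaximal (μ : Measure X) (f : X → ℂ) (x : X) : ℝ≥0∞ :=
  ⨆ (s : ℝ) (_ : 0 < s), ballAverage μ f x s

/-- The noncentered Hardy--Littlewood maximal operator: the supremum is over all open balls
that contain `x`. -/
def noncenteredMaximal (μ : Measure X) (f : X → ℂ) (x : X) : ℝ≥0∞ :=
  ⨆ (y : X) (s : ℝ) (_ : 0 < s) (_ : x ∈ Metric.ball y s), ballAverage μ f y s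

end Operators

section Types

variable {X : Type*} [MeasurableSpace X]

/-- The quasinorm of `L^{p,∞}`: `sup_{t > 0} t |{g > t}|^{1/p}` for finite `p`, while
`L^{∞,∞} = L^∞`. -/
def weakNorm (g : X → ℝ≥0∞) (p : ℝ≥0∞) (μ : Measure X) : ℝ≥0∞ :=
  if p = ∞ then eLpNorm g ∞ μ
  else ⨆ (t : ℝ≥0) (_ : 0 < t), (t : ℝ≥0∞) * μ {x | (t : ℝ≥0∞) < g x} ^ (1 / p.toReal)

/-- The quasinorm of the Lorentz space `L^{p,1}`, `p ∈ [1, ∞)`: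
`p ∫_0^∞ |{|f| > t}|^{1/p} dt`. -/
def lorentzOneNorm (f : X → ℂ) (p : ℝ≥0∞) (μ : Measure X) : ℝ≥0∞ :=
  p * ∫⁻ t in Ioi (0 : ℝ), μ {x | t < ‖f x‖} ^ (1 / p.toReal)

/-- Strong type `(p, p)`: boundedness on `L^p`. -/
def StrongType (T : (X → ℂ) → X → ℝ≥0∞) (p : ℝ≥0∞) (μ : Measure X) : Prop :=
  ∃ C : ℝ≥0, ∀ f : X → ℂ, MemLp f p μ → eLpNorm (T f) p μ ≤ C * eLpNorm f p μ

/-- Weak type `(p, p)`: boundedness from `L^p` to `L^{p,∞}`. -/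
def WeakType (T : (X → ℂ) → X → ℝ≥0∞) (p : ℝ≥0∞) (μ : Measure X) : Prop :=
  ∃ C : ℝ≥0, ∀ f : X → ℂ, MemLp f p μ → weakNorm (T f) p μ ≤ C * eLpNorm f p μ

/-- Restricted weak type `(p, p)`: boundedness from `L^{p,1}` to `L^{p,∞}` for finite `p`, and
boundedness on `L^∞` for `p = ∞`. -/
def RestrictedWeakType (T : (X → ℂ) → X → ℝ≥0∞) (p : ℝ≥0∞) (μ : Measure X) : Prop :=
  if p = ∞ then StrongType T ∞ μ
  else ∃ C : ℝ≥0, ∀ f : X → ℂ, AEStronglyMeasurable f μ → lorentzOneNorm f p μ < ∞ →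
    weakNorm (T f) p μ ≤ C * lorentzOneNorm f p μ

end Types

end MaximalTypes

end

/-! All distances in the space are 0, 1 or 2, so a ball is a point, a closed neighbourhood in a
graph, or the whole space. Start from a weighted bipartite graph (`LeafGraph`) with leaves x of
weight a(x) and sources y of weight b(y). The space consists of the sources, a centre and a target
for each leaf, and a hub carrying more than half of the total mass. All neighbourhoods except those
of the centres contain the hub, so averages over them are at most twice the global average. The
neighbourhood of the centre of x consists of that centre, the target, of mass a(x), and the sources
adjacent to x. Its mass lies between a(x) and 3a(x), and up to harmless terms the average over it is
Tφ(x) = a(x)⁻¹ ∑ b(y)φ(y), summed over y adjacent to x.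

The centered operator sees this average only at the centre, whose mass e(x) ≤ a(x) is free. The
noncentered operator sees it on the whole ball, in particular at the target. Hence the noncentered
types are those of T from (Y, b) to (X, a), and the centered ones are those of T from (Y, b) to (X,
e). On a disjoint union of G₁ and G₂ put e = a on G₁, and e = aδ with ∑ δ ≤ 1 on G₂. Then T on G₂ is
bounded on L¹ and on L^∞ for the weight e, so the centered operator has the types of G₁ while the
noncentered one has the common types of G₁ and G₂ (`exists_space`). As the noncentered sets lie
inside the centered ones, it suffices to realize each triple separately by some T.

In one triple (`exists_leafGraph_hasType_iff`) the inclusions and the closure condition force a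
common endpoint p₀, unless all sets are {∞}. What remains is the behaviour at p₀, where strong type
implies weak type and weak type implies restricted weak type. Stars, with one source and many leaves
of relative weights 2^j, give three of the four cases: about 2^{k(p₀-1)} leaves of weight 2^k give
all types at p₀; an extra factor k+1 destroys them all; spreading about 2^{j(p₀-1)} leaves over
every level j ≤ k destroys only the strong type. Restricted weak type without weak type comes from
dyadic trees: the leaves are the points of an interval, the sources its dyadic subintervals, and
those of length 2^j have relative weight proportional to ρ^j with ρ = 2^{-1/(p₀-1)}. Every level is
then critical at p₀. A function spread over all levels breaks the weak type, whereas for a pair of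
sets the contributions of the levels decay geometrically on both sides of a single one. This needs
p₀ > 1, in accordance with condition (iii), since L^{1,1} = L¹.

The measure is finite with infinitely many atoms, hence nondoubling, and at p = ∞ both operators are
contractions. -/

noncomputable section

namespace MaximalTypes

/-! ### Weighted strong, weak and Lorentz quasinorms on discrete sets -/

section WeightedSums

variable {ι κ : Type*}

/-- The mass of a set under a weight function on the points. -/
def mass (w : ι → ℝ≥0∞) (S : Set ι) : ℝ≥0∞ := ∑' i, S.indicator w i

/-- The `L^p` norm with respect to a weight. -/
def sNorm (w : ι → ℝ≥0∞) (p : ℝ) (g : ι → ℝ≥0∞) : ℝ≥0∞ := (∑' i, w i * g i ^ p) ^ (1 / p)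

/-- The `L^{p,∞}` quasinorm with respect to a weight. -/
def wNorm (w : ι → ℝ≥0∞) (p : ℝ) (g : ι → ℝ≥0∞) : ℝ≥0∞ :=
  ⨆ (t : ℝ≥0) (_ : 0 < t), (t : ℝ≥0∞) * mass w {i | (t : ℝ≥0∞) < g i} ^ (1 / p)

/-- The `L^{p,1}` quasinorm with respect to a weight. -/
def lNorm (w : ι → ℝ≥0∞) (p : ℝ) (φ : ι → ℝ≥0) : ℝ≥0∞ :=
  ENNReal.ofReal p * ∫⁻ t in Ioi (0 : ℝ), mass w {i | t < φ i} ^ (1 / p)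

/-- The three types of inequalities. -/
inductive Kind
  | strong
  | weak
  | restricted

/-- The (quasi)norm on the target side of an inequality of the given kind. -/
def tgt (k : Kind) (w : ι → ℝ≥0∞) (p : ℝ) (g : ι → ℝ≥0∞) : ℝ≥0∞ :=
  match k with
  | .strong => sNorm w p g
  | .weak => wNorm w p g
  | .restricted => wNorm w p g

/-- The (quasi)norm on the source side of an inequality of the given kind. -/
def src (k : Kind) (w : ι → ℝ≥0∞) (p : ℝ) (φ : ι → ℝ≥0) : ℝ≥0∞ :=
  match k with
  | .strong => sNorm w p (fun i => φ i)
  | .weak => sNorm w p (fun i => φ i)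
  | .restricted => lNorm w p φ

/-- Boundedness of an operator in the sense of the given kind. -/
def Bdd (k : Kind) (p : ℝ) (w : ι → ℝ≥0∞) (v : κ → ℝ≥0∞) (U : (ι → ℝ≥0) → κ → ℝ≥0∞) : Prop :=
  ∃ C : ℝ≥0, ∀ φ, tgt k v p (U φ) ≤ C * src k w p φ

lemma mass_mono (w : ι → ℝ≥0∞) {S T : Set ι} (h : S ⊆ T) : mass w S ≤ mass w T :=
  ENNReal.tsum_le_tsum fun i => indicator_le_indicator_of_subset h (fun _ => zero_le) i

lemma mass_union_le (w : ι → ℝ≥0∞) (S T : Set ι) : mass w (S ∪ T) ≤ mass w S + mass w T := by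
  unfold mass
  rw [← ENNReal.tsum_add]
  refine ENNReal.tsum_le_tsum fun i => ?_
  by_cases hS : i ∈ S <;> by_cases hT : i ∈ T <;> simp [indicator, hS, hT]

lemma mass_le_tsum (w : ι → ℝ≥0∞) (S : Set ι) : mass w S ≤ ∑' i, w i :=
  ENNReal.tsum_le_tsum fun i => indicator_le_self' (fun _ _ => zero_le) i

@[simp] lemma mass_univ (w : ι → ℝ≥0∞) : mass w univ = ∑' i, w i := by simp [mass]

lemma mass_singleton (w : ι → ℝ≥0∞) (i : ι) : mass w {i} = w i := by
  unfold mass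
  rw [tsum_eq_single i]
  · simp
  · intro j hj; simp [hj]

lemma le_mass (w : ι → ℝ≥0∞) {S : Set ι} {i : ι} (h : i ∈ S) : w i ≤ mass w S := by
  rw [← mass_singleton w i]
  exact mass_mono w (by simpa using h)

lemma mass_preimage_le {j : κ → ι} (hj : j.Injective) {w : ι → ℝ≥0∞} {v : κ → ℝ≥0∞}
    (h : ∀ i, v i ≤ w (j i)) (S : Set ι) : mass v (j ⁻¹' S) ≤ mass w S := by
  unfold mass
  refine le_trans (ENNReal.tsum_le_tsum fun i => ?_) (ENNReal.tsum_comp_le_tsum_of_injective hj _)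
  by_cases hi : j i ∈ S <;> simp [indicator, hi, h]

lemma mass_le_preimage {j : κ → ι} (hj : j.Injective) {w : ι → ℝ≥0∞} {v : κ → ℝ≥0∞}
    (h : ∀ i, w (j i) ≤ v i) {S : Set ι} (hS : S ⊆ range j) :
    mass w S ≤ mass v (j ⁻¹' S) := by
  unfold mass
  rw [← hj.tsum_eq (f := S.indicator w) (fun i hi => hS (by
    by_contra hc; simp [hc] at hi))]
  refine ENNReal.tsum_le_tsum fun i => ?_
  by_cases hi : j i ∈ S <;> simp [indicator, hi, h]

lemma wNorm_mono (w : ι → ℝ≥0∞) {p : ℝ} (hp : 1 ≤ p) {g h : ι → ℝ≥0∞} (H : ∀ i, g i ≤ h i) :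
    wNorm w p g ≤ wNorm w p h := by
  unfold wNorm
  gcongr with t ht
  exact mass_mono w fun i hi => lt_of_lt_of_le hi (H i)

lemma le_wNorm (w : ι → ℝ≥0∞) (p : ℝ) (g : ι → ℝ≥0∞) {t : ℝ≥0} (ht : 0 < t) :
    (t : ℝ≥0∞) * mass w {i | (t : ℝ≥0∞) < g i} ^ (1 / p) ≤ wNorm w p g :=
  le_iSup₂ (f := fun (t : ℝ≥0) (_ : 0 < t) =>
    (t : ℝ≥0∞) * mass w {i | (t : ℝ≥0∞) < g i} ^ (1 / p)) t ht

lemma tgt_mono (k : Kind) (w : ι → ℝ≥0∞) {p : ℝ} (hp : 1 ≤ p) {g h : ι → ℝ≥0∞}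
    (H : ∀ i, g i ≤ h i) : tgt k w p g ≤ tgt k w p h := by
  have hs : sNorm w p g ≤ sNorm w p h := by
    unfold sNorm
    gcongr with i
    exact H i
  cases k <;> simp only [tgt, hs, wNorm_mono w hp H]

lemma rpow_inv_add_le {p : ℝ} (hp : 1 ≤ p) (x y : ℝ≥0∞) :
    (x + y) ^ (1 / p) ≤ x ^ (1 / p) + y ^ (1 / p) :=
  ENNReal.rpow_add_le_add_rpow _ _ (by positivity) (by rw [div_le_one (by linarith)]; exact hp)

/-- The level sets of a maximum are unions of level sets, so the subadditivity of x ↦ x^{1/p} gives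
constant 1 even for the weak quasinorm. Sums are then handled through g + h ≤ 2 max(g, h). -/
lemma tgt_sup_le (k : Kind) (w : ι → ℝ≥0∞) {p : ℝ} (hp : 1 ≤ p) (g h : ι → ℝ≥0∞) :
    tgt k w p (g ⊔ h) ≤ tgt k w p g + tgt k w p h := by
  have hs : sNorm w p (g ⊔ h) ≤ sNorm w p g + sNorm w p h := by
    unfold sNorm
    refine le_trans ?_ (rpow_inv_add_le hp _ _)
    rw [← ENNReal.tsum_add]
    gcongr with i
    rw [← mul_add]
    gcongr
    rcases le_total (g i) (h i) with H | H <;> simp [H]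
  have hw : wNorm w p (g ⊔ h) ≤ wNorm w p g + wNorm w p h := by
    refine iSup₂_le fun t ht => ?_
    refine le_trans ?_ (add_le_add (le_wNorm w p g ht) (le_wNorm w p h ht))
    rw [← mul_add]
    gcongr
    refine le_trans ?_ (rpow_inv_add_le hp _ _)
    gcongr
    refine le_trans (mass_mono w fun i hi => ?_) (mass_union_le w _ _)
    simpa [lt_sup_iff] using hi
  cases k
  exacts [hs, hw, hw]

lemma tgt_const_mul_le (k : Kind) (w : ι → ℝ≥0∞) {p : ℝ} (hp : 1 ≤ p) {c : ℝ≥0} (hc : 0 < c)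
    (g : ι → ℝ≥0∞) : tgt k w p (fun i => c * g i) ≤ c * tgt k w p g := by
  have hp0 : 0 < p := by linarith
  have hs : sNorm w p (fun i => c * g i) ≤ c * sNorm w p g := by
    unfold sNorm
    have : ∑' i, w i * (c * g i) ^ p = (c : ℝ≥0∞) ^ p * ∑' i, w i * g i ^ p := by
      rw [← ENNReal.tsum_mul_left]
      congr 1; ext i
      rw [ENNReal.mul_rpow_of_nonneg _ _ hp0.le]; ring
    rw [this, ENNReal.mul_rpow_of_nonneg _ _ (by positivity), ← ENNReal.rpow_mul,
      mul_one_div_cancel hp0.ne', ENNReal.rpow_one]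
  have hw : wNorm w p (fun i => c * g i) ≤ c * wNorm w p g := by
    refine iSup₂_le fun t ht => ?_
    have hc' : (c : ℝ≥0∞) ≠ 0 := by simpa using hc.ne'
    have : (t : ℝ≥0∞) = c * ((t / c : ℝ≥0) : ℝ≥0∞) := by
      rw [← ENNReal.coe_mul, mul_div_cancel₀ _ hc.ne']
    rw [this, mul_assoc]
    gcongr
    refine le_trans ?_ (le_wNorm w p g (div_pos ht hc))
    gcongr
    refine mass_mono w fun i hi => ?_
    simp only [mem_ofPred_eq] at hi ⊢
    rwa [ENNReal.mul_lt_mul_iff_right hc' ENNReal.coe_ne_top] at hi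
  cases k
  exacts [hs, hw, hw]

lemma tgt_add_le (k : Kind) (w : ι → ℝ≥0∞) {p : ℝ} (hp : 1 ≤ p) (g h : ι → ℝ≥0∞) :
    tgt k w p (fun i => g i + h i) ≤ 2 * (tgt k w p g + tgt k w p h) := by
  refine le_trans (tgt_mono k w hp (h := fun i => ((2 : ℝ≥0) : ℝ≥0∞) * (g ⊔ h) i) fun i => ?_) ?_
  · rw [ENNReal.coe_ofNat, two_mul]
    exact add_le_add le_sup_left le_sup_right
  · refine le_trans (tgt_const_mul_le k w hp two_pos _) ?_
    rw [ENNReal.coe_ofNat]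
    gcongr
    exact tgt_sup_le k w hp g h

lemma wNorm_le_sNorm (w : ι → ℝ≥0∞) {p : ℝ} (hp : 1 ≤ p) (g : ι → ℝ≥0∞) :
    wNorm w p g ≤ sNorm w p g := by
  have hp0 : 0 < p := by linarith
  refine iSup₂_le fun t ht => ?_
  have : (t : ℝ≥0∞) = ((t : ℝ≥0∞) ^ p) ^ (1 / p) := by
    rw [← ENNReal.rpow_mul, mul_one_div_cancel hp0.ne', ENNReal.rpow_one]
  rw [this, ← ENNReal.mul_rpow_of_nonneg _ _ (by positivity)]
  rw [← this]
  unfold sNorm mass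
  gcongr
  rw [← ENNReal.tsum_mul_left]
  refine ENNReal.tsum_le_tsum fun i => ?_
  by_cases hi : (t : ℝ≥0∞) < g i
  · simp only [indicator, mem_ofPred_eq, hi, if_true]
    rw [mul_comm]
    gcongr
  · simp [indicator, hi]

lemma ofReal_rpow_eq_lintegral (x : ℝ≥0) {p : ℝ} (hp : 0 < p) :
    (x : ℝ≥0∞) ^ p = ENNReal.ofReal p *
      ∫⁻ t in Ioi (0 : ℝ), (if t < x then 1 else 0) * ENNReal.ofReal (t ^ (p - 1)) := by
  have h := lintegral_rpow_eq_lintegral_meas_lt_mul (Measure.dirac ()) (f := fun _ => (x : ℝ))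
    (Filter.Eventually.of_forall fun _ => x.2) aemeasurable_const hp
  simp only [lintegral_dirac] at h
  have h2 : ENNReal.ofReal ((x : ℝ) ^ p) = (x : ℝ≥0∞) ^ p := by
    rw [← ENNReal.ofReal_rpow_of_nonneg x.coe_nonneg hp.le, ENNReal.ofReal_coe_nnreal]
  rw [h2] at h
  rw [h]
  congr 2
  ext t
  by_cases ht : t < x <;> simp [ht]

lemma tsum_mul_rpow_eq_lintegral [Countable ι] (w : ι → ℝ≥0∞) (φ : ι → ℝ≥0) {p : ℝ}
    (hp : 0 < p) : ∑' i, w i * (φ i : ℝ≥0∞) ^ p = ENNReal.ofReal p *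
      ∫⁻ t in Ioi (0 : ℝ), mass w {i | t < φ i} * ENNReal.ofReal (t ^ (p - 1)) := by
  have hm : ∀ i, Measurable fun t : ℝ =>
      (if t < φ i then (1 : ℝ≥0∞) else 0) * ENNReal.ofReal (t ^ (p - 1)) :=
    fun i => (Measurable.ite measurableSet_Iio measurable_const measurable_const).mul (by fun_prop)
  have : ∀ t : ℝ, mass w {i | t < φ i} * ENNReal.ofReal (t ^ (p - 1)) =
      ∑' i, w i * ((if t < φ i then 1 else 0) * ENNReal.ofReal (t ^ (p - 1))) := by
    intro t
    unfold mass
    rw [← ENNReal.tsum_mul_right]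
    congr 1; ext i
    by_cases h : t < φ i <;> simp [h]
  simp_rw [this]
  rw [lintegral_tsum fun i => ((hm i).const_mul _).aemeasurable,
    ← ENNReal.tsum_mul_left]
  congr 1; ext i
  rw [lintegral_const_mul _ (hm i), ofReal_rpow_eq_lintegral _ hp]
  ring

lemma mul_rpow_mass_le_lNorm (w : ι → ℝ≥0∞) {p : ℝ} (hp : 1 ≤ p) (φ : ι → ℝ≥0) (t : ℝ) :
    ENNReal.ofReal t * mass w {i | t < φ i} ^ (1 / p) ≤
      ∫⁻ t in Ioi (0 : ℝ), mass w {i | t < φ i} ^ (1 / p) := by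
  calc ENNReal.ofReal t * mass w {i | t < φ i} ^ (1 / p)
      = ∫⁻ s in Ioo 0 t, mass w {i | t < φ i} ^ (1 / p) := by
        simp [mul_comm]
    _ ≤ ∫⁻ s in Ioo 0 t, mass w {i | s < φ i} ^ (1 / p) := by
        refine setLIntegral_mono' measurableSet_Ioo fun s hs => ?_
        gcongr
        exact mass_mono w fun i hi => lt_trans hs.2 hi
    _ ≤ _ := lintegral_mono_set Ioo_subset_Ioi_self

/-- Write L for the integral in `lNorm`. In the layer cake formula p ∫ t^{p-1} w(φ > t) dt for the
p-th power of the norm, the bound t w(φ > t)^{1/p} ≤ L turns the integrand into at most L^{p-1} w(φ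
> t)^{1/p}. -/
lemma sNorm_le_lNorm [Countable ι] (w : ι → ℝ≥0∞) {p : ℝ} (hp : 1 ≤ p) (φ : ι → ℝ≥0) :
    sNorm w p (fun i => φ i) ≤ lNorm w p φ := by
  have hp0 : 0 < p := by linarith
  have hp1 : 1 ≤ ENNReal.ofReal p := by simpa using ENNReal.ofReal_le_ofReal hp
  unfold sNorm lNorm
  rw [tsum_mul_rpow_eq_lintegral w φ hp0]
  set L := ∫⁻ t in Ioi (0 : ℝ), mass w {i | t < φ i} ^ (1 / p) with hL
  have key : ∫⁻ t in Ioi (0 : ℝ), mass w {i | t < φ i} * ENNReal.ofReal (t ^ (p - 1)) ≤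
      L ^ (p - 1) * L := by
    have hmeas : Measurable fun t : ℝ => mass w {i | t < φ i} ^ (1 / p) := by
      refine Measurable.pow_const ?_ _
      refine Antitone.measurable fun s t hst => mass_mono w fun i hi => lt_of_le_of_lt hst hi
    rw [hL, ← lintegral_const_mul _ hmeas]
    refine setLIntegral_mono' measurableSet_Ioi fun t ht => ?_
    rw [← hL]
    have h1 := ENNReal.rpow_le_rpow (mul_rpow_mass_le_lNorm w hp φ t) (by linarith : 0 ≤ p - 1)
    rw [← hL] at h1
    calc mass w {i | t < φ i} * ENNReal.ofReal (t ^ (p - 1))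
        = (ENNReal.ofReal t * mass w {i | t < φ i} ^ (1 / p)) ^ (p - 1) *
            mass w {i | t < φ i} ^ (1 / p) := by
          rw [ENNReal.mul_rpow_of_nonneg _ _ (by linarith), mul_assoc, ← ENNReal.rpow_mul,
            ← ENNReal.rpow_add_of_nonneg _ _ (mul_nonneg (by positivity) (by linarith))
              (by positivity), ENNReal.ofReal_rpow_of_nonneg (le_of_lt ht) (by linarith), mul_comm]
          congr 1
          rw [show 1 / p * (p - 1) + 1 / p = 1 by field_simp; ring, ENNReal.rpow_one]
      _ ≤ _ := by gcongr
  calc (ENNReal.ofReal p * ∫⁻ t in Ioi (0 : ℝ),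
          mass w {i | t < φ i} * ENNReal.ofReal (t ^ (p - 1))) ^ (1 / p)
      ≤ (ENNReal.ofReal p ^ p * L ^ p) ^ (1 / p) := by
        gcongr
        · conv_lhs => rw [← ENNReal.rpow_one (ENNReal.ofReal p)]
          exact ENNReal.rpow_le_rpow_of_exponent_le hp1 hp
        · refine key.trans (le_of_eq ?_)
          conv_lhs => rw [← ENNReal.rpow_one L]
          rw [← ENNReal.rpow_mul, ← ENNReal.rpow_add_of_nonneg _ _ (by linarith) (by linarith)]
          congr 1; ring
    _ = ENNReal.ofReal p * L := by
        rw [← ENNReal.mul_rpow_of_nonneg _ _ hp0.le, ← ENNReal.rpow_mul,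
          mul_one_div_cancel hp0.ne', ENNReal.rpow_one]

lemma sNorm_le_src [Countable ι] (k : Kind) (w : ι → ℝ≥0∞) {p : ℝ} (hp : 1 ≤ p)
    (φ : ι → ℝ≥0) : sNorm w p (fun i => φ i) ≤ src k w p φ := by
  cases k
  exacts [le_rfl, le_rfl, sNorm_le_lNorm w hp φ]

lemma tgt_le_sNorm (k : Kind) (w : ι → ℝ≥0∞) {p : ℝ} (hp : 1 ≤ p)
    (g : ι → ℝ≥0∞) : tgt k w p g ≤ sNorm w p g := by
  cases k
  exacts [le_rfl, wNorm_le_sNorm w hp g, wNorm_le_sNorm w hp g]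

lemma Bdd.of_strong [Countable ι] (k : Kind) {p : ℝ} (hp : 1 ≤ p) {w : ι → ℝ≥0∞}
    {v : κ → ℝ≥0∞} {U : (ι → ℝ≥0) → κ → ℝ≥0∞} (h : Bdd .strong p w v U) : Bdd k p w v U := by
  obtain ⟨C, hC⟩ := h
  refine ⟨C, fun φ => (tgt_le_sNorm k v hp _).trans ((hC φ).trans ?_)⟩
  gcongr
  exact sNorm_le_src k w hp φ

lemma Bdd.restricted_of_weak [Countable ι] {p : ℝ} (hp : 1 ≤ p) {w : ι → ℝ≥0∞}
    {v : κ → ℝ≥0∞} {U : (ι → ℝ≥0) → κ → ℝ≥0∞} (h : Bdd .weak p w v U) :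
    Bdd .restricted p w v U := by
  obtain ⟨C, hC⟩ := h
  refine ⟨C, fun φ => (hC φ).trans ?_⟩
  gcongr
  exact sNorm_le_src .restricted w hp φ

lemma Bdd.restricted [Countable ι] {k : Kind} {p : ℝ} (hp : 1 ≤ p) {w : ι → ℝ≥0∞}
    {v : κ → ℝ≥0∞} {U : (ι → ℝ≥0) → κ → ℝ≥0∞} (h : Bdd k p w v U) : Bdd .restricted p w v U := by
  cases k
  exacts [h.of_strong _ hp, h.restricted_of_weak hp, h]

lemma tgt_comp_le (k : Kind) {p : ℝ} (hp : 1 ≤ p) {j : κ → ι} (hj : j.Injective)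
    {w : ι → ℝ≥0∞} {v : κ → ℝ≥0∞} (h : ∀ i, v i ≤ w (j i)) (g : ι → ℝ≥0∞) :
    tgt k v p (fun i => g (j i)) ≤ tgt k w p g := by
  have hs : sNorm v p (fun i => g (j i)) ≤ sNorm w p g := by
    unfold sNorm
    gcongr
    refine le_trans (ENNReal.tsum_le_tsum fun i => ?_)
      (ENNReal.tsum_comp_le_tsum_of_injective hj _)
    simp only
    gcongr
    exact h i
  have hw : wNorm v p (fun i => g (j i)) ≤ wNorm w p g := by
    unfold wNorm
    gcongr with t ht
    exact mass_preimage_le hj h {i | (t : ℝ≥0∞) < g i}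
  cases k
  exacts [hs, hw, hw]

lemma src_comp_le (k : Kind) {p : ℝ} (hp : 1 ≤ p) {j : κ → ι} (hj : j.Injective)
    {w : ι → ℝ≥0∞} {v : κ → ℝ≥0∞} (h : ∀ i, v i ≤ w (j i)) (φ : ι → ℝ≥0) :
    src k v p (fun i => φ (j i)) ≤ src k w p φ := by
  have hs := tgt_comp_le .strong hp hj h (fun i => (φ i : ℝ≥0∞))
  have hw : lNorm v p (fun i => φ (j i)) ≤ lNorm w p φ := by
    unfold lNorm
    gcongr with t
    exact mass_preimage_le hj h {i | t < φ i}
  cases k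
  exacts [hs, hs, hw]

lemma extend_eq_zero_or {α : Type*} [Zero α] {j : κ → ι} (hj : j.Injective) (g : κ → α) (i : ι) :
    (∃ x, j x = i ∧ Function.extend j g 0 i = g x) ∨
      (i ∉ range j ∧ Function.extend j g 0 i = 0) := by
  by_cases h : ∃ x, j x = i
  · obtain ⟨x, rfl⟩ := h
    exact .inl ⟨x, rfl, hj.extend_apply _ _ _⟩
  · exact .inr ⟨h, Function.extend_apply' _ _ _ h⟩

lemma tgt_extend_le (k : Kind) {p : ℝ} (hp : 1 ≤ p) {j : κ → ι} (hj : j.Injective)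
    {w : ι → ℝ≥0∞} {v : κ → ℝ≥0∞} (h : ∀ i, w (j i) ≤ v i) (g : κ → ℝ≥0∞) :
    tgt k w p (Function.extend j g 0) ≤ tgt k v p g := by
  have hs : sNorm w p (Function.extend j g 0) ≤ sNorm v p g := by
    unfold sNorm
    gcongr
    rw [← hj.tsum_eq]
    · refine ENNReal.tsum_le_tsum fun i => ?_
      rw [hj.extend_apply]
      gcongr
      exact h i
    · intro i hi
      rcases extend_eq_zero_or hj g i with ⟨x, hx, -⟩ | ⟨-, h0⟩
      · exact ⟨x, hx⟩
      · simp [h0, (by linarith : 0 < p)] at hi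
  have hw : wNorm w p (Function.extend j g 0) ≤ wNorm v p g := by
    unfold wNorm
    gcongr with t ht
    refine (mass_le_preimage hj h fun i hi => ?_).trans (mass_mono v fun i hi => ?_)
    · rcases extend_eq_zero_or hj g i with ⟨x, hx, -⟩ | ⟨-, h0⟩
      · exact ⟨x, hx⟩
      · simp [h0] at hi
    · simpa [hj.extend_apply] using hi
  cases k
  exacts [hs, hw, hw]

lemma src_extend_le (k : Kind) {p : ℝ} (hp : 1 ≤ p) {j : κ → ι} (hj : j.Injective)
    {w : ι → ℝ≥0∞} {v : κ → ℝ≥0∞} (h : ∀ i, w (j i) ≤ v i) (φ : κ → ℝ≥0) :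
    src k w p (Function.extend j φ 0) ≤ src k v p φ := by
  have hs : sNorm w p (fun i => (Function.extend j φ 0 i : ℝ≥0)) ≤ sNorm v p (fun i => φ i) := by
    have := tgt_extend_le .strong hp hj h (fun i => (φ i : ℝ≥0∞))
    refine le_trans (le_of_eq ?_) this
    simp only [tgt]
    congr 1
    ext i
    rcases extend_eq_zero_or hj φ i with ⟨x, hx, h1⟩ | ⟨h1, h0⟩
    · rw [h1, ← hx, hj.extend_apply]
    · rw [h0, Function.extend_apply' _ _ _ h1]; rfl
  have hw : lNorm w p (Function.extend j φ 0) ≤ lNorm v p φ := by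
    unfold lNorm
    gcongr 1
    refine setLIntegral_mono' measurableSet_Ioi fun t ht => ?_
    gcongr
    refine (mass_le_preimage hj h fun i hi => ?_).trans (mass_mono v fun i hi => ?_)
    · rcases extend_eq_zero_or hj φ i with ⟨x, hx, -⟩ | ⟨-, h0⟩
      · exact ⟨x, hx⟩
      · simp only [mem_ofPred_eq, h0] at hi
        exact absurd hi (not_lt.2 (le_of_lt ht))
    · simpa [hj.extend_apply] using hi
  cases k
  exacts [hs, hs, hw]

/-! ### Positive kernels: sufficient criteria and testing -/

/-- Jensen's inequality for weights of total mass at most 1; the missing mass can be placed at the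
value 0. -/
lemma rpow_tsum_mul_le {p : ℝ} (hp : 1 ≤ p) {c : ι → ℝ≥0∞} (hc : ∑' i, c i ≤ 1)
    (u : ι → ℝ≥0∞) : (∑' i, c i * u i) ^ p ≤ ∑' i, c i * u i ^ p := by
  have hp0 : 0 < p := by linarith
  have : ∑' i, c i * u i ≤ (∑' i, c i * u i ^ p) ^ p⁻¹ := by
    rw [ENNReal.tsum_eq_iSup_sum]
    refine iSup_le fun s => ?_
    refine (ENNReal.inner_le_weight_mul_Lp_of_nonneg s hp c u).trans ?_
    have h1 : (∑ i ∈ s, c i) ^ (1 - p⁻¹) ≤ 1 := by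
      refine ENNReal.rpow_le_one ((ENNReal.sum_le_tsum s).trans hc) ?_
      rw [sub_nonneg]
      exact inv_le_one_of_one_le₀ hp
    refine (mul_le_of_le_one_left zero_le h1).trans ?_
    gcongr
    exact ENNReal.sum_le_tsum s
  calc _ ≤ ((∑' i, c i * u i ^ p) ^ p⁻¹) ^ p := by gcongr
    _ = _ := by rw [← ENNReal.rpow_mul, inv_mul_cancel₀ hp0.ne', ENNReal.rpow_one]

/-- The positive operator with the given kernel. -/
def kernelOp (K : κ → ι → ℝ≥0∞) (φ : ι → ℝ≥0) (x : κ) : ℝ≥0∞ := ∑' y, K x y * φ y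

/-- Jensen's inequality with respect to c in each row moves the power p inside, onto L and φ.
Exchanging the sums leaves a condition on columns only. -/
lemma bdd_strong_of_schur {p : ℝ} (hp : 1 ≤ p) {w : ι → ℝ≥0∞} {v : κ → ℝ≥0∞}
    {K : κ → ι → ℝ≥0∞} (c L : κ → ι → ℝ≥0∞) (C : ℝ≥0) (hK : ∀ x y, K x y ≤ c x y * L x y)
    (hc : ∀ x, ∑' y, c x y ≤ 1) (hL : ∀ y, ∑' x, v x * (c x y * L x y ^ p) ≤ C * w y) :
    Bdd .strong p w v (kernelOp K) := by
  have hp0 : 0 < p := by linarith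
  refine ⟨C ^ (1 / p), fun φ => ?_⟩
  simp only [tgt, src, sNorm]
  rw [ENNReal.coe_rpow_of_nonneg _ (by positivity),
    ← ENNReal.mul_rpow_of_nonneg _ _ (by positivity)]
  gcongr
  calc ∑' x, v x * kernelOp K φ x ^ p
      ≤ ∑' x, v x * ∑' y, c x y * (L x y * φ y) ^ p := by
        gcongr with x
        refine le_trans ?_ (rpow_tsum_mul_le hp (hc x) _)
        gcongr
        refine ENNReal.tsum_le_tsum fun y => ?_
        rw [← mul_assoc]
        gcongr
        exact hK x y
    _ = ∑' y, (∑' x, v x * (c x y * L x y ^ p)) * (φ y : ℝ≥0∞) ^ p := by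
        simp_rw [← ENNReal.tsum_mul_left, ← ENNReal.tsum_mul_right]
        rw [ENNReal.tsum_comm]
        simp_rw [ENNReal.mul_rpow_of_nonneg _ _ hp0.le, mul_assoc]
    _ ≤ ∑' y, C * w y * (φ y : ℝ≥0∞) ^ p := by
        gcongr with y
        exact hL y
    _ = _ := by simp_rw [← ENNReal.tsum_mul_left, mul_assoc]

/-- Kernels that are bounded on `L^1` and on `L^∞` satisfy all inequalities. -/
lemma bdd_of_row_col [Countable ι] (k : Kind) {p : ℝ} (hp : 1 ≤ p) {w : ι → ℝ≥0∞}
    {v : κ → ℝ≥0∞} {K : κ → ι → ℝ≥0∞} (hr : ∀ x, ∑' y, K x y ≤ 1)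
    (hcol : ∀ y, ∑' x, v x * K x y ≤ w y) : Bdd k p w v (kernelOp K) :=
  (bdd_strong_of_schur hp K 1 1 (by simp) hr (by simpa using hcol)).of_strong k hp

lemma Bdd.of_le_add (k : Kind) {p : ℝ} (hp : 1 ≤ p) {w : ι → ℝ≥0∞}
    {v : κ → ℝ≥0∞} {U V W : (ι → ℝ≥0) → κ → ℝ≥0∞} (hV : Bdd k p w v V) (hW : Bdd k p w v W)
    (h : ∀ φ x, U φ x ≤ V φ x + W φ x) : Bdd k p w v U := by
  obtain ⟨C, hC⟩ := hV
  obtain ⟨D, hD⟩ := hW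
  refine ⟨2 * (C + D), fun φ => (tgt_mono k v hp (h φ)).trans ((tgt_add_le k v hp _ _).trans ?_)⟩
  push_cast
  rw [mul_assoc, add_mul]
  gcongr
  exacts [hC φ, hD φ]

lemma Bdd.of_le_const_mul (k : Kind) {p : ℝ} (hp : 1 ≤ p) {w : ι → ℝ≥0∞}
    {v : κ → ℝ≥0∞} {U V : (ι → ℝ≥0) → κ → ℝ≥0∞} (hV : Bdd k p w v V) {c : ℝ≥0} (hc : 0 < c)
    (h : ∀ φ x, U φ x ≤ c * V φ x) : Bdd k p w v U := by
  obtain ⟨C, hC⟩ := hV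
  refine ⟨c * C, fun φ => (tgt_mono k v hp (h φ)).trans ((tgt_const_mul_le k v hp hc _).trans ?_)⟩
  push_cast
  rw [mul_assoc]
  gcongr
  exact hC φ

/-- A restricted bilinear estimate yields the restricted weak type inequality. -/
lemma bdd_restricted_of_bilinear [Countable ι] [Countable κ] {p : ℝ} (hp : 1 ≤ p)
    {w : ι → ℝ≥0∞} {v : κ → ℝ≥0∞} (hv : ∑' x, v x ≠ ∞) {K : κ → ι → ℝ≥0∞} (C : ℝ≥0)
    (h : ∀ (E : Set κ) (F : Set ι), ∑' x, ∑' y, E.indicator v x * F.indicator (K x) y ≤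
      C * (mass v E ^ (1 - 1 / p) * mass w F ^ (1 / p))) :
    Bdd .restricted p w v (kernelOp K) := by
  have hp0 : 0 < p := by linarith
  have hp1 : 1 ≤ ENNReal.ofReal p := by simpa using ENNReal.ofReal_le_ofReal hp
  refine ⟨C, fun φ => iSup₂_le fun t ht => ?_⟩
  set E := {i | (t : ℝ≥0∞) < kernelOp K φ i} with hE
  simp only [src, lNorm]
  set L := ∫⁻ t in Ioi (0 : ℝ), mass w {i | t < φ i} ^ (1 / p) with hL
  suffices H : (t : ℝ≥0∞) * mass v E ^ (1 / p) ≤ C * L by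
    refine H.trans ?_
    gcongr
    exact le_mul_of_one_le_left zero_le hp1
  have hfin : mass v E ≠ ∞ := ne_top_of_le_ne_top hv (mass_le_tsum v E)
  rcases eq_or_ne (mass v E) 0 with h0 | h0
  · rw [h0, ENNReal.zero_rpow_of_pos (by positivity), mul_zero]
    exact zero_le
  -- Chebyshev's inequality on E, then the decomposition of φ into its superlevel sets, to each of
  -- which the bilinear estimate applies.
  have h1 : (t : ℝ≥0∞) * mass v E ≤ C * (mass v E ^ (1 - 1 / p) * L) := by
    calc (t : ℝ≥0∞) * mass v E ≤ ∑' x, E.indicator v x * kernelOp K φ x := by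
          unfold mass
          rw [← ENNReal.tsum_mul_left]
          refine ENNReal.tsum_le_tsum fun x => ?_
          by_cases hx : x ∈ E
          · rw [mul_comm]
            gcongr
            exact le_of_lt hx
          · simp [hx]
      _ = ∫⁻ s in Ioi (0 : ℝ), ∑' x, ∑' y, E.indicator v x *
            {i | s < φ i}.indicator (K x) y := by
          have hm : ∀ x y, Measurable fun s : ℝ =>
              E.indicator v x * {i | s < φ i}.indicator (K x) y := by
            intro x y
            refine Measurable.const_mul ?_ _
            have : (fun s : ℝ => {i | s < φ i}.indicator (K x) y) =
                fun s : ℝ => if s < φ y then K x y else 0 := by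
              ext s; simp [indicator]
            rw [this]
            exact Measurable.ite measurableSet_Iio measurable_const measurable_const
          rw [lintegral_tsum fun x => (Measurable.tsum (hm x)).aemeasurable]
          congr 1; ext x
          rw [lintegral_tsum fun y => (hm x y).aemeasurable]
          unfold kernelOp
          rw [← ENNReal.tsum_mul_left]
          congr 1; ext y
          have hy := ofReal_rpow_eq_lintegral (φ y) one_pos
          simp only [ENNReal.rpow_one, ENNReal.ofReal_one, one_mul, sub_self, Real.rpow_zero,
            mul_one] at hy
          rw [hy, ← mul_assoc, ← lintegral_const_mul _
            (Measurable.ite measurableSet_Iio measurable_const measurable_const)]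
          congr 1; ext s
          by_cases hs : s < φ y <;> simp [hs]
      _ ≤ ∫⁻ s in Ioi (0 : ℝ), C * mass v E ^ (1 - 1 / p) * mass w {i | s < φ i} ^ (1 / p) := by
          refine lintegral_mono fun s => (h E _).trans (le_of_eq ?_)
          ring
      _ = C * (mass v E ^ (1 - 1 / p) * L) := by
          have hmeas : Measurable fun t : ℝ => mass w {i | t < φ i} ^ (1 / p) := by
            refine Measurable.pow_const ?_ _
            refine Antitone.measurable fun s t hst => mass_mono w fun i hi => lt_of_le_of_lt hst hi
          rw [lintegral_const_mul _ hmeas, mul_assoc]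
  have hsplit : mass v E = mass v E ^ (1 - 1 / p) * mass v E ^ (1 / p) := by
    rw [← ENNReal.rpow_add _ _ h0 hfin, sub_add_cancel, ENNReal.rpow_one]
  have hne : mass v E ^ (1 - 1 / p) ≠ 0 := by simp [h0, hfin]
  have hnt : mass v E ^ (1 - 1 / p) ≠ ∞ := by simp [h0, hfin]
  -- Cancelling v(E)^{1-1/p} is legitimate because the total mass of v is finite.
  refine (ENNReal.mul_le_mul_iff_right hne hnt).1 ?_
  calc mass v E ^ (1 - 1 / p) * ((t : ℝ≥0∞) * mass v E ^ (1 / p))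
      = t * (mass v E ^ (1 - 1 / p) * mass v E ^ (1 / p)) := by ring
    _ = t * mass v E := by rw [← hsplit]
    _ ≤ _ := h1
    _ = _ := by ring

lemma lNorm_single (w : ι → ℝ≥0∞) {p : ℝ} (hp : 1 ≤ p) [DecidableEq ι] (y : ι) :
    lNorm w p (Pi.single y 1) ≤ ENNReal.ofReal p * w y ^ (1 / p) := by
  have hp0 : 0 < p := by linarith
  unfold lNorm
  gcongr
  calc ∫⁻ t in Ioi (0 : ℝ), mass w {i | t < (Pi.single y 1 : ι → ℝ≥0) i} ^ (1 / p)
      ≤ ∫⁻ t in Ioi (0 : ℝ), (Ioo (0 : ℝ) 1).indicator (fun _ => w y ^ (1 / p)) t := by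
        refine setLIntegral_mono' measurableSet_Ioi fun t ht => ?_
        have hsub : ∀ i ∈ {i | t < (Pi.single y 1 : ι → ℝ≥0) i}, i = y ∧ t < 1 := by
          intro i hi
          by_cases hiy : i = y
          · subst hiy; simpa using hi
          · simp only [mem_ofPred_eq, Pi.single_eq_of_ne hiy, NNReal.coe_zero] at hi
            exact absurd hi (not_lt.2 (le_of_lt ht))
        by_cases h1 : t < 1
        · rw [indicator_of_mem (show t ∈ Ioo (0 : ℝ) 1 from ⟨ht, h1⟩), ← mass_singleton w y]
          gcongr
          exact mass_mono w fun i hi => (hsub i hi).1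
        · have : {i | t < (Pi.single y 1 : ι → ℝ≥0) i} = ∅ :=
            eq_empty_of_forall_notMem fun i hi => h1 (hsub i hi).2
          rw [this]
          simp [mass, hp0]
    _ ≤ ∫⁻ t : ℝ, (Ioo (0 : ℝ) 1).indicator (fun _ => w y ^ (1 / p)) t :=
        setLIntegral_le_lintegral _ _
    _ = w y ^ (1 / p) := by
        rw [lintegral_indicator measurableSet_Ioo]; simp

/-- Testing the restricted weak type inequality on a single point. -/
lemma restricted_test {p : ℝ} (hp : 1 ≤ p) {w : ι → ℝ≥0∞} {v : κ → ℝ≥0∞} {K : κ → ι → ℝ≥0∞}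
    (h : Bdd .restricted p w v (kernelOp K)) :
    ∃ C : ℝ≥0, ∀ (y : ι) (E : Set κ) (t : ℝ≥0), 0 < t → (∀ x ∈ E, (2 * t : ℝ≥0) ≤ K x y) →
      (t : ℝ≥0∞) ^ p * mass v E ≤ C * w y := by
  classical
  have hp0 : 0 < p := by linarith
  obtain ⟨C, hC⟩ := h
  -- The factor p comes from the norm of the indicator of a point. The 2 in the assumption on K
  -- provides the strict inequality in the level set.
  refine ⟨(C * p.toNNReal) ^ p, fun y E t ht hE => ?_⟩
  have h1 : (t : ℝ≥0∞) * mass v E ^ (1 / p) ≤ C * (ENNReal.ofReal p * w y ^ (1 / p)) := by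
    calc _ ≤ (t : ℝ≥0∞) * mass v {x | (t : ℝ≥0∞) < kernelOp K (Pi.single y 1) x} ^ (1 / p) := by
          gcongr
          refine mass_mono v fun x hx => ?_
          have h2 : kernelOp K (Pi.single y 1) x = K x y := by
            unfold kernelOp
            rw [tsum_eq_single y]
            · simp
            · intro z hz; simp [hz]
          rw [mem_ofPred_eq, h2]
          refine lt_of_lt_of_le ?_ (hE x hx)
          rw [ENNReal.coe_lt_coe]
          exact lt_mul_of_one_lt_left ht one_lt_two
      _ ≤ _ := le_wNorm v p _ ht
      _ ≤ _ := hC _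
      _ ≤ _ := by
          gcongr
          exact lNorm_single w hp y
  have h2 := ENNReal.rpow_le_rpow h1 hp0.le
  rw [ENNReal.mul_rpow_of_nonneg _ _ hp0.le, ← mul_assoc, ENNReal.mul_rpow_of_nonneg _ _ hp0.le,
    ← ENNReal.rpow_mul, ← ENNReal.rpow_mul, one_div_mul_cancel hp0.ne', ENNReal.rpow_one,
    ENNReal.rpow_one] at h2
  rw [ENNReal.coe_rpow_of_nonneg _ hp0.le]
  push_cast
  exact h2

end WeightedSums

/-! ### Graph metrics and their maximal operators -/

section DiscreteSpaces

variable {V : Type}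

open Classical in
/-- The metric in which adjacent points have distance `1` and all other distinct points have
distance `2`. -/
abbrev graphMetric (H : SimpleGraph V) : MetricSpace V where
  dist x y := if x = y then 0 else if H.Adj x y then 1 else 2
  dist_self x := by simp
  dist_comm x y := by simp only [eq_comm (a := x), H.adj_comm x y]
  dist_triangle x y z := by
    by_cases hxy : x = y
    · subst hxy; simp
    by_cases hyz : y = z
    · subst hyz; simp
    have h : ∀ u v, u ≠ v → (1 : ℝ) ≤ (if u = v then 0 else if H.Adj u v then 1 else 2) := by
      intro u v huv
      simp only [huv, if_false]
      split_ifs <;> norm_num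
    have h1 := h x y hxy
    have h2 := h y z hyz
    have h3 : (if x = z then (0 : ℝ) else if H.Adj x z then 1 else 2) ≤ 2 := by
      split_ifs <;> norm_num
    linarith
  eq_of_dist_eq_zero {x y} h := by
    by_contra hne
    simp only [hne, if_false] at h
    split_ifs at h <;> norm_num at h

/-- The closed neighbourhood of a vertex. -/
def nbhd (H : SimpleGraph V) (x : V) : Set V := {y | y = x ∨ H.Adj x y}

lemma self_mem_nbhd (H : SimpleGraph V) (x : V) : x ∈ nbhd H x := .inl rfl

section Ball

variable (H : SimpleGraph V) (x : V) {s : ℝ}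

lemma graphMetric_ball_of_le_one (h0 : 0 < s) (h1 : s ≤ 1) :
    letI := graphMetric H; Metric.ball x s = {x} := by
  let := graphMetric H
  ext y
  simp only [Metric.mem_ball, mem_singleton_iff]
  constructor
  · intro h
    by_contra hne
    have : (1 : ℝ) ≤ dist y x := by
      classical
      change (1 : ℝ) ≤ if y = x then 0 else if H.Adj y x then 1 else 2
      rw [if_neg hne]
      split_ifs <;> norm_num
    linarith
  · rintro rfl; simpa

lemma graphMetric_ball_of_le_two (h1 : 1 < s) (h2 : s ≤ 2) :
    letI := graphMetric H; Metric.ball x s = nbhd H x := by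
  let := graphMetric H
  ext y
  simp only [Metric.mem_ball, nbhd, mem_ofPred_eq, dist, H.adj_comm x y]
  by_cases hxy : y = x
  · simp only [hxy, if_true, true_or, iff_true]; linarith
  · by_cases ha : H.Adj y x
    · simp [hxy, ha, h1]
    · simp [hxy, ha, h2]

lemma graphMetric_ball_of_two_lt (h2 : 2 < s) :
    letI := graphMetric H; Metric.ball x s = univ := by
  let := graphMetric H
  ext y
  simp only [Metric.mem_ball, mem_univ, iff_true, dist]
  split_ifs <;> linarith

lemma graphMetric_ball_cases (h0 : 0 < s) : letI := graphMetric H;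
    Metric.ball x s = {x} ∨ Metric.ball x s = nbhd H x ∨ Metric.ball x s = univ := by
  rcases le_or_gt s 1 with h | h
  · exact .inl (graphMetric_ball_of_le_one H x h0 h)
  rcases le_or_gt s 2 with h' | h'
  · exact .inr (.inl (graphMetric_ball_of_le_two H x h h'))
  · exact .inr (.inr (graphMetric_ball_of_two_lt H x h'))

lemma graphMetric_discreteTopology : letI := graphMetric H; DiscreteTopology V := by
  let := graphMetric H
  refine discreteTopology_iff_isOpen_singleton.2 fun x => ?_
  rw [← graphMetric_ball_of_le_one H x one_pos le_rfl]
  exact Metric.isOpen_ball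

end Ball

/-- The average of a function over a set with respect to a weight. -/
def avg (m : V → ℝ≥0∞) (S : Set V) (φ : V → ℝ≥0) : ℝ≥0∞ :=
  (∑' y, S.indicator (fun y => m y * φ y) y) / mass m S

/-- The action of an operator on functions with nonnegative values. -/
def onNonneg (T : (V → ℂ) → V → ℝ≥0∞) (φ : V → ℝ≥0) : V → ℝ≥0∞ := T fun x => ((φ x : ℝ) : ℂ)

/-- The operator depends only on the absolute value of the function. -/
def AbsInvariant (T : (V → ℂ) → V → ℝ≥0∞) : Prop :=
  ∀ f g : V → ℂ, (∀ x, ‖f x‖ = ‖g x‖) → T f = T g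

lemma AbsInvariant.eq_onNonneg {T : (V → ℂ) → V → ℝ≥0∞} (hT : AbsInvariant T) (f : V → ℂ) :
    T f = onNonneg T (fun x => ‖f x‖₊) :=
  hT _ _ fun x => by simp

/-- The types are tested on functions of finite norm only, `Bdd` on all functions. Since 0 · ∞ = 0,
the constant is raised to C + 1 so that functions of infinite norm satisfy the inequality trivially.
-/
lemma bdd_of_finite {k : Kind} {p : ℝ} {ι κ : Type*} {w : ι → ℝ≥0∞} {v : κ → ℝ≥0∞}
    {U : (ι → ℝ≥0) → κ → ℝ≥0∞} (C : ℝ≥0)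
    (h : ∀ φ, src k w p φ ≠ ∞ → tgt k v p (U φ) ≤ C * src k w p φ) : Bdd k p w v U := by
  refine ⟨C + 1, fun φ => ?_⟩
  by_cases hφ : src k w p φ = ∞
  · rw [hφ, ENNReal.mul_top (by simp)]
    exact le_top
  · refine (h φ hφ).trans ?_
    gcongr
    simp

lemma ballAverage_abs [MetricSpace V] [MeasurableSpace V] (μ : Measure V)
    {f g : V → ℂ} (h : ∀ x, ‖f x‖ = ‖g x‖) :
    ballAverage μ f = ballAverage μ g := by
  have : ∀ x, ‖f x‖ₑ = ‖g x‖ₑ := fun x => by rw [← ofReal_norm, ← ofReal_norm, h x]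
  ext y s
  simp only [ballAverage, this]

lemma absInvariant_centeredMaximal [MetricSpace V] [MeasurableSpace V] (μ : Measure V) :
    AbsInvariant (centeredMaximal μ) := fun f g h => by
  ext x; simp only [centeredMaximal, ballAverage_abs μ h]

lemma absInvariant_noncenteredMaximal [MetricSpace V] [MeasurableSpace V] (μ : Measure V) :
    AbsInvariant (noncenteredMaximal μ) := fun f g h => by
  ext x; simp only [noncenteredMaximal, ballAverage_abs μ h]

lemma avg_singleton {m : V → ℝ≥0∞} (hm0 : ∀ x, m x ≠ 0) (hm : ∀ x, m x ≠ ∞) (φ : V → ℝ≥0) (x : V) :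
    avg m {x} φ = φ x := by
  unfold avg
  rw [mass_singleton, tsum_eq_single x]
  · simp only [mem_singleton_iff, indicator_of_mem]
    rw [mul_comm, ENNReal.mul_div_cancel_right (hm0 x) (hm x)]
  · intro y hy; simp [hy]

/-- No point is a null set, so the essential supremum of |f| bounds every value of |f| and hence
every average. -/
lemma types_top [MetricSpace V] [MeasurableSpace V] {μ : Measure V} (hμ : ∀ x, μ {x} ≠ 0) :
    (StrongType (centeredMaximal μ) ∞ μ ∧ WeakType (centeredMaximal μ) ∞ μ ∧
      RestrictedWeakType (centeredMaximal μ) ∞ μ) ∧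
    (StrongType (noncenteredMaximal μ) ∞ μ ∧ WeakType (noncenteredMaximal μ) ∞ μ ∧
      RestrictedWeakType (noncenteredMaximal μ) ∞ μ) := by
  have hle : ∀ f : V → ℂ, ∀ x, ‖f x‖ₑ ≤ eLpNorm f ∞ μ := by
    intro f x
    rw [eLpNorm_exponent_top]
    have h := ae_le_eLpNormEssSup (f := f) (μ := μ)
    by_contra hx
    exact hμ x (measure_mono_null (by simpa using hx) (ae_iff.1 h))
  have havg : ∀ (f : V → ℂ) y s, ballAverage μ f y s ≤ eLpNorm f ∞ μ := by
    intro f y s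
    refine ENNReal.div_le_of_le_mul ?_
    calc _ ≤ ∫⁻ _ in Metric.ball y s, eLpNorm f ∞ μ ∂μ := lintegral_mono fun x => hle f x
      _ = _ := by simp
  have key : ∀ T : (V → ℂ) → V → ℝ≥0∞, (∀ f x, T f x ≤ eLpNorm f ∞ μ) →
      StrongType T ∞ μ ∧ WeakType T ∞ μ ∧ RestrictedWeakType T ∞ μ := by
    intro T hT
    have hS : StrongType T ∞ μ := by
      refine ⟨1, fun f _ => ?_⟩
      rw [ENNReal.coe_one, one_mul, eLpNorm_exponent_top (f := T f)]
      exact eLpNormEssSup_le_of_ae_enorm_bound (.of_forall fun x => hT f x)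
    refine ⟨hS, ?_, by simpa [RestrictedWeakType] using hS⟩
    obtain ⟨C, hC⟩ := hS
    exact ⟨C, fun f hf => by simpa [weakNorm] using hC f hf⟩
  refine ⟨key _ fun f x => iSup₂_le fun s _ => havg f x s, key _ fun f x => ?_⟩
  exact iSup_le fun y => iSup_le fun s => iSup_le fun _ => iSup_le fun _ => havg f y s

/-- A finite measure on an infinite graph metric space cannot be doubling if the points have
positive mass. -/
lemma not_isDoubling_graphMetric [Infinite V] [MeasurableSpace V] [MeasurableSingletonClass V]
    (H : SimpleGraph V)
    (μ : Measure V) [IsFiniteMeasure μ] (h0 : μ univ ≠ 0) :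
    letI := graphMetric H; ¬ IsDoubling μ := by
  let := graphMetric H
  rintro ⟨C, hC⟩
  have h1 : ∀ x, μ univ ≤ C * C * μ {x} := by
    intro x
    -- Doubling the radius 1 leads from {x} to its neighbourhood; doubling 3/2 leads from the same
    -- neighbourhood to the whole space. So all points have comparable mass.
    have e1 := hC x 1 one_pos
    have e2 := hC x (3 / 2) (by norm_num)
    rw [show (2 : ℝ) * (3 / 2) = 3 by norm_num, graphMetric_ball_of_two_lt H x (by norm_num),
      graphMetric_ball_of_le_two H x (by norm_num) (by norm_num)] at e2
    rw [mul_one, graphMetric_ball_of_le_one H x one_pos le_rfl,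
      graphMetric_ball_of_le_two H x (by norm_num) le_rfl] at e1
    rw [mul_assoc]
    exact e2.trans (by gcongr)
  have hx : ∀ x, μ univ / (C * C) ≤ μ {x} := fun x => ENNReal.div_le_of_le_mul' (h1 x)
  have hpos : μ univ / (C * C) ≠ 0 := by
    rw [Ne, ENNReal.div_eq_zero_iff, not_or]
    exact ⟨h0, ENNReal.mul_ne_top ENNReal.coe_ne_top ENNReal.coe_ne_top⟩
  have := Measure.finite_const_le_meas_of_disjoint_iUnion μ (pos_iff_ne_zero.2 hpos)
    (As := fun x : V => ({x} : Set V)) (fun x => MeasurableSet.singleton x)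
    (fun x y hxy => by simpa using hxy) (measure_ne_top μ _)
  refine infinite_univ (this.subset fun x _ => hx x)

/-! ### Purely atomic measures: the types as inequalities between weighted sums -/

variable [MeasurableSpace V] [DiscreteMeasurableSpace V]

/-- The purely atomic measure with the given weights. -/
def pointMeasure (m : V → ℝ≥0∞) : Measure V := Measure.sum fun i => m i • Measure.dirac i

lemma lintegral_pointMeasure (m g : V → ℝ≥0∞) :
    ∫⁻ x, g x ∂pointMeasure m = ∑' x, m x * g x := by
  simp [pointMeasure, lintegral_sum_measure, lintegral_smul_measure, lintegral_dirac' _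
    (Measurable.of_discrete (f := g))]

lemma setLIntegral_pointMeasure (m g : V → ℝ≥0∞) (S : Set V) :
    ∫⁻ x in S, g x ∂pointMeasure m = ∑' x, S.indicator (fun x => m x * g x) x := by
  rw [← lintegral_indicator (MeasurableSet.of_discrete), lintegral_pointMeasure]
  congr 1; ext x
  by_cases h : x ∈ S <;> simp [h]

lemma pointMeasure_apply (m : V → ℝ≥0∞) (S : Set V) : pointMeasure m S = mass m S := by
  rw [← setLIntegral_one, setLIntegral_pointMeasure]
  simp [mass]

variable {m : V → ℝ≥0∞}

lemma eLpNorm_pointMeasure {ε : Type*} [ENorm ε] {p : ℝ≥0∞} (h1 : 1 ≤ p) (ht : p ≠ ∞)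
    (f : V → ε) : eLpNorm f p (pointMeasure m) = sNorm m p.toReal (fun x => ‖f x‖ₑ) := by
  rw [eLpNorm_eq_lintegral_rpow_enorm_toReal (zero_lt_one.trans_le h1).ne' ht,
    lintegral_pointMeasure]
  rfl

lemma weakNorm_pointMeasure {p : ℝ≥0∞} (ht : p ≠ ∞) (g : V → ℝ≥0∞) :
    weakNorm g p (pointMeasure m) = wNorm m p.toReal g := by
  simp only [weakNorm, ht, if_false, pointMeasure_apply, wNorm]

lemma lorentzOneNorm_pointMeasure {p : ℝ≥0∞} (ht : p ≠ ∞) (f : V → ℂ) :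
    lorentzOneNorm f p (pointMeasure m) = lNorm m p.toReal (fun x => ‖f x‖₊) := by
  simp only [lorentzOneNorm, pointMeasure_apply, lNorm, ENNReal.ofReal_toReal ht, coe_nnnorm]

section Types

variable [Countable V] {T : (V → ℂ) → V → ℝ≥0∞} {p : ℝ≥0∞}

lemma strongType_iff (hT : AbsInvariant T) (h1 : 1 ≤ p) (ht : p ≠ ∞) :
    StrongType T p (pointMeasure m) ↔ Bdd .strong p.toReal m m (onNonneg T) := by
  constructor
  · rintro ⟨C, hC⟩
    refine bdd_of_finite C fun φ hφ => ?_
    have h := eLpNorm_pointMeasure (m := m) h1 ht fun x => ((φ x : ℝ) : ℂ)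
    have h2 := eLpNorm_pointMeasure (m := m) h1 ht (onNonneg T φ)
    have he : ∀ x, ‖((φ x : ℝ) : ℂ)‖ₑ = φ x := fun x => by simp [enorm_eq_nnnorm]
    simp only [he] at h
    simp only [enorm_eq_self] at h2
    have := hC (fun x => ((φ x : ℝ) : ℂ)) ⟨.of_discrete, by
      rw [h]; exact lt_top_iff_ne_top.2 hφ⟩
    rw [h] at this
    exact h2.symm.trans_le this
  · rintro ⟨C, hC⟩
    refine ⟨C, fun f _ => ?_⟩
    rw [hT.eq_onNonneg, eLpNorm_pointMeasure h1 ht, eLpNorm_pointMeasure h1 ht]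
    exact hC _

lemma weakType_iff (hT : AbsInvariant T) (h1 : 1 ≤ p) (ht : p ≠ ∞) :
    WeakType T p (pointMeasure m) ↔ Bdd .weak p.toReal m m (onNonneg T) := by
  constructor
  · rintro ⟨C, hC⟩
    refine bdd_of_finite C fun φ hφ => ?_
    have h := eLpNorm_pointMeasure (m := m) h1 ht fun x => ((φ x : ℝ) : ℂ)
    have he : ∀ x, ‖((φ x : ℝ) : ℂ)‖ₑ = φ x := fun x => by simp [enorm_eq_nnnorm]
    simp only [he] at h
    have := hC (fun x => ((φ x : ℝ) : ℂ)) ⟨.of_discrete, by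
      rw [h]; exact lt_top_iff_ne_top.2 hφ⟩
    rw [h, weakNorm_pointMeasure ht] at this
    exact this
  · rintro ⟨C, hC⟩
    refine ⟨C, fun f _ => ?_⟩
    rw [hT.eq_onNonneg, weakNorm_pointMeasure ht, eLpNorm_pointMeasure h1 ht]
    exact hC _

lemma restrictedWeakType_iff (hT : AbsInvariant T) (ht : p ≠ ∞) :
    RestrictedWeakType T p (pointMeasure m) ↔ Bdd .restricted p.toReal m m (onNonneg T) := by
  simp only [RestrictedWeakType, ht, if_false]
  constructor
  · rintro ⟨C, hC⟩
    refine bdd_of_finite C fun φ hφ => ?_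
    have h := lorentzOneNorm_pointMeasure (m := m) ht fun x => ((φ x : ℝ) : ℂ)
    have he : ∀ x, ‖((φ x : ℝ) : ℂ)‖₊ = φ x := fun x => by simp
    simp only [he] at h
    have := hC (fun x => ((φ x : ℝ) : ℂ)) .of_discrete (by
      rw [h]; exact lt_top_iff_ne_top.2 hφ)
    rw [h, weakNorm_pointMeasure ht] at this
    exact this
  · rintro ⟨C, hC⟩
    refine ⟨C, fun f _ _ => ?_⟩
    rw [hT.eq_onNonneg, weakNorm_pointMeasure ht, lorentzOneNorm_pointMeasure ht]
    exact hC _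

end Types

lemma ballAverage_pointMeasure [MetricSpace V] (φ : V → ℝ≥0) (y : V) (s : ℝ) :
    ballAverage (pointMeasure m) (fun x => ((φ x : ℝ) : ℂ)) y s = avg m (Metric.ball y s) φ := by
  have he : ∀ x, ‖((φ x : ℝ) : ℂ)‖ₑ = φ x := fun x => by simp [enorm_eq_nnnorm]
  simp only [ballAverage, setLIntegral_pointMeasure, pointMeasure_apply, avg, he]

section Maximal

variable (H : SimpleGraph V)

lemma centeredMaximal_le (hm0 : ∀ x, m x ≠ 0) (hm : ∀ x, m x ≠ ∞)
    (φ : V → ℝ≥0) (x : V) : letI := graphMetric H;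
    onNonneg (centeredMaximal (pointMeasure m)) φ x ≤
      φ x + (avg m univ φ + avg m (nbhd H x) φ) := by
  let := graphMetric H
  refine iSup₂_le fun s hs => ?_
  rw [ballAverage_pointMeasure]
  rcases graphMetric_ball_cases H x hs with h | h | h <;> rw [h]
  · rw [avg_singleton hm0 hm]; exact le_self_add
  · exact le_add_left le_add_self
  · exact le_add_left le_self_add

lemma noncenteredMaximal_le (hm0 : ∀ x, m x ≠ 0) (hm : ∀ x, m x ≠ ∞)
    (φ : V → ℝ≥0) (x : V) : letI := graphMetric H;
    onNonneg (noncenteredMaximal (pointMeasure m)) φ x ≤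
      φ x + (avg m univ φ + ⨆ (y : V) (_ : x ∈ nbhd H y), avg m (nbhd H y) φ) := by
  let := graphMetric H
  refine iSup_le fun y => iSup_le fun s => iSup_le fun hs => iSup_le fun hx => ?_
  rw [ballAverage_pointMeasure]
  rcases graphMetric_ball_cases H y hs with h | h | h <;> rw [h] at hx ⊢
  · rw [avg_singleton hm0 hm, mem_singleton_iff.1 hx]; exact le_self_add
  · exact le_add_left (le_add_left (le_iSup₂_of_le y hx le_rfl))
  · exact le_add_left le_self_add

lemma le_centeredMaximal (φ : V → ℝ≥0) (x : V) : letI := graphMetric H;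
    avg m (nbhd H x) φ ≤ onNonneg (centeredMaximal (pointMeasure m)) φ x := by
  let := graphMetric H
  refine le_iSup₂_of_le 2 two_pos ?_
  rw [ballAverage_pointMeasure, graphMetric_ball_of_le_two H x one_lt_two le_rfl]

lemma le_noncenteredMaximal (φ : V → ℝ≥0) {x y : V} (hx : x ∈ nbhd H y) :
    letI := graphMetric H;
    avg m (nbhd H y) φ ≤ onNonneg (noncenteredMaximal (pointMeasure m)) φ x := by
  let := graphMetric H
  have hb := graphMetric_ball_of_le_two H y one_lt_two le_rfl
  refine le_iSup_of_le y <| le_iSup_of_le 2 <| le_iSup_of_le two_pos <|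
    le_iSup_of_le (by rw [hb]; exact hx) ?_
  rw [ballAverage_pointMeasure, hb]

end Maximal

end DiscreteSpaces

/-! ### Transferring inequalities between spaces -/

section Transfer

variable {ι κ ι' κ' : Type*}

/-- Since d ≤ 1 and p ≥ 1, the factor d^p is at most d, which the weights absorb. -/
lemma bdd_diagonal [Countable ι] (k : Kind) {p : ℝ} (hp : 1 ≤ p) {w v : ι → ℝ≥0∞}
    {d : ι → ℝ≥0∞} (hd : ∀ x, d x ≤ 1) (h : ∀ x, v x * d x ≤ w x) :
    Bdd k p w v (fun φ x => d x * φ x) := by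
  refine Bdd.of_strong k hp ⟨1, fun φ => ?_⟩
  rw [ENNReal.coe_one, one_mul]
  simp only [tgt, src, sNorm]
  refine ENNReal.rpow_le_rpow (ENNReal.tsum_le_tsum fun x => ?_) (by positivity)
  rw [ENNReal.mul_rpow_of_nonneg _ _ (by linarith), ← mul_assoc]
  gcongr
  refine le_trans ?_ (h x)
  gcongr
  conv_rhs => rw [← ENNReal.rpow_one (d x)]
  exact ENNReal.rpow_le_rpow_of_exponent_ge (hd x) hp

lemma Bdd.comp_source {k : Kind} {p : ℝ} (hp : 1 ≤ p) {w : ι → ℝ≥0∞} {w' : ι' → ℝ≥0∞}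
    {v : κ → ℝ≥0∞} {U : (ι' → ℝ≥0) → κ → ℝ≥0∞} (hU : Bdd k p w' v U) {j : ι' → ι}
    (hj : j.Injective) (h : ∀ i, w' i ≤ w (j i)) :
    Bdd k p w v (fun φ => U fun i => φ (j i)) := by
  obtain ⟨C, hC⟩ := hU
  refine ⟨C, fun φ => (hC _).trans ?_⟩
  gcongr
  exact src_comp_le k hp hj h φ

lemma Bdd.extend_target {k : Kind} {p : ℝ} (hp : 1 ≤ p) {w : ι → ℝ≥0∞} {v : κ → ℝ≥0∞}
    {v' : κ' → ℝ≥0∞} {U : (ι → ℝ≥0) → κ → ℝ≥0∞} (hU : Bdd k p w v U) {j : κ → κ'}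
    (hj : j.Injective) (h : ∀ i, v' (j i) ≤ v i) :
    Bdd k p w v' (fun φ => Function.extend j (U φ) 0) :=
  hU.imp fun _ hC φ => (tgt_extend_le k hp hj h _).trans (hC φ)

/-- An inequality passes to an operator that is dominated after embedding its source and target. -/
lemma Bdd.of_embedding {k : Kind} {p : ℝ} (hp : 1 ≤ p) {w : ι → ℝ≥0∞} {v : κ → ℝ≥0∞}
    {w' : ι' → ℝ≥0∞} {v' : κ' → ℝ≥0∞} {U : (ι → ℝ≥0) → κ → ℝ≥0∞}
    {V : (ι' → ℝ≥0) → κ' → ℝ≥0∞} (hV : Bdd k p w' v' V) {i : ι → ι'} (hi : i.Injective)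
    (hw : ∀ y, w' (i y) ≤ w y) {j : κ → κ'} (hj : j.Injective) (hv : ∀ x, v x ≤ v' (j x))
    {c : ℝ≥0} (hc : 0 < c) (h : ∀ φ x, U φ x ≤ c * V (Function.extend i φ 0) (j x)) :
    Bdd k p w v U := by
  obtain ⟨C, hC⟩ := hV
  refine ⟨c * C, fun φ => (tgt_mono k v hp (h φ)).trans
    ((tgt_const_mul_le k v hp hc _).trans ?_)⟩
  push_cast
  rw [mul_assoc]
  gcongr
  refine (tgt_comp_le k hp hj hv _).trans ((hC _).trans ?_)
  gcongr
  exact src_extend_le k hp hi hw φ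

/-- The supremum of constants over sets is controlled by the constants if each set has mass
comparable to the weight of its index. -/
lemma tgt_iSup_le (k : Kind) {p : ℝ} (hp : 1 ≤ p) {m : ι → ℝ≥0∞} {a : κ → ℝ≥0∞}
    (D : κ → Set ι) {c : ℝ≥0} (hc : 1 ≤ c) (hD : ∀ x, mass m (D x) ≤ c * a x)
    (g : κ → ℝ≥0∞) :
    tgt k m p (fun q => ⨆ (x : κ) (_ : q ∈ D x), g x) ≤ c * tgt k a p g := by
  have hp0 : 0 < p := by linarith
  have hcp : (c : ℝ≥0∞) ^ (1 / p) ≤ c := by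
    conv_rhs => rw [← ENNReal.rpow_one (c : ℝ≥0∞)]
    refine ENNReal.rpow_le_rpow_of_exponent_le (by exact_mod_cast hc) ?_
    rw [div_le_one hp0]; exact hp
  -- In both bounds the supremum over x is replaced by a sum over x and the sums are exchanged: of
  -- the powers g(x)^p here, and of the masses of those D(x) with g(x) > t below. The overlap of the
  -- sets D(x) plays no role.
  have hs : sNorm m p (fun q => ⨆ (x : κ) (_ : q ∈ D x), g x) ≤ c * sNorm a p g := by
    unfold sNorm
    refine le_trans ?_ (mul_le_mul_left hcp _)
    rw [← ENNReal.mul_rpow_of_nonneg _ _ (by positivity)]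
    gcongr
    calc ∑' q, m q * (⨆ (x : κ) (_ : q ∈ D x), g x) ^ p
        ≤ ∑' q, m q * ∑' x, {x | q ∈ D x}.indicator (fun x => g x ^ p) x := by
          gcongr with q
          have : ⨆ (x : κ) (_ : q ∈ D x), g x ≤
              (∑' x, {x | q ∈ D x}.indicator (fun x => g x ^ p) x) ^ p⁻¹ := by
            refine iSup₂_le fun x hx => ?_
            rw [ENNReal.le_rpow_inv_iff hp0]
            refine le_trans (le_of_eq ?_) (ENNReal.le_tsum x)
            rw [indicator_of_mem (show x ∈ {x | q ∈ D x} from hx)]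
          rwa [ENNReal.le_rpow_inv_iff hp0] at this
      _ = ∑' x, mass m (D x) * g x ^ p := by
          unfold mass
          simp_rw [← ENNReal.tsum_mul_left, ← ENNReal.tsum_mul_right]
          rw [ENNReal.tsum_comm]
          congr 1; ext x; congr 1; ext q
          by_cases h : q ∈ D x <;> simp [h]
      _ ≤ ∑' x, c * a x * g x ^ p := by
          gcongr with x
          exact hD x
      _ = _ := by simp_rw [← ENNReal.tsum_mul_left, mul_assoc]
  have hw : wNorm m p (fun q => ⨆ (x : κ) (_ : q ∈ D x), g x) ≤ c * wNorm a p g := by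
    refine iSup₂_le fun t ht => ?_
    refine le_trans ?_ (mul_le_mul_right (le_wNorm a p g ht) _)
    rw [← mul_assoc, mul_comm (c : ℝ≥0∞), mul_assoc]
    gcongr
    refine le_trans ?_ (mul_le_mul_left hcp _)
    rw [← ENNReal.mul_rpow_of_nonneg _ _ (by positivity)]
    gcongr
    calc mass m {q | (t : ℝ≥0∞) < ⨆ (x : κ) (_ : q ∈ D x), g x}
        ≤ ∑' q, ∑' x, {x | (t : ℝ≥0∞) < g x}.indicator (fun x => (D x).indicator m q) x := by
          unfold mass
          gcongr with q
          by_cases h : q ∈ {q | (t : ℝ≥0∞) < ⨆ (x : κ) (_ : q ∈ D x), g x}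
          · rw [indicator_of_mem h]
            obtain ⟨x, hx, hq⟩ : ∃ x, q ∈ D x ∧ (t : ℝ≥0∞) < g x := by
              simpa [lt_iSup_iff] using h
            refine le_trans (le_of_eq ?_) (ENNReal.le_tsum x)
            rw [indicator_of_mem (show x ∈ {x | (t : ℝ≥0∞) < g x} from hq), indicator_of_mem hx]
          · rw [indicator_of_notMem h]; exact zero_le
      _ = ∑' x, {x | (t : ℝ≥0∞) < g x}.indicator (fun x => mass m (D x)) x := by
          unfold mass
          rw [ENNReal.tsum_comm]
          congr 1; ext x
          by_cases h : x ∈ {x | (t : ℝ≥0∞) < g x}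
          · simp only [indicator_of_mem h]
          · simp only [indicator_of_notMem h, tsum_zero]
      _ ≤ c * mass a {x | (t : ℝ≥0∞) < g x} := by
          unfold mass
          rw [← ENNReal.tsum_mul_left]
          gcongr with x
          by_cases h : x ∈ {x | (t : ℝ≥0∞) < g x}
          · simp only [indicator_of_mem h]; exact hD x
          · simp only [indicator_of_notMem h, mul_zero, le_rfl]
  cases k
  exacts [hs, hw, hw]

end Transfer

/-! ### The space over a weighted bipartite graph -/

/-- A weighted bipartite graph in which the mass of the neighbours of each leaf is at most the
weight of the leaf. -/
structure LeafGraph where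
  /-- The leaves. -/
  X : Type
  /-- The sources. -/
  Y : Type
  countable_leaf : Countable X
  infinite_leaf : Infinite X
  countable_source : Countable Y
  /-- The adjacency between leaves and sources. -/
  adj : X → Y → Prop
  /-- The weights of the leaves. -/
  a : X → ℝ≥0
  /-- The weights of the sources. -/
  b : Y → ℝ≥0
  a_pos : ∀ x, 0 < a x
  b_pos : ∀ y, 0 < b y
  mass_adj_le : ∀ x, mass (fun y => (b y : ℝ≥0∞)) {y | adj x y} ≤ a x
  sum_a : ∑' x, (a x : ℝ≥0∞) ≠ ∞
  sum_b : ∑' y, (b y : ℝ≥0∞) ≠ ∞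

attribute [instance] LeafGraph.countable_leaf LeafGraph.infinite_leaf LeafGraph.countable_source

/-- The kernel of the averaging operator from sources to leaves. -/
def LeafGraph.ker (G : LeafGraph) (x : G.X) : G.Y → ℝ≥0∞ :=
  {y | G.adj x y}.indicator fun y => (G.b y : ℝ≥0∞) / G.a x

/-- The inequality of the given kind for the averaging operator of a graph. -/
def LeafGraph.HasType (G : LeafGraph) (k : Kind) (p : ℝ) : Prop :=
  Bdd k p (fun y => (G.b y : ℝ≥0∞)) (fun x => (G.a x : ℝ≥0∞)) (kernelOp G.ker)

/-- The points of the space over a graph: a hub, the sources, and for each leaf a centre and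
a target. -/
inductive Pt (X Y : Type)
  | hub
  | source (y : Y)
  | centre (x : X)
  | target (x : X)

namespace Pt

variable {X Y : Type}

/-- The points as a disjoint union. -/
def equivSum : Pt X Y ≃ Unit ⊕ (Y ⊕ (X ⊕ X)) where
  toFun
    | hub => .inl ()
    | source y => .inr (.inl y)
    | centre x => .inr (.inr (.inl x))
    | target x => .inr (.inr (.inr x))
  invFun
    | .inl _ => hub
    | .inr (.inl y) => source y
    | .inr (.inr (.inl x)) => centre x
    | .inr (.inr (.inr x)) => target x
  left_inv q := by cases q <;> rfl
  right_inv q := by rcases q with _ | _ | _ | _ <;> rfl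

instance [Countable X] [Countable Y] : Countable (Pt X Y) := equivSum.injective.countable

instance : Nonempty (Pt X Y) := ⟨hub⟩

lemma source_injective : (source : Y → Pt X Y).Injective := fun _ _ h => by simpa using h

lemma centre_injective : (centre : X → Pt X Y).Injective := fun _ _ h => by simpa using h

lemma target_injective : (target : X → Pt X Y).Injective := fun _ _ h => by simpa using h

instance [Infinite X] : Infinite (Pt X Y) := Infinite.of_injective _ centre_injective

instance : MeasurableSpace (Pt X Y) := ⊤

instance : DiscreteMeasurableSpace (Pt X Y) := ⟨fun _ => trivial⟩

lemma tsum_eq (f : Pt X Y → ℝ≥0∞) : ∑' q, f q =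
    f hub + (∑' y, f (source y) + (∑' x, f (centre x) + ∑' x, f (target x))) := by
  rw [← equivSum.symm.tsum_eq f]
  rw [ENNReal.summable.tsum_sum ENNReal.summable, ENNReal.summable.tsum_sum ENNReal.summable,
    ENNReal.summable.tsum_sum ENNReal.summable, tsum_fintype]
  simp [equivSum]

/-- The oriented adjacency between points. -/
def rel (adj : X → Y → Prop) : Pt X Y → Pt X Y → Prop
  | hub, source _ => True
  | hub, target _ => True
  | centre x, source y => adj x y
  | centre x, target x' => x = x'
  | _, _ => False

/-- The graph on the points. -/
def graph (adj : X → Y → Prop) : SimpleGraph (Pt X Y) := SimpleGraph.fromRel (rel adj)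

lemma hub_mem_nbhd (adj : X → Y → Prop) {q : Pt X Y} (h : ∀ x, q ≠ centre x) :
    hub ∈ nbhd (graph adj) q := by
  cases q with
  | hub => exact self_mem_nbhd _ _
  | centre x => exact absurd rfl (h x)
  | source y => right; simp [graph, rel]
  | target x => right; simp [graph, rel]

lemma mem_nbhd_centre (adj : X → Y → Prop) (x : X) (q : Pt X Y) :
    q ∈ nbhd (graph adj) (centre x) ↔
      q = centre x ∨ q = target x ∨ ∃ y, adj x y ∧ q = source y := by
  cases q <;> simp [nbhd, graph, rel, eq_comm]

end Pt

namespace LeafGraph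

variable (G : LeafGraph) (e : G.X → ℝ≥0)

/-- The weights of the points of the space over a graph. -/
def weight : Pt G.X G.Y → ℝ≥0∞
  | .hub => 1 + (∑' y, (G.b y : ℝ≥0∞) + (∑' x, (e x : ℝ≥0∞) + ∑' x, (G.a x : ℝ≥0∞)))
  | .source y => G.b y
  | .centre x => e x
  | .target x => G.a x

/-- The average over the ball around the centre of a leaf. -/
def leafAvg (φ : Pt G.X G.Y → ℝ≥0) (x : G.X) : ℝ≥0∞ :=
  avg (G.weight e) (nbhd (Pt.graph G.adj) (.centre x)) φ

lemma tsum_nbhd_centre (x : G.X) (g : Pt G.X G.Y → ℝ≥0∞) :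
    ∑' q, (nbhd (Pt.graph G.adj) (.centre x)).indicator g q =
      ∑' y, {y | G.adj x y}.indicator (fun y => g (.source y)) y +
        (g (.centre x) + g (.target x)) := by
  classical
  rw [Pt.tsum_eq]
  simp only [indicator, Pt.mem_nbhd_centre]
  simp [tsum_ite_eq]

variable {e} (he : ∀ x, e x ≤ G.a x) (he0 : ∀ x, 0 < e x)

include he in
lemma sum_centre : ∑' x, (e x : ℝ≥0∞) ≠ ∞ :=
  ne_top_of_le_ne_top G.sum_a (ENNReal.tsum_le_tsum fun x => by exact_mod_cast he x)

include he in
lemma weight_ne_top (q : Pt G.X G.Y) : G.weight e q ≠ ∞ := by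
  cases q <;> simp [weight, G.sum_a, G.sum_b, G.sum_centre he]

include he0 in
lemma weight_ne_zero (q : Pt G.X G.Y) : G.weight e q ≠ 0 := by
  cases q <;> simp [weight, (G.a_pos _).ne', (G.b_pos _).ne', (he0 _).ne']

lemma sum_weight_le : ∑' q, G.weight e q ≤ 2 * G.weight e .hub := by
  rw [Pt.tsum_eq, two_mul]
  gcongr
  simp only [weight]
  exact le_add_self

include he in
lemma sum_weight_ne_top : ∑' q, G.weight e q ≠ ∞ :=
  ne_top_of_le_ne_top (ENNReal.mul_ne_top (by simp) (G.weight_ne_top he _)) G.sum_weight_le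

include he in
-- The hub outweighs all other points together, so S has at least half of the total mass.
lemma avg_le_of_hub_mem {S : Set (Pt G.X G.Y)} (hS : .hub ∈ S) (φ : Pt G.X G.Y → ℝ≥0) :
    avg (G.weight e) S φ ≤ 2 * avg (G.weight e) univ φ := by
  unfold avg
  rw [mass_univ, ← mul_div_assoc]
  have h1 : ∑' q, G.weight e q ≤ 2 * mass (G.weight e) S :=
    G.sum_weight_le.trans (by gcongr; exact le_mass _ hS)
  have h0 : mass (G.weight e) S ≠ 0 := fun h => by
    have := le_mass (G.weight e) hS
    simp [h, weight] at this
  have ht : mass (G.weight e) S ≠ ∞ :=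
    ne_top_of_le_ne_top (G.sum_weight_ne_top he) (mass_le_tsum _ _)
  calc _ ≤ (∑' y, univ.indicator (fun y => G.weight e y * φ y) y) / mass (G.weight e) S := by
        gcongr
        exact subset_univ S
    _ = 2 * (∑' y, univ.indicator (fun y => G.weight e y * φ y) y) /
          (2 * mass (G.weight e) S) := by
        rw [ENNReal.mul_div_mul_left _ _ (by simp) (by simp)]
    _ ≤ _ := by gcongr

lemma mass_nbhd_centre (x : G.X) : mass (G.weight e) (nbhd (Pt.graph G.adj) (.centre x)) =
    mass (fun y => (G.b y : ℝ≥0∞)) {y | G.adj x y} + (e x + G.a x) :=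
  G.tsum_nbhd_centre x _

include he in
lemma mass_nbhd_centre_le (x : G.X) :
    mass (G.weight e) (nbhd (Pt.graph G.adj) (.centre x)) ≤ (3 : ℝ≥0) * G.a x := by
  rw [mass_nbhd_centre]
  calc _ ≤ (G.a x : ℝ≥0∞) + (G.a x + G.a x) := by
        gcongr
        exacts [G.mass_adj_le x, he x]
    _ = _ := by push_cast; ring

lemma kernelOp_ker (φ : G.Y → ℝ≥0) (x : G.X) : kernelOp G.ker φ x =
    (∑' y, {y | G.adj x y}.indicator (fun y => (G.b y : ℝ≥0∞) * φ y) y) / G.a x := by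
  unfold kernelOp ker
  rw [div_eq_mul_inv, ← ENNReal.tsum_mul_right]
  congr 1; ext y
  by_cases h : y ∈ {y | G.adj x y}
  · simp only [indicator_of_mem h, div_eq_mul_inv]; ring
  · simp only [indicator_of_notMem h, zero_mul]

/-- In the denominator only the target is kept, of mass a(x). -/
lemma leafAvg_le (φ : Pt G.X G.Y → ℝ≥0) (x : G.X) : G.leafAvg e φ x ≤
    kernelOp G.ker (fun y => φ (.source y)) x +
      ((e x : ℝ≥0∞) / G.a x * φ (.centre x) + φ (.target x)) := by
  have ha : (G.a x : ℝ≥0∞) ≠ 0 := by simpa using (G.a_pos x).ne'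
  rw [kernelOp_ker]
  unfold leafAvg avg
  rw [tsum_nbhd_centre]
  calc _ ≤ _ / (G.a x : ℝ≥0∞) := by
        gcongr
        rw [mass_nbhd_centre]
        exact le_add_left le_add_self
    _ = _ := by
        simp only [weight]
        rw [ENNReal.add_div, ENNReal.add_div, mul_comm (G.a x : ℝ≥0∞) (φ (.target x)),
          ENNReal.mul_div_cancel_right ha ENNReal.coe_ne_top, ENNReal.mul_div_right_comm]

include he in
-- The 3 counts the adjacent sources, the centre and the target, each of mass at most a(x).
lemma le_leafAvg (φ : G.Y → ℝ≥0) (x : G.X) : kernelOp G.ker φ x ≤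
    (3 : ℝ≥0) * G.leafAvg e (Function.extend .source φ 0) x := by
  have ha : (G.a x : ℝ≥0∞) ≠ 0 := by simpa using (G.a_pos x).ne'
  rw [kernelOp_ker]
  unfold leafAvg avg
  rw [tsum_nbhd_centre]
  simp only [Pt.source_injective.extend_apply]
  calc _ = (3 : ℝ≥0) * ((∑' y, {y | G.adj x y}.indicator (fun y => (G.b y : ℝ≥0∞) * φ y) y) /
          ((3 : ℝ≥0) * G.a x)) := by
        rw [← mul_div_assoc, ENNReal.mul_div_mul_left _ _ (by simp) (by simp)]
    _ ≤ _ := by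
        gcongr
        · exact le_self_add
        · exact G.mass_nbhd_centre_le he x

include he in
-- The terms of `leafAvg_le` from the centre and the target are diagonal and bounded for every v ≤
-- a, so only the sources matter. The free weight v allows both v = e and v = a.
lemma bdd_leafAvg {k : Kind} {p : ℝ} (hp : 1 ≤ p) {v : G.X → ℝ≥0∞} (hv : ∀ x, v x ≤ G.a x)
    (h : Bdd k p (fun y => (G.b y : ℝ≥0∞)) v (kernelOp G.ker)) :
    Bdd k p (G.weight e) v (G.leafAvg e) := by
  have ha : ∀ x, (G.a x : ℝ≥0∞) ≠ 0 := fun x => by simpa using (G.a_pos x).ne'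
  have h1 := h.comp_source (w := G.weight e) hp Pt.source_injective fun _ => le_rfl
  have h2 : Bdd k p (fun x => (e x : ℝ≥0∞)) v (fun φ x => (e x : ℝ≥0∞) / G.a x * φ x) := by
    refine bdd_diagonal k hp (fun x => ENNReal.div_le_of_le_mul ?_) fun x => ?_
    · rw [one_mul]; exact_mod_cast he x
    · refine (mul_le_mul_left (hv x) _).trans ?_
      rw [ENNReal.mul_div_cancel (ha x) ENNReal.coe_ne_top]
  have h3 : Bdd k p (fun x => (G.a x : ℝ≥0∞)) v (fun φ x => 1 * φ x) :=
    bdd_diagonal k hp (fun x => le_rfl) fun x => by rw [mul_one]; exact hv x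
  simp only [one_mul] at h3
  have h2' := h2.comp_source (w := G.weight e) hp Pt.centre_injective fun _ => le_rfl
  have h3' := h3.comp_source (w := G.weight e) hp Pt.target_injective fun _ => le_rfl
  exact Bdd.of_le_add k hp h1 (Bdd.of_le_add k hp h2' h3' fun _ _ => le_rfl)
    fun φ x => G.leafAvg_le φ x

include he in
-- Global averaging has rows of sum 1 and columns balanced by the weight. The 3 covers the whole
-- space once and the neighbourhoods containing the hub twice.
lemma bdd_trivial (k : Kind) {p : ℝ} (hp : 1 ≤ p) :
    Bdd k p (G.weight e) (G.weight e) (fun φ q => φ q + 3 * avg (G.weight e) univ φ) := by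
  have h1 : Bdd k p (G.weight e) (G.weight e) (fun φ q => 1 * φ q) :=
    bdd_diagonal k hp (fun x => le_rfl) fun x => by rw [mul_one]
  simp only [one_mul] at h1
  have hne : ∑' q, G.weight e q ≠ 0 := fun h => by
    have := ENNReal.tsum_eq_zero.1 h .hub
    simp [weight] at this
  have h2 : Bdd k p (G.weight e) (G.weight e)
      (kernelOp fun _ q => G.weight e q / ∑' q, G.weight e q) := by
    refine bdd_of_row_col k hp (fun x => ?_) fun y => ?_
    · simp_rw [div_eq_mul_inv]
      rw [ENNReal.tsum_mul_right, ENNReal.mul_inv_cancel hne (G.sum_weight_ne_top he)]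
    · rw [ENNReal.tsum_mul_right, ENNReal.mul_div_cancel hne (G.sum_weight_ne_top he)]
  refine Bdd.of_le_add k hp h1 (Bdd.of_le_const_mul k hp h2 (c := 3) (by norm_num)
    (U := fun φ _ => 3 * avg (G.weight e) univ φ) fun φ x => ?_) fun _ _ => le_rfl
  rw [ENNReal.coe_ofNat]
  gcongr
  unfold avg kernelOp
  simp only [indicator_univ, mass_univ, div_eq_mul_inv, ← ENNReal.tsum_mul_right]
  gcongr 1
  rw [mul_right_comm]

include he he0 in
-- The ball around the centre of x is centered at that point only, so its average counts with the
-- mass e(x).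
lemma bdd_centeredMaximal_iff (k : Kind) {p : ℝ} (hp : 1 ≤ p) :
    letI := graphMetric (Pt.graph G.adj)
    Bdd k p (G.weight e) (G.weight e)
      (onNonneg (centeredMaximal (pointMeasure (G.weight e)))) ↔
    Bdd k p (fun y => (G.b y : ℝ≥0∞)) (fun x => (e x : ℝ≥0∞)) (kernelOp G.ker) := by
  let := graphMetric (Pt.graph G.adj)
  constructor
  · intro h
    refine h.of_embedding hp Pt.source_injective (fun _ => le_rfl) Pt.centre_injective
      (fun _ => le_rfl) (c := 3) (by norm_num) fun φ x => (G.le_leafAvg he φ x).trans ?_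
    gcongr
    exact le_centeredMaximal _ _ _
  · intro h
    have h1 := (G.bdd_leafAvg he hp (fun x => by exact_mod_cast he x) h).extend_target
      (v' := G.weight e) hp Pt.centre_injective fun _ => le_rfl
    refine Bdd.of_le_add k hp (G.bdd_trivial he k hp) h1 fun φ q => ?_
    refine (centeredMaximal_le (Pt.graph G.adj) (G.weight_ne_zero he0) (G.weight_ne_top he)
      φ q).trans ?_
    rw [add_assoc]
    refine add_le_add le_rfl ?_
    by_cases hq : ∃ x, q = .centre x
    · obtain ⟨x, rfl⟩ := hq
      rw [Pt.centre_injective.extend_apply]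
      gcongr
      · exact le_mul_of_one_le_left zero_le (by norm_num)
      · rfl
    · push Not at hq
      refine le_trans ?_ le_self_add
      refine (add_le_add le_rfl (G.avg_le_of_hub_mem he (Pt.hub_mem_nbhd _ hq) φ)).trans ?_
      rw [← one_add_mul]
      norm_num

include he he0 in
-- The average around the centre of x is now felt on the whole ball. Its target, of mass a(x), gives
-- one direction; its mass, at most 3a(x), gives the other through `tgt_iSup_le`.
lemma bdd_noncenteredMaximal_iff (k : Kind) {p : ℝ} (hp : 1 ≤ p) :
    letI := graphMetric (Pt.graph G.adj)
    Bdd k p (G.weight e) (G.weight e)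
      (onNonneg (noncenteredMaximal (pointMeasure (G.weight e)))) ↔ G.HasType k p := by
  let := graphMetric (Pt.graph G.adj)
  constructor
  · intro h
    refine h.of_embedding hp Pt.source_injective (fun _ => le_rfl) Pt.target_injective
      (fun _ => le_rfl) (c := 3) (by norm_num) fun φ x => (G.le_leafAvg he φ x).trans ?_
    gcongr
    refine le_noncenteredMaximal _ _ ?_
    rw [Pt.mem_nbhd_centre]; simp
  · intro h
    have h1 : Bdd k p (G.weight e) (G.weight e) (fun φ q =>
        ⨆ (x : G.X) (_ : q ∈ nbhd (Pt.graph G.adj) (.centre x)), G.leafAvg e φ x) := by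
      obtain ⟨C, hC⟩ := G.bdd_leafAvg he hp (fun _ => le_rfl) h
      refine ⟨3 * C, fun φ => (tgt_iSup_le k hp _ (by norm_num) (G.mass_nbhd_centre_le he)
        _).trans ?_⟩
      rw [ENNReal.coe_mul, mul_assoc]
      gcongr
      exact hC φ
    refine Bdd.of_le_add k hp (G.bdd_trivial he k hp) h1 fun φ q => ?_
    refine (noncenteredMaximal_le (Pt.graph G.adj) (G.weight_ne_zero he0) (G.weight_ne_top he)
      φ q).trans ?_
    rw [add_assoc]
    refine add_le_add le_rfl ?_
    have : ⨆ (y : Pt G.X G.Y) (_ : q ∈ nbhd (Pt.graph G.adj) y),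
        avg (G.weight e) (nbhd (Pt.graph G.adj) y) φ ≤ 2 * avg (G.weight e) univ φ +
        ⨆ (x : G.X) (_ : q ∈ nbhd (Pt.graph G.adj) (.centre x)), G.leafAvg e φ x := by
      refine iSup₂_le fun y hy => ?_
      by_cases hq : ∃ x, y = .centre x
      · obtain ⟨x, rfl⟩ := hq
        exact le_add_left (le_iSup₂_of_le x hy le_rfl)
      · push Not at hq
        exact le_add_right (G.avg_le_of_hub_mem he (Pt.hub_mem_nbhd _ hq) φ)
    refine (add_le_add le_rfl this).trans (le_of_eq ?_)
    ring

end LeafGraph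

/-! ### Disjoint unions and the decoupling of the two operators -/

section Union

lemma kernelOp_inl {X₁ X₂ Y₁ Y₂ : Type*} {K : X₁ ⊕ X₂ → Y₁ ⊕ Y₂ → ℝ≥0∞}
    (h : ∀ x y, K (.inl x) (.inr y) = 0) (φ : Y₁ ⊕ Y₂ → ℝ≥0) (x : X₁) :
    kernelOp K φ (.inl x) =
      kernelOp (fun x y => K (.inl x) (.inl y)) (fun y => φ (.inl y)) x := by
  unfold kernelOp
  rw [ENNReal.summable.tsum_sum ENNReal.summable]
  simp [h]

lemma kernelOp_inr {X₁ X₂ Y₁ Y₂ : Type*} {K : X₁ ⊕ X₂ → Y₁ ⊕ Y₂ → ℝ≥0∞}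
    (h : ∀ x y, K (.inr x) (.inl y) = 0) (φ : Y₁ ⊕ Y₂ → ℝ≥0) (x : X₂) :
    kernelOp K φ (.inr x) =
      kernelOp (fun x y => K (.inr x) (.inr y)) (fun y => φ (.inr y)) x := by
  unfold kernelOp
  rw [ENNReal.summable.tsum_sum ENNReal.summable]
  simp [h]

/-- A block diagonal kernel is bounded if and only if both blocks are. -/
lemma bdd_sum_iff {X₁ X₂ Y₁ Y₂ : Type*} (k : Kind) {p : ℝ} (hp : 1 ≤ p)
    {w : Y₁ ⊕ Y₂ → ℝ≥0∞} {v : X₁ ⊕ X₂ → ℝ≥0∞} {K : X₁ ⊕ X₂ → Y₁ ⊕ Y₂ → ℝ≥0∞}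
    (h₁ : ∀ x y, K (.inl x) (.inr y) = 0) (h₂ : ∀ x y, K (.inr x) (.inl y) = 0) :
    Bdd k p w v (kernelOp K) ↔
      Bdd k p (fun y => w (.inl y)) (fun x => v (.inl x))
        (kernelOp fun x y => K (.inl x) (.inl y)) ∧
      Bdd k p (fun y => w (.inr y)) (fun x => v (.inr x))
        (kernelOp fun x y => K (.inr x) (.inr y)) := by
  constructor
  · intro h
    refine ⟨h.of_embedding hp Sum.inl_injective (fun _ => le_rfl) Sum.inl_injective
      (fun _ => le_rfl) one_pos fun φ x => ?_, h.of_embedding hp Sum.inr_injective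
      (fun _ => le_rfl) Sum.inr_injective (fun _ => le_rfl) one_pos fun φ x => ?_⟩
    · rw [kernelOp_inl h₁]
      simp only [Sum.inl_injective.extend_apply, ENNReal.coe_one, one_mul, le_rfl]
    · rw [kernelOp_inr h₂]
      simp only [Sum.inr_injective.extend_apply, ENNReal.coe_one, one_mul, le_rfl]
  · rintro ⟨hl, hr⟩
    have hl' := (hl.comp_source (w := w) hp Sum.inl_injective fun _ => le_rfl).extend_target
      (v' := v) hp Sum.inl_injective fun _ => le_rfl
    have hr' := (hr.comp_source (w := w) hp Sum.inr_injective fun _ => le_rfl).extend_target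
      (v' := v) hp Sum.inr_injective fun _ => le_rfl
    refine Bdd.of_le_add k hp hl' hr' fun φ x => ?_
    rcases x with x | x
    · rw [kernelOp_inl h₁, Sum.inl_injective.extend_apply]
      exact le_self_add
    · rw [kernelOp_inr h₂, Sum.inr_injective.extend_apply]
      exact le_add_self

lemma mass_sum {Y₁ Y₂ : Type*} (w : Y₁ ⊕ Y₂ → ℝ≥0∞) (S : Set (Y₁ ⊕ Y₂)) :
    mass w S = mass (fun y => w (.inl y)) {y | .inl y ∈ S} +
      mass (fun y => w (.inr y)) {y | .inr y ∈ S} := by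
  unfold mass
  rw [ENNReal.summable.tsum_sum ENNReal.summable]
  rfl

/-- The disjoint union of two weighted graphs. -/
def LeafGraph.union (G₁ G₂ : LeafGraph) : LeafGraph where
  X := G₁.X ⊕ G₂.X
  Y := G₁.Y ⊕ G₂.Y
  countable_leaf := inferInstance
  infinite_leaf := inferInstance
  countable_source := inferInstance
  adj
    | .inl x, .inl y => G₁.adj x y
    | .inr x, .inr y => G₂.adj x y
    | _, _ => False
  a := Sum.elim G₁.a G₂.a
  b := Sum.elim G₁.b G₂.b
  a_pos x := by rcases x with x | x <;> simp [LeafGraph.a_pos]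
  b_pos y := by rcases y with y | y <;> simp [LeafGraph.b_pos]
  mass_adj_le x := by
    rw [mass_sum]
    rcases x with x | x
    · simpa [mass] using G₁.mass_adj_le x
    · simpa [mass] using G₂.mass_adj_le x
  sum_a := by
    rw [ENNReal.summable.tsum_sum ENNReal.summable]
    simpa using ⟨G₁.sum_a, G₂.sum_a⟩
  sum_b := by
    rw [ENNReal.summable.tsum_sum ENNReal.summable]
    simpa using ⟨G₁.sum_b, G₂.sum_b⟩

lemma LeafGraph.bdd_union_iff (G₁ G₂ : LeafGraph) (k : Kind) {p : ℝ} (hp : 1 ≤ p)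
    (v : G₁.X ⊕ G₂.X → ℝ≥0∞) :
    Bdd k p (fun y => ((G₁.union G₂).b y : ℝ≥0∞)) v (kernelOp (G₁.union G₂).ker) ↔
      Bdd k p (fun y => (G₁.b y : ℝ≥0∞)) (fun x => v (.inl x)) (kernelOp G₁.ker) ∧
      Bdd k p (fun y => (G₂.b y : ℝ≥0∞)) (fun x => v (.inr x)) (kernelOp G₂.ker) :=
  bdd_sum_iff (K := (G₁.union G₂).ker) k hp
    (fun x y => indicator_of_notMem (s := {z | (G₁.union G₂).adj (.inl x) z})
      (show ¬ (G₁.union G₂).adj (.inl x) (.inr y) from id) _)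
    (fun x y => indicator_of_notMem (s := {z | (G₁.union G₂).adj (.inr x) z})
      (show ¬ (G₁.union G₂).adj (.inr x) (.inl y) from id) _)

/-- If the targets are given tiny weights, then the averaging operator is trivial. -/
lemma LeafGraph.bdd_of_sum_le_one (G : LeafGraph) (k : Kind) {p : ℝ} (hp : 1 ≤ p)
    {δ : G.X → ℝ≥0} (hδ : ∑' x, (δ x : ℝ≥0∞) ≤ 1) :
    Bdd k p (fun y => (G.b y : ℝ≥0∞)) (fun x => (G.a x : ℝ≥0∞) * δ x) (kernelOp G.ker) := by
  have ha : ∀ x, (G.a x : ℝ≥0∞) ≠ 0 := fun x => by simpa using (G.a_pos x).ne'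
  -- Rows sum to at most 1 by `mass_adj_le`; in a column a(x) cancels and leaves b(y) ∑ δ.
  refine bdd_of_row_col k hp (fun x => ?_) fun y => ?_
  · have : ∑' y, G.ker x y = mass (fun y => (G.b y : ℝ≥0∞)) {y | G.adj x y} / G.a x := by
      unfold mass ker
      rw [div_eq_mul_inv, ← ENNReal.tsum_mul_right]
      congr 1; ext y
      by_cases h : y ∈ {y | G.adj x y}
      · simp only [indicator_of_mem h, div_eq_mul_inv]
      · simp only [indicator_of_notMem h, zero_mul]
    rw [this]
    exact ENNReal.div_le_of_le_mul (by rw [one_mul]; exact G.mass_adj_le x)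
  · calc ∑' x, (G.a x : ℝ≥0∞) * δ x * G.ker x y ≤ ∑' x, (δ x : ℝ≥0∞) * G.b y := by
          refine ENNReal.tsum_le_tsum fun x => ?_
          have : G.ker x y ≤ G.b y / G.a x := indicator_le_self' (fun _ _ => zero_le) y
          calc _ ≤ (G.a x : ℝ≥0∞) * δ x * (G.b y / G.a x) := by gcongr
            _ = δ x * (G.a x * (G.b y / G.a x)) := by ring
            _ = _ := by rw [ENNReal.mul_div_cancel (ha x) ENNReal.coe_ne_top]
      _ ≤ 1 * G.b y := by
          rw [ENNReal.tsum_mul_right]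
          gcongr
      _ = _ := one_mul _

/-- The inequality of the given kind. -/
def HasKind {V : Type} [MeasurableSpace V] (k : Kind) (T : (V → ℂ) → V → ℝ≥0∞) (p : ℝ≥0∞)
    (μ : Measure V) : Prop :=
  match k with
  | .strong => StrongType T p μ
  | .weak => WeakType T p μ
  | .restricted => RestrictedWeakType T p μ

lemma hasKind_iff {V : Type} [MeasurableSpace V] [DiscreteMeasurableSpace V] [Countable V]
    {m : V → ℝ≥0∞} (k : Kind) {T : (V → ℂ) → V → ℝ≥0∞} (hT : AbsInvariant T) {p : ℝ≥0∞}
    (h1 : 1 ≤ p) (ht : p ≠ ∞) :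
    HasKind k T p (pointMeasure m) ↔ Bdd k p.toReal m m (onNonneg T) := by
  cases k
  exacts [strongType_iff hT h1 ht, weakType_iff hT h1 ht, restrictedWeakType_iff hT ht]

/-- The space in which the types of the centered operator are those of the first graph, and the
types of the noncentered operator are the common types of both graphs. -/
theorem exists_space (G₁ G₂ : LeafGraph) :
    ∃ (Z : Type) (_ : Nonempty Z) (_ : MetricSpace Z) (_ : MeasurableSpace Z)
      (_ : BorelSpace Z) (μ : Measure Z), BallsFinitePos μ ∧ ¬ IsDoubling μ ∧
      (∀ k, HasKind k (centeredMaximal μ) ∞ μ ∧ HasKind k (noncenteredMaximal μ) ∞ μ) ∧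
      ∀ k p, 1 ≤ p → p ≠ ∞ →
        (HasKind k (centeredMaximal μ) p μ ↔ G₁.HasType k p.toReal) ∧
        (HasKind k (noncenteredMaximal μ) p μ ↔
          G₁.HasType k p.toReal ∧ G₂.HasType k p.toReal) := by
  obtain ⟨δ, hδ0, hδ⟩ := ENNReal.exists_pos_sum_of_countable one_ne_zero G₂.X
  have hδ1 : ∀ x, δ x ≤ 1 := fun x => by
    have := (ENNReal.le_tsum x).trans hδ.le
    exact_mod_cast this
  let G := G₁.union G₂
  -- Full centre weights on the first graph let the centered operator see it. The summable factors δ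
  -- hide the second graph from it, and the targets still carry the weights a for the noncentered
  -- operator.
  let e : G.X → ℝ≥0 := Sum.elim G₁.a fun x => G₂.a x * δ x
  have he : ∀ x, e x ≤ G.a x := by
    rintro (x | x)
    · exact le_rfl
    · exact mul_le_of_le_one_right' (hδ1 x)
  have he0 : ∀ x, 0 < e x := by
    rintro (x | x)
    · exact G₁.a_pos x
    · exact mul_pos (G₂.a_pos x) (hδ0 x)
  let := graphMetric (Pt.graph G.adj)
  have hdisc : DiscreteTopology (Pt G.X G.Y) := graphMetric_discreteTopology _
  have hfin : pointMeasure (G.weight e) univ < ∞ := by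
    rw [pointMeasure_apply, mass_univ]
    exact lt_top_iff_ne_top.2 (G.sum_weight_ne_top he)
  have : IsFiniteMeasure (pointMeasure (G.weight e)) := ⟨hfin⟩
  have hpos : ∀ (S : Set (Pt G.X G.Y)) (q), q ∈ S → 0 < pointMeasure (G.weight e) S := by
    intro S q hq
    rw [pointMeasure_apply]
    exact (pos_iff_ne_zero.2 (G.weight_ne_zero he0 q)).trans_le (le_mass _ hq)
  refine ⟨Pt G.X G.Y, inferInstance, inferInstance, inferInstance,
    ⟨(borel_eq_top_of_discrete (α := Pt G.X G.Y)).symm⟩, pointMeasure (G.weight e),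
    fun x s hs => ⟨hpos _ x (Metric.mem_ball_self hs), measure_lt_top _ _⟩,
    not_isDoubling_graphMetric _ _ (hpos univ .hub (mem_univ _)).ne', fun k => ?_,
    fun k p h1 ht => ?_⟩
  · obtain ⟨⟨h1, h2, h3⟩, h4, h5, h6⟩ := types_top (μ := pointMeasure (G.weight e))
      fun x => (hpos {x} x rfl).ne'
    cases k
    exacts [⟨h1, h4⟩, ⟨h2, h5⟩, ⟨h3, h6⟩]
  · have hp : 1 ≤ p.toReal := by
      simpa using (ENNReal.toReal_le_toReal ENNReal.one_ne_top ht).2 h1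
    rw [hasKind_iff k (absInvariant_centeredMaximal _) h1 ht,
      hasKind_iff k (absInvariant_noncenteredMaximal _) h1 ht,
      G.bdd_centeredMaximal_iff he he0 k hp, G.bdd_noncenteredMaximal_iff he he0 k hp]
    constructor
    · refine (G₁.bdd_union_iff G₂ k hp _).trans (and_iff_left ?_)
      have := G₂.bdd_of_sum_le_one k hp hδ.le
      simpa [e] using this
    · exact G₁.bdd_union_iff G₂ k hp _

end Union

/-! ### Weak and strong type without roots -/

section Criteria

variable {ι κ : Type*}

lemma bdd_weak_of_distribution {p : ℝ} (hp : 1 ≤ p) {w : ι → ℝ≥0∞} {v : κ → ℝ≥0∞}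
    {U : (ι → ℝ≥0) → κ → ℝ≥0∞} (C : ℝ≥0)
    (h : ∀ φ (t : ℝ≥0), 0 < t → (t : ℝ≥0∞) ^ p * mass v {x | (t : ℝ≥0∞) < U φ x} ≤
      C * ∑' y, w y * (φ y : ℝ≥0∞) ^ p) : Bdd .weak p w v U := by
  have hp0 : 0 < p := by linarith
  refine ⟨C ^ (1 / p), fun φ => iSup₂_le fun t ht => ?_⟩
  have h1 := ENNReal.rpow_le_rpow (h φ t ht) (by positivity : 0 ≤ 1 / p)
  rw [ENNReal.mul_rpow_of_nonneg _ _ (by positivity),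
    ENNReal.mul_rpow_of_nonneg _ _ (by positivity),
    ← ENNReal.rpow_mul, mul_one_div_cancel hp0.ne', ENNReal.rpow_one] at h1
  rw [ENNReal.coe_rpow_of_nonneg _ (by positivity)]
  exact h1

lemma weak_apply {p : ℝ} (hp : 1 ≤ p) {w : ι → ℝ≥0∞} {v : κ → ℝ≥0∞}
    {U : (ι → ℝ≥0) → κ → ℝ≥0∞} (h : Bdd .weak p w v U) :
    ∃ C : ℝ≥0, ∀ φ (t : ℝ≥0), 0 < t → (t : ℝ≥0∞) ^ p * mass v {x | (t : ℝ≥0∞) < U φ x} ≤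
      C * ∑' y, w y * (φ y : ℝ≥0∞) ^ p := by
  have hp0 : 0 < p := by linarith
  obtain ⟨C, hC⟩ := h
  refine ⟨C ^ p, fun φ t ht => ?_⟩
  have h1 := ENNReal.rpow_le_rpow ((le_wNorm v p (U φ) ht).trans (hC φ)) hp0.le
  simp only [src, sNorm] at h1
  rw [ENNReal.mul_rpow_of_nonneg _ _ hp0.le, ENNReal.mul_rpow_of_nonneg _ _ hp0.le,
    ← ENNReal.rpow_mul, ← ENNReal.rpow_mul, one_div_mul_cancel hp0.ne', ENNReal.rpow_one,
    ENNReal.rpow_one] at h1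
  rwa [ENNReal.coe_rpow_of_nonneg _ hp0.le]

lemma strong_apply {p : ℝ} (hp : 1 ≤ p) {w : ι → ℝ≥0∞} {v : κ → ℝ≥0∞}
    {U : (ι → ℝ≥0) → κ → ℝ≥0∞} (h : Bdd .strong p w v U) :
    ∃ C : ℝ≥0, ∀ φ, ∑' x, v x * U φ x ^ p ≤ C * ∑' y, w y * (φ y : ℝ≥0∞) ^ p := by
  have hp0 : 0 < p := by linarith
  obtain ⟨C, hC⟩ := h
  refine ⟨C ^ p, fun φ => ?_⟩
  have h1 := ENNReal.rpow_le_rpow (hC φ) hp0.le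
  simp only [tgt, src, sNorm] at h1
  rw [ENNReal.mul_rpow_of_nonneg _ _ hp0.le, ← ENNReal.rpow_mul, ← ENNReal.rpow_mul,
    one_div_mul_cancel hp0.ne', ENNReal.rpow_one, ENNReal.rpow_one] at h1
  rwa [ENNReal.coe_rpow_of_nonneg _ hp0.le]

end Criteria

/-! ### Normalization to finite total mass -/

section Scaling

/-- Scaling factors which make a sequence of masses summable. -/
def scale (A : ℕ → ℝ≥0) (k : ℕ) : ℝ≥0 := (2 ^ k * (1 + A k))⁻¹

lemma scale_pos (A : ℕ → ℝ≥0) (k : ℕ) : 0 < scale A k := by unfold scale; positivity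

lemma scale_mul_le (A : ℕ → ℝ≥0) (k : ℕ) {B : ℝ≥0} (h : B ≤ 1 + A k) :
    scale A k * B ≤ 2⁻¹ ^ k := by
  unfold scale
  rw [mul_inv, mul_assoc, inv_pow]
  refine mul_le_of_le_one_right' ?_
  rw [inv_mul_le_iff₀ (by positivity), mul_one]
  exact h

/-- Within one component the factor multiplies source and leaf weights alike, so the kernel is
unchanged there. The bound 1 + A serves both the leaves, with B = A, and a single source, with B =
1. -/
lemma tsum_scale_mul_ne_top (A B : ℕ → ℝ≥0) (h : ∀ k, B k ≤ 1 + A k) :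
    ∑' k, ((scale A k * B k : ℝ≥0) : ℝ≥0∞) ≠ ∞ := by
  refine ne_top_of_le_ne_top (b := ∑' k : ℕ, (2⁻¹ : ℝ≥0∞) ^ k) ?_
    (ENNReal.tsum_le_tsum fun k => ?_)
  · rw [ENNReal.tsum_geometric]; simp
  · have := scale_mul_le A k (h k)
    calc ((scale A k * B k : ℝ≥0) : ℝ≥0∞) ≤ ((2⁻¹ ^ k : ℝ≥0) : ℝ≥0∞) := by exact_mod_cast this
      _ = _ := by simp [ENNReal.inv_pow]

end Scaling

/-! ### Stars: all types, no types, or only the strong type missing at the endpoint -/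

section Stars

variable (n : ℕ → ℕ → ℕ)

/-- The leaves of the stars: the `k`-th star has `n k j` leaves of relative weight `2 ^ j`
for each `j ≤ k`. -/
abbrev StarLeaf : Type := Σ k : ℕ, Σ j : Fin (k + 1), Fin (n k j)

lemma tsum_starLeaf (g : ∀ k : ℕ, Fin (k + 1) → ℝ≥0∞) :
    ∑' x : StarLeaf n, g x.1 x.2.1 = ∑' k, ∑ j : Fin (k + 1), (n k j : ℝ≥0∞) * g k j := by
  rw [ENNReal.tsum_sigma (fun k (x : Σ j : Fin (k + 1), Fin (n k j)) => g k x.1)]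
  congr 1; ext k
  rw [ENNReal.tsum_sigma (fun (j : Fin (k + 1)) (_ : Fin (n k j)) => g k j), tsum_fintype]
  simp

/-- The masses of the leaves of the unscaled stars. -/
def starMass (k : ℕ) : ℝ≥0 := ∑ j : Fin (k + 1), (n k j : ℝ≥0) * 2 ^ (j : ℕ)

/-- The disjoint union of stars. -/
def starGraph (hn : ∀ k, 0 < n k k) : LeafGraph where
  X := StarLeaf n
  Y := ℕ
  countable_leaf := inferInstance
  infinite_leaf := Infinite.of_injective
    (fun k : ℕ => (⟨k, Fin.last k, ⟨0, by simpa using hn k⟩⟩ : StarLeaf n))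
    fun k l h => congrArg Sigma.fst h
  countable_source := inferInstance
  adj x k := x.1 = k
  a x := scale (starMass n) x.1 * 2 ^ (x.2.1 : ℕ)
  b k := scale (starMass n) k
  a_pos x := mul_pos (scale_pos _ _) (by positivity)
  b_pos k := scale_pos _ _
  mass_adj_le x := by
    have : {y | x.1 = y} = {x.1} := by ext; simp [eq_comm]
    rw [this, mass_singleton, ENNReal.coe_le_coe]
    exact le_mul_of_one_le_right zero_le (one_le_pow₀ one_le_two)
  sum_a := by
    rw [tsum_starLeaf n fun k j => ((scale (starMass n) k * 2 ^ (j : ℕ) : ℝ≥0) : ℝ≥0∞)]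
    have := tsum_scale_mul_ne_top (starMass n) (starMass n) fun k => le_add_self
    convert this using 4 with k
    simp only [starMass, Finset.mul_sum]
    push_cast
    exact Finset.sum_congr rfl fun j _ => by ring
  sum_b := by
    have := tsum_scale_mul_ne_top (starMass n) (fun _ => 1) fun k => le_self_add
    simpa using this

variable {n}

/-- The sums that govern the strong type inequalities for stars. -/
def starSum (n : ℕ → ℕ → ℕ) (p : ℝ) (k : ℕ) : ℝ≥0∞ :=
  ∑ j : Fin (k + 1), (n k j : ℝ≥0∞) * 2 ^ ((j : ℕ) * (1 - p))

/-- The scaling factors of the stars. -/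
def starScale (n : ℕ → ℕ → ℕ) (k : ℕ) : ℝ≥0∞ := scale (starMass n) k

lemma starScale_ne_zero (k : ℕ) : starScale n k ≠ 0 := by
  simpa [starScale] using (scale_pos _ _).ne'

lemma starScale_ne_top (k : ℕ) : starScale n k ≠ ∞ := ENNReal.coe_ne_top

/-- The weights of the leaves of the stars. -/
def starWeight (x : StarLeaf n) : ℝ≥0∞ := starScale n x.1 * 2 ^ (x.2.1 : ℕ)

/-- The kernel of the averaging operator for stars. -/
def starKer (x : StarLeaf n) (k : ℕ) : ℝ≥0∞ :=
  if x.1 = k then ((2 : ℝ≥0∞) ^ (x.2.1 : ℕ))⁻¹ else 0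

lemma starGraph_hasType_iff (hn : ∀ k, 0 < n k k) {k : Kind} {p : ℝ} :
    (starGraph n hn).HasType k p ↔
      Bdd k p (starScale n) starWeight (kernelOp (starKer (n := n))) := by
  have h1 : (starGraph n hn).ker = (starKer : StarLeaf n → ℕ → ℝ≥0∞) := by
    funext x k
    have hs := starScale_ne_zero (n := n) x.1
    by_cases h : x.1 = k
    · subst h
      refine Eq.trans ?_ (if_pos rfl).symm
      refine (indicator_of_mem (s := {y | x.1 = y}) rfl _).trans ?_
      change starScale n x.1 / ((scale (starMass n) x.1 * 2 ^ (x.2.1 : ℕ) : ℝ≥0) : ℝ≥0∞) = _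
      rw [ENNReal.coe_mul]
      change starScale n x.1 / (starScale n x.1 * _) = _
      rw [div_eq_mul_inv, ENNReal.mul_inv (.inl hs) (.inl ENNReal.coe_ne_top),
        ← mul_assoc, ENNReal.mul_inv_cancel hs (starScale_ne_top _)]
      simp
    · exact (indicator_of_notMem (s := {y | x.1 = y}) h _).trans (if_neg h).symm
  have h2 : (fun x => ((starGraph n hn).a x : ℝ≥0∞)) = (starWeight : StarLeaf n → ℝ≥0∞) := by
    funext x
    change ((scale (starMass n) x.1 * 2 ^ (x.2.1 : ℕ) : ℝ≥0) : ℝ≥0∞) = _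
    simp [starWeight, starScale]
  exact iff_of_eq (congrArg₂ (fun (v : StarLeaf n → ℝ≥0∞) (K : StarLeaf n → ℕ → ℝ≥0∞) =>
    Bdd k p (starScale n) v (kernelOp K)) h2 h1)

lemma kernelOp_starKer (φ : ℕ → ℝ≥0) (x : StarLeaf n) :
    kernelOp starKer φ x = ((2 : ℝ≥0∞) ^ (x.2.1 : ℕ))⁻¹ * φ x.1 := by
  unfold kernelOp
  rw [tsum_eq_single x.1 fun k hk => ?_, starKer, if_pos rfl]
  rw [starKer, if_neg hk.symm, zero_mul]

lemma two_pow_mul_rpow (j : ℕ) (p : ℝ) :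
    (2 : ℝ≥0∞) ^ j * ((2 : ℝ≥0∞) ^ j)⁻¹ ^ p = 2 ^ (j * (1 - p)) := by
  rw [← ENNReal.rpow_natCast, ← ENNReal.rpow_neg, ← ENNReal.rpow_mul,
    ← ENNReal.rpow_add _ _ (by simp) (by simp)]
  congr 1; ring

/-- A leaf sees only the source of its star, so the p-th power of the norm splits over stars, and
`starSum` is the exact factor on each of them. -/
lemma bdd_star_strong_iff {p : ℝ} (hp : 1 ≤ p) :
    Bdd .strong p (starScale n) starWeight (kernelOp (starKer (n := n))) ↔
      ∃ C : ℝ≥0, ∀ k, starSum n p k ≤ C := by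
  have key : ∀ φ : ℕ → ℝ≥0, ∑' x : StarLeaf n, starWeight x * kernelOp starKer φ x ^ p =
      ∑' k, starSum n p k * (starScale n k * (φ k : ℝ≥0∞) ^ p) := by
    intro φ
    simp_rw [kernelOp_starKer, starWeight]
    rw [tsum_starLeaf n fun k j => starScale n k * 2 ^ (j : ℕ) *
      (((2 : ℝ≥0∞) ^ (j : ℕ))⁻¹ * φ k) ^ p]
    congr 1; ext k
    unfold starSum
    rw [Finset.sum_mul]
    refine Finset.sum_congr rfl fun j _ => ?_
    rw [ENNReal.mul_rpow_of_nonneg _ _ (by linarith), ← two_pow_mul_rpow]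
    ring
  constructor
  · intro h
    obtain ⟨C, hC⟩ := strong_apply hp h
    refine ⟨C, fun k => ?_⟩
    have h1 := hC (Pi.single k 1)
    have h2 := (key (Pi.single k 1)).symm.trans_le h1
    have hz : ∀ l : ℕ, l ≠ k → (((Pi.single k 1 : ℕ → ℝ≥0) l : ℝ≥0) : ℝ≥0∞) ^ p = 0 := by
      intro l hl
      rw [Pi.single_eq_of_ne hl, ENNReal.coe_zero, ENNReal.zero_rpow_of_pos (by linarith)]
    rw [tsum_eq_single k (fun l hl => by rw [hz l hl, mul_zero, mul_zero]),
      tsum_eq_single k (fun l hl => by rw [hz l hl, mul_zero])] at h2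
    simp only [Pi.single_eq_same, ENNReal.coe_one, ENNReal.one_rpow, mul_one] at h2
    exact (ENNReal.mul_le_mul_iff_left (starScale_ne_zero k) (starScale_ne_top k)).1 h2
  · rintro ⟨C, hC⟩
    refine ⟨C ^ (1 / p), fun φ => ?_⟩
    simp only [tgt, src, sNorm]
    rw [ENNReal.coe_rpow_of_nonneg _ (by positivity),
      ← ENNReal.mul_rpow_of_nonneg _ _ (by positivity)]
    refine ENNReal.rpow_le_rpow ((key φ).trans_le ?_) (by positivity)
    rw [← ENNReal.tsum_mul_left]
    exact ENNReal.tsum_le_tsum fun k => mul_le_mul_left (hC k) _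

/-- Test on the source of the k-th star and its heaviest leaves, of relative weight 2^k, at half of
the kernel value 2^{-k}. -/
lemma bdd_star_restricted {p : ℝ} (hp : 1 ≤ p)
    (h : Bdd .restricted p (starScale n) starWeight (kernelOp (starKer (n := n)))) :
    ∃ C : ℝ≥0, ∀ k, (n k k : ℝ≥0∞) * 2 ^ (k * (1 - p)) ≤ C := by
  obtain ⟨C, hC⟩ := restricted_test hp h
  refine ⟨2 ^ p * C, fun k => ?_⟩
  have h1 := hC k {x : StarLeaf n | x.1 = k ∧ (x.2.1 : ℕ) = k} (2⁻¹ * (2 ^ k)⁻¹) (by positivity)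
    (fun x hx => by
      rw [starKer, if_pos hx.1, hx.2, mul_inv_cancel_left₀ two_ne_zero]
      simp)
  have hm : mass starWeight {x : StarLeaf n | x.1 = k ∧ (x.2.1 : ℕ) = k} =
      n k k * (starScale n k * 2 ^ k) := by
    unfold mass
    have : ∀ x : StarLeaf n, {x : StarLeaf n | x.1 = k ∧ (x.2.1 : ℕ) = k}.indicator
        starWeight x =
        if x.1 = k ∧ (x.2.1 : ℕ) = k then starScale n x.1 * 2 ^ (x.2.1 : ℕ) else 0 := by
      intro x
      by_cases h : x.1 = k ∧ (x.2.1 : ℕ) = k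
      · rw [if_pos h, indicator_of_mem (by exact h), starWeight]
      · rw [if_neg h, indicator_of_notMem (by exact h)]
    simp_rw [this]
    rw [tsum_starLeaf n fun l j => if l = k ∧ (j : ℕ) = k then
          (starScale n l * 2 ^ (j : ℕ)) else 0, tsum_eq_single k,
      Finset.sum_eq_single (Fin.last k)]
    · simp
    · intro j _ hj
      rw [if_neg, mul_zero]
      rintro ⟨-, h2⟩
      exact hj (Fin.ext h2)
    · simp
    · intro l hl
      exact Finset.sum_eq_zero fun j _ => by rw [if_neg (fun h => hl h.1), mul_zero]
  rw [hm] at h1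
  have h2 : ((2⁻¹ * (2 ^ k)⁻¹ : ℝ≥0) : ℝ≥0∞) ^ p * (n k k * (starScale n k * 2 ^ k)) =
      (2 ^ p)⁻¹ * (n k k * 2 ^ (k * (1 - p))) * starScale n k := by
    rw [← two_pow_mul_rpow, ENNReal.coe_mul, ENNReal.mul_rpow_of_nonneg _ _ (by linarith),
      ← ENNReal.inv_rpow]
    simp only [ENNReal.coe_inv two_ne_zero,
      ENNReal.coe_inv (pow_ne_zero k (two_ne_zero (α := ℝ≥0)))]
    push_cast
    ring
  rw [h2] at h1
  have h3 := (ENNReal.mul_le_mul_iff_left (starScale_ne_zero k) (starScale_ne_top k)).1 h1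
  rw [ENNReal.coe_mul, ENNReal.coe_rpow_of_nonneg _ (by linarith), ENNReal.coe_ofNat]
  rwa [ENNReal.inv_mul_le_iff (by simp) (by simp)] at h3

/-- The ratio 2^r is at least 2, so all terms before an index sum to at most the term at that index;
the last term with 2^j < u dominates. -/
lemma sum_rpow_le_of_two_pow_lt {r : ℝ} (hr : 1 ≤ r) (u : ℝ≥0∞) (k : ℕ) :
    ∑ j ∈ Finset.range k, (if (2 : ℝ≥0∞) ^ j < u then (2 : ℝ≥0∞) ^ (j * r) else 0) ≤
      2 * u ^ r := by
  have hgeom : ∀ k : ℕ, ∑ j ∈ Finset.range k,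
      (if (2 : ℝ≥0∞) ^ j < u then (2 : ℝ≥0∞) ^ (j * r) else 0) ≤ 2 ^ (k * r) := by
    intro k
    induction k with
    | zero => simp
    | succ k ih =>
      rw [Finset.sum_range_succ]
      calc _ ≤ (2 : ℝ≥0∞) ^ (k * r) + 2 ^ (k * r) := by
            gcongr
            split_ifs
            exacts [le_rfl, zero_le]
        _ = 2 ^ (k * r) * 2 ^ (1 : ℝ) := by rw [ENNReal.rpow_one]; ring
        _ ≤ 2 ^ (k * r) * 2 ^ r := by
            gcongr
            norm_num
        _ = _ := by
            rw [← ENNReal.rpow_add _ _ (by simp) (by simp)]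
            push_cast; congr 1; ring
  induction k with
  | zero => simp
  | succ k ih =>
    rw [Finset.sum_range_succ]
    split_ifs with h
    · have h1 : (2 : ℝ≥0∞) ^ (k * r) ≤ u ^ r := by
        rw [ENNReal.rpow_mul, ENNReal.rpow_natCast]
        gcongr
      rw [two_mul]
      exact add_le_add ((hgeom k).trans h1) h1
    · rwa [add_zero]

/-- The value 2^{-j}φ exceeds t exactly when 2^j < φ/t. These levels have relative mass at most a
constant times ∑ 2^{jr}, which is dominated by its last term and so by (φ/t)^r; the number of levels
does not enter. -/
lemma bdd_star_weak {r : ℝ} (hr : 1 ≤ r) (C : ℝ≥0)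
    (h : ∀ k j, (n k j : ℝ≥0∞) ≤ C * 2 ^ (j * (r - 1))) :
    Bdd .weak r (starScale n) starWeight (kernelOp (starKer (n := n))) := by
  refine bdd_weak_of_distribution hr (C * 2) fun φ t ht => ?_
  have ht0 : (t : ℝ≥0∞) ≠ 0 := by simpa using ht.ne'
  unfold mass
  have h1 : ∀ x : StarLeaf n, {x : StarLeaf n | (t : ℝ≥0∞) <
      kernelOp starKer φ x}.indicator starWeight x =
        if (2 : ℝ≥0∞) ^ (x.2.1 : ℕ) < φ x.1 / t then starScale n x.1 * 2 ^ (x.2.1 : ℕ) else 0 := by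
    intro x
    have : (t : ℝ≥0∞) < kernelOp starKer φ x ↔ (2 : ℝ≥0∞) ^ (x.2.1 : ℕ) < φ x.1 / t := by
      rw [kernelOp_starKer, mul_comm, ← div_eq_mul_inv,
        ENNReal.lt_div_iff_mul_lt (.inl (by simp)) (.inl (by simp)),
        ENNReal.lt_div_iff_mul_lt (.inl ht0) (.inl ENNReal.coe_ne_top), mul_comm]
    by_cases h : (2 : ℝ≥0∞) ^ (x.2.1 : ℕ) < φ x.1 / t
    · rw [if_pos h, indicator_of_mem (by exact this.2 h), starWeight]
    · rw [if_neg h, indicator_of_notMem (by exact fun h' => h (this.1 h'))]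
  simp_rw [h1]
  rw [tsum_starLeaf n fun l j => if (2 : ℝ≥0∞) ^ (j : ℕ) < φ l / t then
          (starScale n l * 2 ^ (j : ℕ)) else 0,
    ← ENNReal.tsum_mul_left, ← ENNReal.tsum_mul_left]
  refine ENNReal.tsum_le_tsum fun k => ?_
  have h2 : ∑ j : Fin (k + 1), (n k j : ℝ≥0∞) * (if (2 : ℝ≥0∞) ^ (j : ℕ) < φ k / t then
          (starScale n k * 2 ^ (j : ℕ)) else 0) ≤
      C * starScale n k * (2 * (φ k / t) ^ r) := by
    refine le_trans ?_ (mul_le_mul_right (sum_rpow_le_of_two_pow_lt hr (φ k / t) (k + 1)) _)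
    rw [← Fin.sum_univ_eq_sum_range (fun j =>
      if (2 : ℝ≥0∞) ^ j < φ k / t then (2 : ℝ≥0∞) ^ (j * r) else 0), Finset.mul_sum]
    refine Finset.sum_le_sum fun j _ => ?_
    split_ifs
    · calc (n k j : ℝ≥0∞) * (starScale n k * 2 ^ (j : ℕ))
          ≤ C * 2 ^ ((j : ℕ) * (r - 1)) * (starScale n k * 2 ^ (j : ℕ)) := by
            gcongr; exact h k j
        _ = C * starScale n k * (2 ^ ((j : ℕ) * (r - 1)) * 2 ^ (j : ℕ)) := by ring
        _ = _ := by
            rw [← ENNReal.rpow_natCast, ← ENNReal.rpow_add _ _ (by simp) (by simp)]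
            congr 2; ring
    · simp
  calc _ ≤ (t : ℝ≥0∞) ^ r * (C * starScale n k * (2 * (φ k / t) ^ r)) := by gcongr
    _ = C * 2 * (starScale n k * ((φ k / t * t) ^ r)) := by
        rw [ENNReal.mul_rpow_of_nonneg _ _ (by linarith)]; ring
    _ = _ := by
        rw [ENNReal.div_mul_cancel ht0 ENNReal.coe_ne_top]
        simp

/-- A natural number comparable to `2 ^ (k * (r - 1))`. -/
def approxPow (r : ℝ) (k : ℕ) : ℕ := ⌈(2 : ℝ) ^ (k * (r - 1))⌉₊

lemma two_rpow_eq_ofReal (x : ℝ) : (2 : ℝ≥0∞) ^ x = ENNReal.ofReal (2 ^ x) := by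
  rw [← ENNReal.ofReal_rpow_of_pos two_pos, ENNReal.ofReal_ofNat]

lemma le_approxPow (r : ℝ) (k : ℕ) : (2 : ℝ≥0∞) ^ (k * (r - 1)) ≤ approxPow r k := by
  rw [two_rpow_eq_ofReal, ← ENNReal.ofReal_natCast]
  exact ENNReal.ofReal_le_ofReal (Nat.le_ceil _)

lemma approxPow_le {r : ℝ} (hr : 1 ≤ r) (k : ℕ) :
    (approxPow r k : ℝ≥0∞) ≤ 2 * 2 ^ (k * (r - 1)) := by
  rw [two_rpow_eq_ofReal, ← ENNReal.ofReal_natCast, ← ENNReal.ofReal_ofNat 2,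
    ← ENNReal.ofReal_mul two_pos.le]
  refine ENNReal.ofReal_le_ofReal ?_
  have h1 : (1 : ℝ) ≤ 2 ^ (k * (r - 1)) :=
    Real.one_le_rpow one_le_two (mul_nonneg k.cast_nonneg (by linarith))
  have := Nat.ceil_lt_add_one (zero_le_one.trans h1)
  unfold approxPow
  linarith

lemma approxPow_pos (r : ℝ) (k : ℕ) : 0 < approxPow r k :=
  Nat.ceil_pos.2 (by positivity)

lemma two_rpow_mul (k : ℕ) (x y : ℝ) :
    (2 : ℝ≥0∞) ^ (k * x) * 2 ^ (k * y) = 2 ^ (k * (x + y)) := by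
  rw [← ENNReal.rpow_add _ _ (by simp) (by simp), mul_add]

/-- Exponentials with positive rate are unbounded. -/
lemma not_forall_two_rpow_le {x : ℝ} (hx : 0 < x) (C : ℝ≥0) :
    ¬ ∀ k : ℕ, (2 : ℝ≥0∞) ^ (k * x) ≤ C := by
  intro h
  have h1 : (1 : ℝ) < 2 ^ x := Real.one_lt_rpow one_lt_two hx
  obtain ⟨k, hk⟩ := pow_unbounded_of_one_lt (C : ℝ) h1
  have h2 := h k
  rw [two_rpow_eq_ofReal, mul_comm, Real.rpow_mul two_pos.le, Real.rpow_natCast,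
    ← ENNReal.ofReal_coe_nnreal, ENNReal.ofReal_le_ofReal_iff C.coe_nonneg] at h2
  linarith

lemma exists_mul_two_rpow_le {x : ℝ} (hx : x < 0) :
    ∃ C : ℝ≥0, ∀ k : ℕ, ((k : ℝ≥0∞) + 1) * 2 ^ (k * x) ≤ C := by
  have h1 : (2 : ℝ) ^ x < 1 := Real.rpow_lt_one_of_one_lt_of_neg one_lt_two hx
  have h0 : (0 : ℝ) ≤ 2 ^ x := by positivity
  have h2 := (tendsto_self_mul_const_pow_of_lt_one h0 h1).add
    (tendsto_pow_atTop_nhds_zero_of_lt_one h0 h1)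
  obtain ⟨C, hC⟩ := h2.bddAbove_range
  refine ⟨C.toNNReal, fun k => ?_⟩
  have h3 : (k : ℝ) * (2 ^ x) ^ k + (2 ^ x) ^ k ≤ C := hC ⟨k, rfl⟩
  rw [two_rpow_eq_ofReal, mul_comm (k : ℝ), Real.rpow_mul two_pos.le, Real.rpow_natCast,
    ← ENNReal.ofReal_natCast, ← ENNReal.ofReal_one, ← ENNReal.ofReal_add k.cast_nonneg zero_le_one,
    ← ENNReal.ofReal_mul (by positivity)]
  refine ENNReal.ofReal_le_ofReal (le_trans (le_of_eq ?_) h3)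
  ring

open Classical in
/-- Multiplicities of stars with leaves of a single weight. -/
def diag (N : ℕ → ℕ) (k j : ℕ) : ℕ := if j = k then N k else 0

lemma starSum_diag (N : ℕ → ℕ) (p : ℝ) (k : ℕ) :
    starSum (diag N) p k = N k * 2 ^ (k * (1 - p)) := by
  unfold starSum diag
  rw [Finset.sum_eq_single (Fin.last k)]
  · simp
  · intro j _ hj
    have : (j : ℕ) ≠ k := fun h => hj (Fin.ext h)
    simp [this]
  · simp

/-- The graph of stars for which no inequality holds. -/
theorem exists_leafGraph_none :
    ∃ G : LeafGraph, ∀ p : ℝ, 1 ≤ p → ¬ G.HasType .restricted p := by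
  refine ⟨starGraph (diag fun k => 2 ^ (k * k)) fun k => by simp [diag], fun p hp h => ?_⟩
  rw [starGraph_hasType_iff] at h
  obtain ⟨C, hC⟩ := bdd_star_restricted hp h
  obtain ⟨l, hl⟩ := exists_nat_ge p
  refine not_forall_two_rpow_le one_pos C fun k => ?_
  -- For l ≥ p the exponent at index k + l is (k+l)(k+l+1-p) ≥ k.
  refine le_trans ?_ (hC (k + l))
  simp only [diag, if_true]
  push_cast
  rw [← ENNReal.rpow_natCast, ← ENNReal.rpow_add _ _ (by simp) (by simp)]
  refine ENNReal.rpow_le_rpow_of_exponent_le (by norm_num) ?_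
  push_cast
  nlinarith [(k.cast_nonneg : (0 : ℝ) ≤ k), (l.cast_nonneg : (0 : ℝ) ≤ l)]

/-- All inequalities hold exactly from the exponent `r` on. -/
theorem exists_leafGraph_closed {r : ℝ} (hr : 1 ≤ r) : ∃ G : LeafGraph,
    (∀ p, r ≤ p → G.HasType .strong p) ∧
    ∀ p, 1 ≤ p → p < r → ¬ G.HasType .restricted p := by
  refine ⟨starGraph (diag (approxPow r)) fun k => by simp [diag, approxPow_pos], fun p hp => ?_,
    fun p hp hpr h => ?_⟩
  · rw [starGraph_hasType_iff, bdd_star_strong_iff (hr.trans hp)]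
    -- The 2 pays for rounding up in `approxPow`; the remaining factor 2^{k(r-p)} is at most 1.
    refine ⟨2, fun k => ?_⟩
    rw [starSum_diag]
    calc _ ≤ 2 * (2 : ℝ≥0∞) ^ (k * (r - 1)) * 2 ^ (k * (1 - p)) := by
          gcongr; exact approxPow_le hr k
      _ = 2 * 2 ^ (k * (r - p)) := by
          rw [mul_assoc, two_rpow_mul]; congr 3; ring
      _ ≤ 2 * 2 ^ (0 : ℝ) := by
          gcongr
          · norm_num
          · exact mul_nonpos_of_nonneg_of_nonpos k.cast_nonneg (by linarith)
      _ = _ := by simp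
  · rw [starGraph_hasType_iff] at h
    obtain ⟨C, hC⟩ := bdd_star_restricted hp h
    refine not_forall_two_rpow_le (sub_pos.2 hpr) C fun k => ?_
    refine le_trans ?_ (hC k)
    simp only [diag, if_true]
    calc (2 : ℝ≥0∞) ^ (k * (r - p)) = 2 ^ (k * (r - 1)) * 2 ^ (k * (1 - p)) := by
          rw [two_rpow_mul]; congr 2; ring
      _ ≤ _ := by gcongr; exact le_approxPow r k

/-- All inequalities hold exactly beyond the exponent `r`. -/
theorem exists_leafGraph_open {r : ℝ} (hr : 1 ≤ r) : ∃ G : LeafGraph,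
    (∀ p, r < p → G.HasType .strong p) ∧
    ∀ p, 1 ≤ p → p ≤ r → ¬ G.HasType .restricted p := by
  refine ⟨starGraph (diag fun k => (k + 1) * approxPow r k)
    fun k => by simp [diag, approxPow_pos], fun p hp => ?_, fun p hp hpr h => ?_⟩
  · rw [starGraph_hasType_iff, bdd_star_strong_iff (hr.trans hp.le)]
    -- Beyond r the exponential decay absorbs the factor k + 1; at r itself nothing compensates it.
    obtain ⟨C, hC⟩ := exists_mul_two_rpow_le (sub_neg.2 hp)
    refine ⟨2 * C, fun k => ?_⟩
    rw [starSum_diag]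
    push_cast
    calc _ ≤ ((k : ℝ≥0∞) + 1) * (2 * (2 : ℝ≥0∞) ^ (k * (r - 1))) * 2 ^ (k * (1 - p)) := by
          gcongr; exact approxPow_le hr k
      _ = 2 * (((k : ℝ≥0∞) + 1) * (2 ^ (k * (r - 1)) * 2 ^ (k * (1 - p)))) := by ring
      _ = 2 * (((k : ℝ≥0∞) + 1) * 2 ^ (k * (r - p))) := by
          rw [two_rpow_mul]; congr 4; ring
      _ ≤ _ := by gcongr; exact hC k
  · rw [starGraph_hasType_iff] at h
    obtain ⟨C, hC⟩ := bdd_star_restricted hp h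
    obtain ⟨k, hk⟩ := exists_nat_gt C
    have h1 := hC k
    simp only [diag, if_true] at h1
    push_cast at h1
    have h2 : (k : ℝ≥0∞) ≤ C := by
      refine le_trans ?_ h1
      calc (k : ℝ≥0∞) ≤ (k + 1) * 1 := by rw [mul_one]; exact le_self_add
        _ ≤ (k + 1) * 2 ^ (k * (r - p)) := by
            gcongr
            rw [← ENNReal.rpow_zero (x := 2)]
            exact ENNReal.rpow_le_rpow_of_exponent_le one_le_two
              (mul_nonneg k.cast_nonneg (by linarith))
        _ = (k + 1) * (2 ^ (k * (r - 1)) * 2 ^ (k * (1 - p))) := by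
            rw [two_rpow_mul]; congr 3; ring
        _ ≤ _ := by
            rw [mul_assoc]; gcongr; exact le_approxPow r k
    exact absurd hk (not_lt.2 (by exact_mod_cast h2))

/-- At the exponent `r` the weak type inequality holds but the strong one does not. -/
theorem exists_leafGraph_weak {r : ℝ} (hr : 1 ≤ r) : ∃ G : LeafGraph,
    (∀ p, r < p → G.HasType .strong p) ∧ G.HasType .weak r ∧ ¬ G.HasType .strong r ∧
    ∀ p, 1 ≤ p → p < r → ¬ G.HasType .restricted p := by
  refine ⟨starGraph (fun _ => approxPow r) fun k => approxPow_pos r k, fun p hp => ?_, ?_, ?_,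
    fun p hp hpr h => ?_⟩
  -- Level j contributes about 2^{j(r-p)}: a convergent geometric series for p > r, but a term of
  -- order 1 for each of the k + 1 levels at p = r.
  · rw [starGraph_hasType_iff, bdd_star_strong_iff (hr.trans hp.le)]
    have hlt : (2 : ℝ≥0∞) ^ (r - p) < 1 :=
      ENNReal.rpow_lt_one_of_one_lt_of_neg (by norm_num) (by linarith)
    have hne : 2 * (1 - (2 : ℝ≥0∞) ^ (r - p))⁻¹ ≠ ∞ :=
      ENNReal.mul_ne_top (by simp) (ENNReal.inv_ne_top.2 (tsub_pos_of_lt hlt).ne')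
    refine ⟨(2 * (1 - (2 : ℝ≥0∞) ^ (r - p))⁻¹).toNNReal, fun k => ?_⟩
    rw [ENNReal.coe_toNNReal hne, ← ENNReal.tsum_geometric]
    unfold starSum
    rw [Fin.sum_univ_eq_sum_range (fun j => (approxPow r j : ℝ≥0∞) * 2 ^ (j * (1 - p)))]
    refine le_trans ?_ (mul_le_mul_right (ENNReal.sum_le_tsum (Finset.range (k + 1))) _)
    rw [Finset.mul_sum]
    refine Finset.sum_le_sum fun j _ => ?_
    calc _ ≤ 2 * (2 : ℝ≥0∞) ^ (j * (r - 1)) * 2 ^ (j * (1 - p)) := by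
          gcongr; exact approxPow_le hr j
      _ = 2 * 2 ^ ((r - p) * j) := by
          rw [mul_assoc, two_rpow_mul]; congr 2; ring
      _ = _ := by rw [ENNReal.rpow_mul, ENNReal.rpow_natCast]
  · rw [starGraph_hasType_iff]
    exact bdd_star_weak hr 2 fun k j => approxPow_le hr j
  · rw [starGraph_hasType_iff, bdd_star_strong_iff hr]
    rintro ⟨C, hC⟩
    obtain ⟨k, hk⟩ := exists_nat_gt C
    have h1 : (k : ℝ≥0∞) ≤ C := by
      refine le_trans ?_ (hC k)
      calc (k : ℝ≥0∞) ≤ ∑ j : Fin (k + 1), 1 := by simp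
        _ ≤ _ := by
          refine Finset.sum_le_sum fun j _ => ?_
          calc (1 : ℝ≥0∞) = 2 ^ ((j : ℕ) * (r - 1)) * 2 ^ ((j : ℕ) * (1 - r)) := by
                rw [two_rpow_mul]; simp
            _ ≤ _ := by gcongr; exact le_approxPow r j
    exact absurd hk (not_lt.2 (by exact_mod_cast h1))
  · rw [starGraph_hasType_iff] at h
    obtain ⟨C, hC⟩ := bdd_star_restricted hp h
    refine not_forall_two_rpow_le (sub_pos.2 hpr) C fun k => ?_
    refine le_trans ?_ (hC k)
    calc (2 : ℝ≥0∞) ^ (k * (r - p)) = 2 ^ (k * (r - 1)) * 2 ^ (k * (1 - p)) := by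
          rw [two_rpow_mul]; congr 2; ring
      _ ≤ _ := by gcongr; exact le_approxPow r k

end Stars

/-! ### Dyadic trees: restricted weak type without weak type -/

section Trees

/-- The leaves of the trees: the `n`-th tree has `2 ^ n` leaves. -/
abbrev TreeLeaf : Type := Σ n : ℕ, Fin (2 ^ n)

/-- The sources of the trees: the dyadic intervals of length `2 ^ j` with `j < n`. -/
abbrev TreeSource : Type := Σ n : ℕ, Σ j : Fin n, Fin (2 ^ (n - j))

/-- The dyadic interval of length `2 ^ j` that contains the leaf. -/
def treeParent (x : TreeLeaf) (j : Fin x.1) : TreeSource :=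
  ⟨x.1, j, ⟨x.2 / 2 ^ (j : ℕ), by
    rw [Nat.div_lt_iff_lt_mul (by positivity), ← pow_add, Nat.sub_add_cancel j.2.le]
    exact x.2.2⟩⟩

/-- The leaves of a dyadic interval. -/
def treeChild (y : TreeSource) (k : Fin (2 ^ (y.2.1 : ℕ))) : TreeLeaf :=
  ⟨y.1, ⟨y.2.2 * 2 ^ (y.2.1 : ℕ) + k, by
    have h1 : (y.2.2 : ℕ) + 1 ≤ 2 ^ (y.1 - y.2.1) := y.2.2.2
    have h2 : 2 ^ y.1 = 2 ^ (y.1 - y.2.1) * 2 ^ (y.2.1 : ℕ) := by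
      rw [← pow_add, Nat.sub_add_cancel y.2.1.2.le]
    calc _ < (y.2.2 : ℕ) * 2 ^ (y.2.1 : ℕ) + 2 ^ (y.2.1 : ℕ) := by
          have := k.2; omega
      _ = (y.2.2 + 1 : ℕ) * 2 ^ (y.2.1 : ℕ) := by ring
      _ ≤ _ := by rw [h2]; gcongr⟩⟩

/-- A leaf is adjacent to the dyadic intervals that contain it. -/
def treeAdj (x : TreeLeaf) (y : TreeSource) : Prop := y ∈ range (treeParent x)

lemma treeParent_injective (x : TreeLeaf) : (treeParent x).Injective := by
  intro i j h
  simp only [treeParent, Sigma.mk.injEq, heq_eq_eq, true_and] at h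
  exact h.1

lemma treeChild_injective (y : TreeSource) : (treeChild y).Injective := by
  intro i j h
  simp only [treeChild, Sigma.mk.injEq, heq_eq_eq, true_and, Fin.mk.injEq] at h
  exact Fin.ext (by omega)

lemma treeAdj_iff (x : TreeLeaf) (y : TreeSource) : treeAdj x y ↔ x ∈ range (treeChild y) := by
  constructor
  · rintro ⟨j, rfl⟩
    refine ⟨⟨x.2 % 2 ^ (j : ℕ), Nat.mod_lt _ (by positivity)⟩, ?_⟩
    refine Sigma.ext rfl (heq_of_eq (Fin.ext ?_))
    exact Nat.div_add_mod' _ _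
  · rintro ⟨k, rfl⟩
    refine ⟨y.2.1, Sigma.ext rfl (heq_of_eq (Sigma.ext rfl (heq_of_eq (Fin.ext ?_))))⟩
    change (y.2.2 * 2 ^ (y.2.1 : ℕ) + k : ℕ) / 2 ^ (y.2.1 : ℕ) = y.2.2
    rw [mul_comm, Nat.mul_add_div (by positivity), Nat.div_eq_of_lt k.2, add_zero]

lemma tsum_treeSource (x : TreeLeaf) (g : TreeSource → ℝ≥0∞) :
    ∑' y, {y | treeAdj x y}.indicator g y = ∑ j, g (treeParent x j) := by
  rw [← tsum_fintype (L := .unconditional _), ← (treeParent_injective x).tsum_eq]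
  · exact tsum_congr fun j => indicator_of_mem (s := {y | treeAdj x y}) ⟨j, rfl⟩ _
  · intro y hy
    by_contra hc
    exact hy (indicator_of_notMem (s := {y | treeAdj x y}) hc _)

lemma tsum_treeLeaf (y : TreeSource) (g : TreeLeaf → ℝ≥0∞) :
    ∑' x, {x | treeAdj x y}.indicator g x = ∑ k, g (treeChild y k) := by
  rw [← tsum_fintype (L := .unconditional _), ← (treeChild_injective y).tsum_eq]
  · exact tsum_congr fun j =>
      indicator_of_mem (s := {x | treeAdj x y}) ((treeAdj_iff _ y).2 ⟨j, rfl⟩) _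
  · intro x hx
    by_contra hc
    exact hx (indicator_of_notMem (s := {x | treeAdj x y})
      (fun h => hc ((treeAdj_iff _ y).1 h)) _)

lemma tsum_treeLeaf_const (y : TreeSource) (g : ℕ → ℝ≥0∞) :
    ∑' x : TreeLeaf, {x : TreeLeaf | treeAdj x y}.indicator (fun x => g x.1) x =
      2 ^ (y.2.1 : ℕ) * g y.1 := by
  rw [tsum_treeLeaf]
  simp [treeChild]

lemma tsum_treeSource_eq (g : ∀ n : ℕ, Fin n → ℝ≥0∞) :
    ∑' y : TreeSource, g y.1 y.2.1 = ∑' n, ∑ j : Fin n, 2 ^ (n - j) * g n j := by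
  rw [ENNReal.tsum_sigma (fun n (y : Σ j : Fin n, Fin (2 ^ (n - j))) => g n y.1)]
  congr 1; ext n
  rw [ENNReal.tsum_sigma (fun (j : Fin n) (_ : Fin (2 ^ (n - j))) => g n j), tsum_fintype]
  simp

/-- The ratio between the weights of consecutive levels. -/
def treeRatio (r : ℝ) : ℝ≥0 := 2 ^ (-(1 / (r - 1)))

lemma treeRatio_lt_one {r : ℝ} (hr : 1 < r) : treeRatio r < 1 :=
  NNReal.rpow_lt_one_of_one_lt_of_neg one_lt_two
    (by rw [neg_lt_zero]; exact one_div_pos.2 (by linarith))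

lemma treeRatio_pos (r : ℝ) : 0 < treeRatio r := NNReal.rpow_pos two_pos

lemma treeRatio_pow (r : ℝ) (j : ℕ) :
    (treeRatio r : ℝ≥0∞) ^ j = 2 ^ (j * (-(1 / (r - 1)))) := by
  rw [mul_comm, ENNReal.rpow_mul, ENNReal.rpow_natCast, treeRatio,
    ENNReal.coe_rpow_of_ne_zero two_ne_zero]
  rfl

/-- The weight of the sources of a level relative to the weight of the leaves. -/
def levelWeight (r : ℝ) (j : ℕ) : ℝ≥0 := (1 - treeRatio r) * treeRatio r ^ j

lemma levelWeight_pos {r : ℝ} (hr : 1 < r) (j : ℕ) : 0 < levelWeight r j :=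
  mul_pos (tsub_pos_of_lt (treeRatio_lt_one hr)) (pow_pos (treeRatio_pos r) j)

lemma sum_geometric_le {ρ : ℝ≥0} (h : ρ < 1) (n : ℕ) :
    ∑ j : Fin n, (((1 - ρ) * ρ ^ (j : ℕ) : ℝ≥0) : ℝ≥0∞) ≤ 1 := by
  rw [Fin.sum_univ_eq_sum_range (fun j => (((1 - ρ) * ρ ^ j : ℝ≥0) : ℝ≥0∞))]
  refine (ENNReal.sum_le_tsum _).trans ?_
  push_cast
  rw [ENNReal.tsum_mul_left, ENNReal.tsum_geometric]
  refine (ENNReal.mul_inv_cancel ?_ ?_).le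
  · exact (tsub_pos_of_lt (by exact_mod_cast h)).ne'
  · exact ne_top_of_le_ne_top ENNReal.one_ne_top tsub_le_self

lemma levelWeight_le_one {r : ℝ} (hr : 1 < r) (j : ℕ) : levelWeight r j ≤ 1 :=
  mul_le_one' tsub_le_self (pow_le_one₀ zero_le (treeRatio_lt_one hr).le)

/-- The scaling factors of the trees. -/
def treeScale (n : ℕ) : ℝ≥0 := scale (fun n => n * 2 ^ n + 2 ^ n) n

lemma treeScale_pos (n : ℕ) : 0 < treeScale n := scale_pos _ _

/-- The disjoint union of trees. -/
def treeGraph {r : ℝ} (hr : 1 < r) : LeafGraph where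
  X := TreeLeaf
  Y := TreeSource
  countable_leaf := inferInstance
  infinite_leaf := Infinite.of_injective (fun n : ℕ => (⟨n, ⟨0, by positivity⟩⟩ : TreeLeaf))
    fun k l h => congrArg Sigma.fst h
  countable_source := inferInstance
  adj := treeAdj
  a x := treeScale x.1
  b y := treeScale y.1 * levelWeight r y.2.1
  a_pos x := treeScale_pos _
  b_pos y := mul_pos (treeScale_pos _) (levelWeight_pos hr _)
  mass_adj_le x := by
    unfold mass
    rw [tsum_treeSource]
    simp only [treeParent, ENNReal.coe_mul]
    rw [← Finset.mul_sum]
    exact mul_le_of_le_one_right' (sum_geometric_le (treeRatio_lt_one hr) x.1)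
  sum_a := by
    rw [ENNReal.tsum_sigma (fun n (_ : Fin (2 ^ n)) => (treeScale n : ℝ≥0∞))]
    have := tsum_scale_mul_ne_top (fun n => n * 2 ^ n + 2 ^ n) (fun n => 2 ^ n)
      fun k => le_add_left le_add_self
    convert this using 4 with n
    simp [treeScale, mul_comm]
  sum_b := by
    rw [tsum_treeSource_eq fun n j => ((treeScale n * levelWeight r j : ℝ≥0) : ℝ≥0∞)]
    have := tsum_scale_mul_ne_top (fun n => n * 2 ^ n + 2 ^ n) (fun n => n * 2 ^ n)
      fun k => le_add_left le_self_add
    refine ne_top_of_le_ne_top this (ENNReal.tsum_le_tsum fun n => ?_)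
    calc _ ≤ ∑ j : Fin n, (2 : ℝ≥0∞) ^ n * treeScale n := by
          refine Finset.sum_le_sum fun j _ => ?_
          gcongr
          · norm_num
          · omega
          · exact mul_le_of_le_one_right' (levelWeight_le_one hr _)
      _ = _ := by
          simp only [Finset.sum_const, Finset.card_univ, Fintype.card_fin, nsmul_eq_mul]
          change _ = ((treeScale n * _ : ℝ≥0) : ℝ≥0∞)
          push_cast
          ring

/-- The weights of the leaves. -/
def treeWeight (x : TreeLeaf) : ℝ≥0∞ := treeScale x.1

/-- The weights of the sources. -/
def treeSourceWeight (r : ℝ) (y : TreeSource) : ℝ≥0∞ := treeScale y.1 * levelWeight r y.2.1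

/-- The kernel of the averaging operator for trees. -/
def treeKer (r : ℝ) (x : TreeLeaf) : TreeSource → ℝ≥0∞ :=
  {y | treeAdj x y}.indicator fun y => (levelWeight r y.2.1 : ℝ≥0∞)

lemma treeScale_ne_zero (n : ℕ) : (treeScale n : ℝ≥0∞) ≠ 0 := by
  simpa using (treeScale_pos n).ne'

lemma treeGraph_hasType_iff {r : ℝ} (hr : 1 < r) {k : Kind} {p : ℝ} :
    (treeGraph hr).HasType k p ↔
      Bdd k p (treeSourceWeight r) treeWeight (kernelOp (treeKer r)) := by
  have h1 : (treeGraph hr).ker = treeKer r := by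
    funext x y
    by_cases h : treeAdj x y
    · refine (indicator_of_mem (s := {y | treeAdj x y}) h _).trans
        (Eq.trans ?_ (indicator_of_mem (s := {y | treeAdj x y}) h _).symm)
      obtain ⟨j, rfl⟩ := h
      change ((treeScale x.1 * levelWeight r j : ℝ≥0) : ℝ≥0∞) / treeScale x.1 = levelWeight r j
      rw [ENNReal.coe_mul, mul_comm,
        ENNReal.mul_div_cancel_right (treeScale_ne_zero _) ENNReal.coe_ne_top]
    · exact (indicator_of_notMem (s := {y | treeAdj x y}) h _).trans
        (indicator_of_notMem (s := {y | treeAdj x y}) h _).symm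
  have h2 : (fun y => ((treeGraph hr).b y : ℝ≥0∞)) = treeSourceWeight r := by
    funext y
    change ((treeScale y.1 * levelWeight r y.2.1 : ℝ≥0) : ℝ≥0∞) = _
    exact ENNReal.coe_mul _ _
  exact iff_of_eq (congrArg₂ (fun (w : TreeSource → ℝ≥0∞) (K : TreeLeaf → TreeSource → ℝ≥0∞) =>
    Bdd k p w treeWeight (kernelOp K)) h2 h1)

lemma kernelOp_treeKer (r : ℝ) (φ : TreeSource → ℝ≥0) (x : TreeLeaf) :
    kernelOp (treeKer r) φ x = ∑ j : Fin x.1, (levelWeight r j : ℝ≥0∞) * φ (treeParent x j) := by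
  unfold kernelOp
  refine Eq.trans (tsum_congr fun y => ?_)
    (tsum_treeSource x fun y => (levelWeight r y.2.1 : ℝ≥0∞) * φ y)
  by_cases h : y ∈ {y | treeAdj x y}
  · simp only [treeKer, indicator_of_mem h]
  · simp only [treeKer, indicator_of_notMem h, zero_mul]

/-- The level factor is split as c · L with c = (1-θ)θ^j, whose rows sum to at most 1, and L = Dω^j.
The choice ω = 2^{-1/(p-1)} makes 2^j L^{p-1} independent of j, balancing the columns; p > r is what
gives θ < 1. -/
lemma bdd_tree_strong {r p : ℝ} (hr : 1 < r) (hp : r < p) :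
    Bdd .strong p (treeSourceWeight r) treeWeight (kernelOp (treeKer r)) := by
  set ω : ℝ≥0 := treeRatio p with hω
  have hω0 : 0 < ω := treeRatio_pos p
  set θ : ℝ≥0 := treeRatio r / ω with hθ
  have hθ1 : θ < 1 := by
    rw [hθ, div_lt_one hω0, hω]
    refine NNReal.rpow_lt_rpow_of_exponent_lt one_lt_two ?_
    rw [neg_lt_neg_iff]
    exact one_div_lt_one_div_of_lt (by linarith) (by linarith)
  have h1θ : 0 < 1 - θ := tsub_pos_of_lt hθ1
  set D : ℝ≥0 := (1 - treeRatio r) / (1 - θ) with hD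
  have hmul : ∀ j : ℕ, ((1 - θ) * θ ^ j) * (D * ω ^ j) = levelWeight r j := by
    intro j
    calc _ = ((1 - θ) * D) * (θ * ω) ^ j := by rw [mul_pow]; ring
      _ = _ := by rw [hD, hθ, div_mul_cancel₀ _ hω0.ne', ← hθ, mul_div_cancel₀ _ h1θ.ne',
            levelWeight]
  have h2 : ∀ j : ℕ, (2 : ℝ≥0∞) ^ j * ((D * ω ^ j : ℝ≥0) : ℝ≥0∞) ^ (p - 1) = D ^ (p - 1) := by
    intro j
    rw [ENNReal.coe_mul, ENNReal.mul_rpow_of_nonneg _ _ (by linarith), ENNReal.coe_pow, hω,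
      treeRatio_pow, ← ENNReal.rpow_mul, mul_left_comm, ← ENNReal.rpow_natCast,
      ← ENNReal.rpow_add _ _ (by simp) (by simp)]
    have : (j : ℝ) + j * -(1 / (p - 1)) * (p - 1) = 0 := by
      have : p - 1 ≠ 0 := by linarith
      field_simp; ring
    rw [this, ENNReal.rpow_zero, mul_one]
  refine bdd_strong_of_schur (by linarith)
    (fun x => {y | treeAdj x y}.indicator fun y =>
      (((1 - θ) * θ ^ (y.2.1 : ℕ) : ℝ≥0) : ℝ≥0∞))
    (fun x y => ((D * ω ^ (y.2.1 : ℕ) : ℝ≥0) : ℝ≥0∞)) (D ^ (p - 1)) (fun x y => ?_) (fun x => ?_)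
    fun y => ?_
  · by_cases h : y ∈ {y | treeAdj x y}
    · simp only [treeKer, indicator_of_mem h]
      rw [← ENNReal.coe_mul, hmul]
    · simp only [treeKer, indicator_of_notMem h, zero_mul, le_rfl]
  · rw [tsum_treeSource]
    exact sum_geometric_le hθ1 x.1
  · have : ∀ x : TreeLeaf, treeWeight x * ({y | treeAdj x y}.indicator (fun y =>
        (((1 - θ) * θ ^ (y.2.1 : ℕ) : ℝ≥0) : ℝ≥0∞)) y *
          ((D * ω ^ (y.2.1 : ℕ) : ℝ≥0) : ℝ≥0∞) ^ p) =
        {x : TreeLeaf | treeAdj x y}.indicator (fun x => (treeScale x.1 : ℝ≥0∞) *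
          ((((1 - θ) * θ ^ (y.2.1 : ℕ) : ℝ≥0) : ℝ≥0∞) *
          ((D * ω ^ (y.2.1 : ℕ) : ℝ≥0) : ℝ≥0∞) ^ p)) x := by
      intro x
      by_cases h : treeAdj x y
      · rw [indicator_of_mem (s := {y | treeAdj x y}) h,
          indicator_of_mem (s := {x | treeAdj x y}) h, treeWeight]
      · rw [indicator_of_notMem (s := {y | treeAdj x y}) h,
          indicator_of_notMem (s := {x | treeAdj x y}) h, zero_mul, mul_zero]
    simp_rw [this]
    rw [tsum_treeLeaf_const y fun n => (treeScale n : ℝ≥0∞) *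
          ((((1 - θ) * θ ^ (y.2.1 : ℕ) : ℝ≥0) : ℝ≥0∞) *
          ((D * ω ^ (y.2.1 : ℕ) : ℝ≥0) : ℝ≥0∞) ^ p), treeSourceWeight, ← hmul,
        ENNReal.coe_mul _ (D * _),
        ENNReal.coe_rpow_of_nonneg _ (by linarith), ← h2 y.2.1]
    have hsplit : ((D * ω ^ (y.2.1 : ℕ) : ℝ≥0) : ℝ≥0∞) ^ p =
        ((D * ω ^ (y.2.1 : ℕ) : ℝ≥0) : ℝ≥0∞) ^ (p - 1) * ((D * ω ^ (y.2.1 : ℕ) : ℝ≥0) : ℝ≥0∞) := by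
      conv_rhs => rw [← ENNReal.rpow_one ((D * ω ^ (y.2.1 : ℕ) : ℝ≥0) : ℝ≥0∞), ← ENNReal.rpow_mul]
      rw [one_mul, ← ENNReal.rpow_add_of_nonneg _ _ (by linarith) zero_le_one, sub_add_cancel]
    rw [hsplit]
    refine le_of_eq ?_
    ring

/-- A single interval of length 2^n, tested at half of its kernel value, would force 2^n ρ^{n(p-1)}
= 2^{n(r-p)/(r-1)} to stay bounded. -/
lemma not_bdd_tree_restricted {r p : ℝ} (hr : 1 < r) (hp : 1 ≤ p) (hpr : p < r) :
    ¬ Bdd .restricted p (treeSourceWeight r) treeWeight (kernelOp (treeKer r)) := by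
  intro h
  obtain ⟨C, hC⟩ := restricted_test hp h
  have hr0 : 0 < r - 1 := by linarith
  set c : ℝ≥0 := 1 - treeRatio r with hc
  have hc0 : 0 < c := tsub_pos_of_lt (treeRatio_lt_one hr)
  have hc0' : (c : ℝ≥0∞) ≠ 0 := by simpa using hc0.ne'
  refine not_forall_two_rpow_le (x := (r - p) / (r - 1)) (div_pos (by linarith) hr0)
    (C * c * ((c / 2) ^ p)⁻¹) fun n => ?_
  -- Levels of a tree are smaller than its index, so length 2^n first occurs in tree n + 1.
  let y : TreeSource := ⟨n + 1, Fin.last n, ⟨0, by positivity⟩⟩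
  have h1 := hC y {x | treeAdj x y} (c / 2 * treeRatio r ^ n)
    (mul_pos (half_pos hc0) (pow_pos (treeRatio_pos r) n)) fun x hx => by
      rw [treeKer, indicator_of_mem (show y ∈ {y | treeAdj x y} from hx)]
      refine ENNReal.coe_le_coe.2 (le_of_eq ?_)
      change _ = c * treeRatio r ^ n
      rw [← mul_assoc, mul_div_cancel₀ _ two_ne_zero]
  have h2 : mass treeWeight {x | treeAdj x y} = 2 ^ n * treeScale (n + 1) :=
    tsum_treeLeaf_const y fun n => (treeScale n : ℝ≥0∞)
  have h3 : treeSourceWeight r y = treeScale (n + 1) * (c * treeRatio r ^ n) := by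
    change (treeScale (n + 1) : ℝ≥0∞) * ((c * treeRatio r ^ n : ℝ≥0) : ℝ≥0∞) = _
    push_cast; rfl
  rw [h2, h3, ENNReal.coe_mul, ENNReal.mul_rpow_of_nonneg _ _ (by linarith), ENNReal.coe_pow,
    treeRatio_pow] at h1
  set Q : ℝ≥0∞ := 2 ^ ((n : ℝ) * -(1 / (r - 1))) with hQ
  have hQ0 : Q ≠ 0 := by rw [hQ]; simp
  have hQt : Q ≠ ∞ := by
    rw [hQ]; exact ENNReal.rpow_ne_top_of_ne_zero (by simp) (by simp)
  have h4 : Q ^ p * 2 ^ n = 2 ^ (n * ((r - p) / (r - 1))) * Q := by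
    rw [hQ, ← ENNReal.rpow_mul, ← ENNReal.rpow_natCast, two_rpow_mul,
      ← ENNReal.rpow_add _ _ (by simp) (by simp)]
    congr 1
    field_simp
    ring
  have h5 : ((c / 2 : ℝ≥0) : ℝ≥0∞) ^ p * 2 ^ (n * ((r - p) / (r - 1))) *
      (Q * treeScale (n + 1)) ≤ C * c * (Q * treeScale (n + 1)) := by
    calc _ = ((c / 2 : ℝ≥0) : ℝ≥0∞) ^ p * (2 ^ (n * ((r - p) / (r - 1))) * Q) *
          treeScale (n + 1) := by ring
      _ = ((c / 2 : ℝ≥0) : ℝ≥0∞) ^ p * Q ^ p * (2 ^ n * treeScale (n + 1)) := by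
          rw [← h4]; ring
      _ ≤ _ := h1
      _ = _ := by ring
  have h6 := (ENNReal.mul_le_mul_iff_left (mul_ne_zero hQ0 (treeScale_ne_zero _))
    (ENNReal.mul_ne_top hQt ENNReal.coe_ne_top)).1 h5
  have h7 : (c / 2) ^ p ≠ 0 := (NNReal.rpow_pos (half_pos hc0)).ne'
  have h7' : ((c / 2 : ℝ≥0) : ℝ≥0∞) ^ p = (((c / 2) ^ p : ℝ≥0) : ℝ≥0∞) :=
    (ENNReal.coe_rpow_of_nonneg _ (by linarith)).symm
  rw [ENNReal.coe_mul, ENNReal.coe_inv h7, ENNReal.coe_mul, ← div_eq_mul_inv,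
    ENNReal.le_div_iff_mul_le (.inl (by simpa using h7)) (.inl ENNReal.coe_ne_top), mul_comm, ← h7']
  exact h6

/-- Once a term of the progression is at most M, the tail from there is bounded by a geometric
series; the terms above M are omitted. -/
lemma sum_ite_geometric_le {ρ : ℝ≥0∞} (M : ℝ≥0∞) (k : ℕ) (v : ℝ≥0∞) :
    ∑ j ∈ Finset.range k, (if ρ ^ j * v ≤ M then ρ ^ j * v else 0) ≤ (1 - ρ)⁻¹ * M := by
  induction k generalizing v with
  | zero => simp
  | succ k ih =>
    by_cases hv : v ≤ M
    · calc _ ≤ ∑ j ∈ Finset.range (k + 1), ρ ^ j * v :=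
            Finset.sum_le_sum fun j _ => by split_ifs <;> simp
        _ = (∑ j ∈ Finset.range (k + 1), ρ ^ j) * v := by rw [Finset.sum_mul]
        _ ≤ (1 - ρ)⁻¹ * M := by
            rw [← ENNReal.tsum_geometric]
            gcongr
            exact ENNReal.sum_le_tsum _
    · rw [Finset.sum_range_succ', pow_zero, one_mul, if_neg hv, add_zero]
      simp_rw [pow_succ, mul_assoc]
      exact ih (ρ * v)

/-- One bound decreases in j and the other increases, both geometrically. They cross at the common
value A^{1-1/r} B^{1/r}, and the sum is comparable to this value. -/
lemma tsum_le_of_le_of_le {r : ℝ} (hr : 1 < r) {A B : ℝ≥0∞} (hA : A ≠ ∞) (hB : B ≠ ∞)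
    {T : ℕ → ℝ≥0∞} (h1 : ∀ j, T j ≤ (treeRatio r : ℝ≥0∞) ^ j * A) (h2 : ∀ j, T j ≤ 2 ^ j * B) :
    ∑' j, T j ≤ (2 + (1 - (treeRatio r : ℝ≥0∞))⁻¹) * (A ^ (1 - 1 / r) * B ^ (1 / r)) := by
  rcases eq_or_ne A 0 with hA0 | hA0
  · simp [show ∀ j, T j = 0 from fun j => by simpa [hA0] using h1 j]
  rcases eq_or_ne B 0 with hB0 | hB0
  · simp [show ∀ j, T j = 0 from fun j => by simpa [hB0] using h2 j]
  have hr0 : 0 < r := by linarith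
  have hr1 : 0 < r - 1 := by linarith
  have hrinv : 0 ≤ 1 - 1 / r := by
    rw [sub_nonneg, div_le_one hr0]; exact hr.le
  set M := A ^ (1 - 1 / r) * B ^ (1 / r) with hM
  -- With ρ = `treeRatio r` one has 2/ρ = 2^{r/(r-1)}, so the bounds agree where 2^j = U. Below U
  -- the increasing one is used, from U on the decreasing one.
  set U := (A / B) ^ (1 - 1 / r) with hU
  have hUB : U * B = M := by
    rw [hU, hM, ENNReal.div_rpow_of_nonneg _ _ hrinv, div_eq_mul_inv, mul_assoc,
      ← ENNReal.rpow_neg]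
    congr 1
    conv_lhs => rw [← ENNReal.rpow_one B, ← ENNReal.rpow_mul]
    rw [one_mul, ← ENNReal.rpow_add _ _ hB0 hB]
    congr 1; ring
  have hUA : ∀ j : ℕ, U ≤ 2 ^ j → (treeRatio r : ℝ≥0∞) ^ j * A ≤ M := by
    intro j hj
    have h3 : (treeRatio r : ℝ≥0∞) ^ j ≤ (A / B) ^ (-(1 / r)) := by
      rw [treeRatio_pow, ENNReal.rpow_mul, ENNReal.rpow_natCast, ENNReal.rpow_neg,
        ENNReal.rpow_neg, ENNReal.inv_le_inv]
      calc (A / B) ^ (1 / r) = U ^ (1 / (r - 1)) := by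
            rw [hU, ← ENNReal.rpow_mul]
            congr 1
            field_simp
        _ ≤ _ := ENNReal.rpow_le_rpow hj (by positivity)
    refine (mul_le_mul_left h3 A).trans (le_of_eq ?_)
    rw [hM, ENNReal.rpow_neg, ENNReal.div_rpow_of_nonneg _ _ (by positivity), ENNReal.inv_div
      (.inr (by simp [hA, hA0])) (.inr (by simp [hA, hA0])), div_eq_mul_inv, ← ENNReal.rpow_neg,
      mul_assoc, mul_comm]
    congr 1
    conv_lhs => rw [← ENNReal.rpow_one A, ← ENNReal.rpow_mul]
    rw [one_mul, ← ENNReal.rpow_add _ _ hA0 hA]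
    congr 1; ring
  refine ENNReal.tsum_le_of_sum_range_le fun k => ?_
  calc ∑ j ∈ Finset.range k, T j
      ≤ ∑ j ∈ Finset.range k, ((if (2 : ℝ≥0∞) ^ j < U then (2 : ℝ≥0∞) ^ (j * (1 : ℝ)) else 0) * B +
          if (treeRatio r : ℝ≥0∞) ^ j * A ≤ M then (treeRatio r : ℝ≥0∞) ^ j * A else 0) := by
        refine Finset.sum_le_sum fun j _ => ?_
        by_cases hj : (2 : ℝ≥0∞) ^ j < U
        · rw [if_pos hj, mul_one, ENNReal.rpow_natCast]
          exact le_add_right (h2 j)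
        · rw [if_pos (hUA j (not_lt.1 hj))]
          exact le_add_left (h1 j)
    _ ≤ 2 * U ^ (1 : ℝ) * B + (1 - (treeRatio r : ℝ≥0∞))⁻¹ * M := by
        rw [Finset.sum_add_distrib, ← Finset.sum_mul]
        gcongr
        · exact sum_rpow_le_of_two_pow_lt le_rfl U k
        · exact sum_ite_geometric_le M k A
    _ = _ := by rw [ENNReal.rpow_one, mul_assoc, hUB, add_mul]

/-- Decompose the bilinear form by levels. At level j a leaf lies in at most one interval, which
gives ρ^j times the mass of E; an interval has 2^j leaves, which gives 2^j times the mass of F. Then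
`tsum_le_of_le_of_le` sums the levels. -/
lemma bdd_tree_restricted {r : ℝ} (hr : 1 < r) :
    Bdd .restricted r (treeSourceWeight r) treeWeight (kernelOp (treeKer r)) := by
  have ha : ∑' x, treeWeight x ≠ ∞ := (treeGraph hr).sum_a
  have hb : ∑' y, treeSourceWeight r y ≠ ∞ := by
    have := (treeGraph hr).sum_b
    refine ne_of_eq_of_ne (tsum_congr fun y => ?_) this
    exact (ENNReal.coe_mul _ _).symm
  have hC : 2 + (1 - (treeRatio r : ℝ≥0∞))⁻¹ ≠ ∞ := by
    refine ENNReal.add_ne_top.2 ⟨by simp, ENNReal.inv_ne_top.2 (tsub_pos_of_lt ?_).ne'⟩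
    exact_mod_cast treeRatio_lt_one hr
  have hlw : ∀ j, (levelWeight r j : ℝ≥0∞) ≤ (treeRatio r : ℝ≥0∞) ^ j := fun j => by
    rw [← ENNReal.coe_pow, ENNReal.coe_le_coe]
    exact mul_le_of_le_one_left' tsub_le_self
  refine bdd_restricted_of_bilinear hr.le ha (2 + (1 - (treeRatio r : ℝ≥0∞))⁻¹).toNNReal
    fun E F => ?_
  rw [ENNReal.coe_toNNReal hC]
  have hsplit : ∑' x, ∑' y, E.indicator treeWeight x * F.indicator (treeKer r x) y =
      ∑' j : ℕ, ∑' x, ∑' y : TreeSource, if (y.2.1 : ℕ) = j then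
        E.indicator treeWeight x * F.indicator (treeKer r x) y else 0 := by
    rw [ENNReal.tsum_comm]
    conv_rhs => rw [ENNReal.tsum_comm]
    conv_lhs => rw [ENNReal.tsum_comm]
    refine tsum_congr fun x => ?_
    rw [ENNReal.tsum_comm]
    refine tsum_congr fun y => ?_
    rw [tsum_eq_single (y.2.1 : ℕ) fun j hj => if_neg hj.symm, if_pos rfl]
  rw [hsplit]
  refine tsum_le_of_le_of_le hr (ne_top_of_le_ne_top ha (mass_le_tsum _ _))
    (ne_top_of_le_ne_top hb (mass_le_tsum _ _)) (fun j => ?_) fun j => ?_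
  · unfold mass
    rw [← ENNReal.tsum_mul_left]
    refine ENNReal.tsum_le_tsum fun x => ?_
    calc _ ≤ ∑' y : TreeSource, {y | treeAdj x y}.indicator (fun y =>
            if (y.2.1 : ℕ) = j then (levelWeight r y.2.1 : ℝ≥0∞) else 0) y *
              E.indicator treeWeight x := by
          refine ENNReal.tsum_le_tsum fun y => ?_
          by_cases hj : (y.2.1 : ℕ) = j
          · rw [if_pos hj, mul_comm]
            gcongr
            refine (indicator_le_self' (fun _ _ => zero_le) y).trans ?_
            unfold treeKer
            by_cases h : y ∈ {y | treeAdj x y}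
            · rw [indicator_of_mem h, indicator_of_mem h, if_pos hj]
            · rw [indicator_of_notMem h]; exact zero_le
          · rw [if_neg hj]; exact zero_le
      _ ≤ _ := by
          rw [ENNReal.tsum_mul_right]
          gcongr
          rw [tsum_treeSource]
          refine le_trans ?_ (hlw j)
          change ∑ i : Fin x.1, (if (i : ℕ) = j then (levelWeight r i : ℝ≥0∞) else 0) ≤ _
          rw [Fin.sum_univ_eq_sum_range
            (fun i => if i = j then (levelWeight r i : ℝ≥0∞) else 0), Finset.sum_ite_eq']
          split_ifs
          exacts [le_rfl, zero_le]
  · rw [ENNReal.tsum_comm]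
    unfold mass
    rw [← ENNReal.tsum_mul_left]
    refine ENNReal.tsum_le_tsum fun y => ?_
    by_cases hy : (y.2.1 : ℕ) = j ∧ y ∈ F
    · obtain ⟨rfl, hF⟩ := hy
      simp only [if_true, indicator_of_mem hF]
      calc _ ≤ ∑' x : TreeLeaf, {x : TreeLeaf | treeAdj x y}.indicator (fun x =>
              (treeScale x.1 : ℝ≥0∞) * levelWeight r y.2.1) x := by
            refine ENNReal.tsum_le_tsum fun x => ?_
            unfold treeKer
            by_cases h : treeAdj x y
            · rw [indicator_of_mem (s := {y | treeAdj x y}) h,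
                indicator_of_mem (s := {x | treeAdj x y}) h]
              gcongr
              exact indicator_le_self' (fun _ _ => zero_le) x
            · rw [indicator_of_notMem (s := {y | treeAdj x y}) h, mul_zero]
              exact zero_le
        _ = _ := tsum_treeLeaf_const y fun n => (treeScale n : ℝ≥0∞) * levelWeight r y.2.1
    · refine le_trans (le_of_eq ?_) zero_le
      refine ENNReal.tsum_eq_zero.2 fun x => ?_
      by_cases hj : (y.2.1 : ℕ) = j
      · rw [if_pos hj, indicator_of_notMem (fun hF => hy ⟨hj, hF⟩), mul_zero]
      · rw [if_neg hj]

/-- On the n-th tree take ρ^{-j} on the intervals of length 2^j. All n levels add the same amount c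
= 1 - ρ to the average at each leaf, giving cn, and each level has the same share of the r-th power
of the norm. The inequality would bound n^{r-1}, although r > 1. -/
lemma not_bdd_tree_weak {r : ℝ} (hr : 1 < r) :
    ¬ Bdd .weak r (treeSourceWeight r) treeWeight (kernelOp (treeKer r)) := by
  intro h
  obtain ⟨C, hC⟩ := weak_apply hr.le h
  have hr0 : 0 < r - 1 := by linarith
  set c : ℝ≥0 := 1 - treeRatio r with hc
  have hc0 : 0 < c := tsub_pos_of_lt (treeRatio_lt_one hr)
  set q := treeRatio r with hq
  have hq0 : q ≠ 0 := (treeRatio_pos r).ne'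
  have hlw : ∀ j, (levelWeight r j) * (q ^ j)⁻¹ = c := fun j => by
    unfold levelWeight
    rw [mul_assoc, mul_inv_cancel₀ (pow_ne_zero _ hq0), mul_one]
  have key : ∀ n : ℕ, 0 < n → ((c / 2 : ℝ≥0) : ℝ≥0∞) ^ r * n ^ (r - 1) ≤ C * c := by
    intro n hn
    let φ : TreeSource → ℝ≥0 := fun y => if y.1 = n then (q ^ (y.2.1 : ℕ))⁻¹ else 0
    have h1 := hC φ (c / 2 * n) (mul_pos (half_pos hc0) (by exact_mod_cast hn))
    have h2 : (2 : ℝ≥0∞) ^ n * treeScale n ≤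
        mass treeWeight {x | ((c / 2 * n : ℝ≥0) : ℝ≥0∞) < kernelOp (treeKer r) φ x} := by
      have hop : ∀ i : Fin (2 ^ n), kernelOp (treeKer r) φ ⟨n, i⟩ = (c * n : ℝ≥0) := by
        intro i
        rw [kernelOp_treeKer]
        simp only [φ, treeParent, if_true, ← ENNReal.coe_mul, hlw]
        simp [mul_comm]
      unfold mass
      rw [ENNReal.tsum_sigma']
      refine le_trans ?_ (ENNReal.le_tsum n)
      rw [tsum_fintype]
      refine le_of_eq ?_
      have : ∀ i : Fin (2 ^ n), {x | ((c / 2 * n : ℝ≥0) : ℝ≥0∞) <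
          kernelOp (treeKer r) φ x}.indicator treeWeight ⟨n, i⟩ = treeScale n := by
        intro i
        refine indicator_of_mem ?_ _
        rw [mem_ofPred_eq, hop, ENNReal.coe_lt_coe]
        exact mul_lt_mul_of_pos_right (half_lt_self hc0) (by exact_mod_cast hn)
      rw [Finset.sum_congr rfl fun i _ => this i]
      simp
    have h3 : ∑' y, treeSourceWeight r y * (φ y : ℝ≥0∞) ^ r =
        n * c * (2 ^ n * treeScale n) := by
      have : ∀ y : TreeSource, treeSourceWeight r y * (φ y : ℝ≥0∞) ^ r =
          if y.1 = n then (treeScale y.1 : ℝ≥0∞) * (c * (q ^ (y.2.1 : ℕ) *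
            ((q ^ (y.2.1 : ℕ) : ℝ≥0∞)⁻¹) ^ r)) else 0 := by
        intro y
        by_cases hy : y.1 = n
        · simp only [φ, if_pos hy, treeSourceWeight,
            show ∀ j, levelWeight r j = c * q ^ j from fun _ => rfl]
          rw [ENNReal.coe_inv (pow_ne_zero _ hq0)]
          push_cast
          ring
        · simp only [φ, if_neg hy, ENNReal.coe_zero]
          rw [ENNReal.zero_rpow_of_pos (by linarith), mul_zero]
      simp_rw [this]
      rw [tsum_treeSource_eq fun m j => if m = n then (treeScale m : ℝ≥0∞) *
        (c * (q ^ (j : ℕ) * ((q ^ (j : ℕ) : ℝ≥0∞)⁻¹) ^ r)) else 0, tsum_eq_single n]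
      · have hj : ∀ j : Fin n, (2 : ℝ≥0∞) ^ (n - j) * (if n = n then (treeScale n : ℝ≥0∞) *
            (c * (q ^ (j : ℕ) * ((q ^ (j : ℕ) : ℝ≥0∞)⁻¹) ^ r)) else 0) =
            c * (2 ^ n * treeScale n) := by
          intro j
          have hqj : (q : ℝ≥0∞) ^ (j : ℕ) * ((q ^ (j : ℕ) : ℝ≥0∞)⁻¹) ^ r = 2 ^ (j : ℕ) := by
            rw [hq, treeRatio_pow, ← ENNReal.rpow_neg, ← ENNReal.rpow_mul,
              ← ENNReal.rpow_add _ _ (by simp) (by simp), ← ENNReal.rpow_natCast]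
            congr 1
            field_simp
            ring
          rw [if_pos rfl, hqj]
          calc _ = c * ((2 : ℝ≥0∞) ^ (n - (j : ℕ)) * 2 ^ (j : ℕ) * treeScale n) := by ring
            _ = _ := by rw [← pow_add, Nat.sub_add_cancel j.2.le]
        rw [Finset.sum_congr rfl fun j _ => hj j]
        simp [mul_assoc]
      · intro m hm
        simp [hm]
    rw [h3] at h1
    set W : ℝ≥0∞ := 2 ^ n * treeScale n with hW
    have hW0 : W ≠ 0 := mul_ne_zero (by simp) (treeScale_ne_zero n)
    have hWt : W ≠ ∞ := ENNReal.mul_ne_top (by simp) ENNReal.coe_ne_top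
    have hn0 : (n : ℝ≥0∞) ≠ 0 := by exact_mod_cast hn.ne'
    have hnt : (n : ℝ≥0∞) ≠ ∞ := ENNReal.natCast_ne_top n
    have h4 : ((c / 2 : ℝ≥0) : ℝ≥0∞) ^ r * n ^ (r - 1) * (n * W) ≤ C * c * (n * W) := by
      calc _ = ((c / 2 * n : ℝ≥0) : ℝ≥0∞) ^ r * W := by
            rw [ENNReal.coe_mul, ENNReal.mul_rpow_of_nonneg _ _ (by linarith), ENNReal.coe_natCast]
            have : (n : ℝ≥0∞) ^ r = n ^ (r - 1) * n := by
              conv_rhs => rw [← ENNReal.rpow_one (n : ℝ≥0∞), ← ENNReal.rpow_mul, one_mul]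
              rw [← ENNReal.rpow_add _ _ hn0 hnt, sub_add_cancel]
            rw [this]; ring
        _ ≤ _ := (mul_le_mul_right h2 _).trans h1
        _ = _ := by ring
    exact (ENNReal.mul_le_mul_iff_left (mul_ne_zero hn0 hW0) (ENNReal.mul_ne_top hnt hWt)).1 h4
  refine not_forall_two_rpow_le hr0 (C * c * ((c / 2) ^ r)⁻¹) fun k => ?_
  have h1 := key (2 ^ k) (by positivity)
  have h7 : (c / 2) ^ r ≠ 0 := (NNReal.rpow_pos (half_pos hc0)).ne'
  have h7' : ((c / 2 : ℝ≥0) : ℝ≥0∞) ^ r = (((c / 2) ^ r : ℝ≥0) : ℝ≥0∞) :=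
    (ENNReal.coe_rpow_of_nonneg _ (by linarith)).symm
  rw [ENNReal.coe_mul, ENNReal.coe_inv h7, ENNReal.coe_mul, ← div_eq_mul_inv,
    ENNReal.le_div_iff_mul_le (.inl (by simpa using h7)) (.inl ENNReal.coe_ne_top), mul_comm, ← h7',
    ENNReal.rpow_mul, ENNReal.rpow_natCast]
  exact_mod_cast h1

/-- At the exponent `r` the restricted weak type inequality holds but the weak one does not. -/
theorem exists_leafGraph_restricted {r : ℝ} (hr : 1 < r) : ∃ G : LeafGraph,
    (∀ p, r < p → G.HasType .strong p) ∧ G.HasType .restricted r ∧ ¬ G.HasType .weak r ∧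
    ∀ p, 1 ≤ p → p < r → ¬ G.HasType .restricted p := by
  refine ⟨treeGraph hr, fun p hp => ?_, ?_, ?_, fun p hp hpr => ?_⟩ <;>
    rw [treeGraph_hasType_iff]
  exacts [bdd_tree_strong hr hp, bdd_tree_restricted hr, not_bdd_tree_weak hr,
    not_bdd_tree_restricted hr hp hpr]

end Trees

/-! ### Realizing every admissible configuration -/

/-- Every admissible triple of sets of exponents is realized by a graph. -/
theorem exists_leafGraph_hasType_iff {P : Kind → Set ℝ≥0∞} (hs : IsExponentRange (P .strong))
    (hr : IsExponentRange (P .restricted)) (hsw : P .strong ⊆ P .weak)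
    (hwr : P .weak ⊆ P .restricted) (hrs : P .restricted ⊆ closure (P .strong))
    (hone : P .restricted = Icc 1 ∞ → P .weak = Icc 1 ∞) :
    ∃ G : LeafGraph, ∀ k p, 1 ≤ p → p ≠ ∞ → (G.HasType k p.toReal ↔ p ∈ P k) := by
  have hsub : ∀ k, P .strong ⊆ P k ∧ P k ⊆ P .restricted := by
    rintro (_ | _ | _)
    exacts [⟨le_rfl, hsw.trans hwr⟩, ⟨hsw, hwr⟩, ⟨hsw.trans hwr, le_rfl⟩]
  have hreal : ∀ {p : ℝ≥0∞}, 1 ≤ p → p ≠ ∞ → 1 ≤ p.toReal := fun h1 ht => by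
    simpa using (ENNReal.toReal_le_toReal ENNReal.one_ne_top ht).2 h1
  rcases hr with hr | ⟨p₀, h1, hlt, hr⟩
  · obtain ⟨G, hG⟩ := exists_leafGraph_none
    refine ⟨G, fun k p hp ht => iff_of_false (fun h => hG _ (hreal hp ht)
      (h.restricted (hreal hp ht))) fun h => ht ?_⟩
    simpa [hr] using (hsub k).2 h
  have hIoc : Ioc p₀ ∞ ⊆ P .restricted := by
    rcases hr with hr | hr <;> rw [hr]
    exact Ioc_subset_Icc_self
  have hIcc : P .restricted ⊆ Icc p₀ ∞ := by
    rcases hr with hr | hr <;> rw [hr]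
    exact Ioc_subset_Icc_self
  -- The closure condition excludes a strong range starting after p₀, or reduced to {∞}, since the
  -- restricted range contains everything beyond p₀.
  have hstrong : Ioc p₀ ∞ ⊆ P .strong := by
    rcases hs with hs | ⟨q₀, -, -, hs⟩
    · exfalso
      have h2 := hrs (hIoc (show p₀ + 1 ∈ Ioc p₀ ∞ from
        ⟨ENNReal.lt_add_right hlt.ne one_ne_zero, le_top⟩))
      rw [hs, closure_singleton, mem_singleton_iff] at h2
      exact (ENNReal.add_ne_top.2 ⟨hlt.ne, ENNReal.one_ne_top⟩) h2
    · have hcl : closure (P .strong) ⊆ Icc q₀ ∞ := by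
        refine isClosed_Icc.closure_subset_iff.2 ?_
        rcases hs with hs | hs <;> rw [hs]
        exact Ioc_subset_Icc_self
      have hq : q₀ ≤ p₀ := by
        refine le_of_forall_gt_imp_ge_of_dense fun z hz => ?_
        exact (hcl (hrs (hIoc ⟨hz, le_top⟩))).1
      rcases hs with hs | hs <;> rw [hs]
      · exact fun z hz => ⟨hq.trans hz.1.le, hz.2⟩
      · exact fun z hz => ⟨hq.trans_lt hz.1, hz.2⟩
  have hr1 : 1 ≤ p₀.toReal := hreal h1 hlt.ne
  suffices h : ∃ G : LeafGraph, (∀ p, p₀.toReal < p → G.HasType .strong p) ∧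
      (∀ p, 1 ≤ p → p < p₀.toReal → ¬ G.HasType .restricted p) ∧
      ∀ k, G.HasType k p₀.toReal ↔ p₀ ∈ P k by
    obtain ⟨G, hgt, hltG, heq⟩ := h
    refine ⟨G, fun k p hp ht => ?_⟩
    have hp1 := hreal hp ht
    rcases lt_trichotomy p p₀ with h | rfl | h
    · refine iff_of_false (fun hk => hltG _ hp1 ((ENNReal.toReal_lt_toReal ht hlt.ne).2 h)
        (hk.restricted hp1)) fun hk => ?_
      exact absurd (hIcc ((hsub k).2 hk)).1 (not_le.2 h)
    · exact heq k
    · exact iff_of_true ((hgt _ ((ENNReal.toReal_lt_toReal hlt.ne ht).2 h)).of_strong k hp1)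
        ((hsub k).1 (hstrong ⟨h, le_top⟩))
  -- Membership of p₀ is monotone along strong, weak, restricted, so four cases remain, each with
  -- its own graph.
  by_cases hmr : p₀ ∈ P .restricted
  · by_cases hmw : p₀ ∈ P .weak
    · by_cases hms : p₀ ∈ P .strong
      · obtain ⟨G, hG, hG'⟩ := exists_leafGraph_closed hr1
        exact ⟨G, fun p hp => hG p hp.le, hG', fun k =>
          iff_of_true ((hG _ le_rfl).of_strong k hr1) ((hsub k).1 hms)⟩
      · obtain ⟨G, hG, hw, hns, hG'⟩ := exists_leafGraph_weak hr1
        refine ⟨G, hG, hG', ?_⟩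
        rintro (_ | _ | _)
        exacts [iff_of_false hns hms, iff_of_true hw hmw, iff_of_true (hw.restricted hr1) hmr]
    -- The trees require r > 1; an endpoint 1 with restricted but not weak type is excluded by
    -- `hone`.
    · have hne : 1 < p₀ := by
        refine lt_of_le_of_ne h1 ?_
        rintro rfl
        refine hmw ?_
        rcases hr with hr | hr
        · rw [hone hr]; exact ⟨le_rfl, le_top⟩
        · rw [hr] at hmr; exact absurd hmr.1 (lt_irrefl _)
      have hr1' : 1 < p₀.toReal := by
        simpa using (ENNReal.toReal_lt_toReal ENNReal.one_ne_top hlt.ne).2 hne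
      obtain ⟨G, hG, hrr, hnw, hG'⟩ := exists_leafGraph_restricted hr1'
      refine ⟨G, hG, hG', ?_⟩
      rintro (_ | _ | _)
      · exact iff_of_false (fun h => hnw (h.of_strong _ hr1)) fun h => hmw (hsw h)
      · exact iff_of_false hnw hmw
      · exact iff_of_true hrr hmr
  · obtain ⟨G, hG, hG'⟩ := exists_leafGraph_open hr1
    exact ⟨G, hG, fun p hp hpr => hG' p hp hpr.le, fun k =>
      iff_of_false (fun h => hG' _ hr1 le_rfl (h.restricted hr1)) fun h => hmr ((hsub k).2 h)⟩

lemma IsExponentRange.top_mem {P : Set ℝ≥0∞} (h : IsExponentRange P) : ∞ ∈ P := by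
  rcases h with rfl | ⟨p₀, -, hlt, rfl | rfl⟩
  exacts [rfl, ⟨le_top, le_rfl⟩, ⟨hlt, le_rfl⟩]

end MaximalTypes

end

theorem theorem2p1p2 (Psc Pwc Prc Ps Pw Pr : Set ℝ≥0∞)
    (hPsc : MaximalTypes.IsExponentRange Psc) (hPwc : MaximalTypes.IsExponentRange Pwc)
    (hPrc : MaximalTypes.IsExponentRange Prc) (hPs : MaximalTypes.IsExponentRange Ps)
    (hPw : MaximalTypes.IsExponentRange Pw) (hPr : MaximalTypes.IsExponentRange Pr)
    (hs : Ps ⊆ Psc) (hw : Pw ⊆ Pwc) (hr : Pr ⊆ Prc)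
    (hswc : Psc ⊆ Pwc) (hwrc : Pwc ⊆ Prc) (hrsc : Prc ⊆ closure Psc)
    (hsw : Ps ⊆ Pw) (hwr : Pw ⊆ Pr) (hrs : Pr ⊆ closure Ps)
    (h1c : Prc = Set.Icc 1 ∞ → Pwc = Set.Icc 1 ∞)
    (h1 : Pr = Set.Icc 1 ∞ → Pw = Set.Icc 1 ∞) :
    ∃ (Z : Type) (_ : Nonempty Z) (_ : MetricSpace Z) (_ : MeasurableSpace Z)
      (_ : BorelSpace Z) (μ : MeasureTheory.Measure Z),
      MaximalTypes.BallsFinitePos μ ∧ ¬ MaximalTypes.IsDoubling μ ∧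
      ∀ p : ℝ≥0∞, 1 ≤ p →
        (MaximalTypes.StrongType (MaximalTypes.centeredMaximal μ) p μ ↔ p ∈ Psc) ∧
        (MaximalTypes.WeakType (MaximalTypes.centeredMaximal μ) p μ ↔ p ∈ Pwc) ∧
        (MaximalTypes.RestrictedWeakType (MaximalTypes.centeredMaximal μ) p μ ↔ p ∈ Prc) ∧
        (MaximalTypes.StrongType (MaximalTypes.noncenteredMaximal μ) p μ ↔ p ∈ Ps) ∧
        (MaximalTypes.WeakType (MaximalTypes.noncenteredMaximal μ) p μ ↔ p ∈ Pw) ∧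
        (MaximalTypes.RestrictedWeakType (MaximalTypes.noncenteredMaximal μ) p μ ↔ p ∈ Pr) := by
  let Pc : MaximalTypes.Kind → Set ℝ≥0∞
    | .strong => Psc
    | .weak => Pwc
    | .restricted => Prc
  let P : MaximalTypes.Kind → Set ℝ≥0∞
    | .strong => Ps
    | .weak => Pw
    | .restricted => Pr
  obtain ⟨G₁, hG₁⟩ := MaximalTypes.exists_leafGraph_hasType_iff (P := Pc)
    hPsc hPrc hswc hwrc hrsc h1c
  obtain ⟨G₂, hG₂⟩ := MaximalTypes.exists_leafGraph_hasType_iff (P := P) hPs hPr hsw hwr hrs h1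
  obtain ⟨Z, i₁, i₂, i₃, i₄, μ, hfin, hdoub, htop, htypes⟩ := MaximalTypes.exists_space G₁ G₂
  have hsub : ∀ k, P k ⊆ Pc k := by
    rintro (_ | _ | _)
    exacts [hs, hw, hr]
  have hmem : ∀ k, ∞ ∈ P k := by
    rintro (_ | _ | _)
    exacts [hPs.top_mem, hPw.top_mem, hPr.top_mem]
  have key : ∀ k p, 1 ≤ p →
      (MaximalTypes.HasKind k (MaximalTypes.centeredMaximal μ) p μ ↔ p ∈ Pc k) ∧
      (MaximalTypes.HasKind k (MaximalTypes.noncenteredMaximal μ) p μ ↔ p ∈ P k) := by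
    intro k p hp
    rcases eq_or_ne p ∞ with rfl | ht
    · exact ⟨iff_of_true (htop k).1 (hsub k (hmem k)), iff_of_true (htop k).2 (hmem k)⟩
    · obtain ⟨h₁, h₂⟩ := htypes k p hp ht
      rw [h₁, h₂, hG₁ k p hp ht, hG₂ k p hp ht]
      -- The noncentered operator needs both graphs; the inclusion in the centered set makes the
      -- condition from the first one redundant.
      exact ⟨Iff.rfl, and_iff_right_of_imp fun h => hsub k h⟩
  refine ⟨Z, i₁, i₂, i₃, i₄, μ, hfin, hdoub, fun p hp => ?_⟩
  obtain ⟨s₁, s₂⟩ := key .strong p hp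
  obtain ⟨w₁, w₂⟩ := key .weak p hp
  obtain ⟨r₁, r₂⟩ := key .restricted p hp
  exact ⟨s₁, w₁, r₁, s₂, w₂, r₂⟩
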